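/- **Setting.** Let $p$ be a prime, $k$ a perfect field of characteristic $p$, $W=W(k)$, $K_0=W[1/p]$, and let $E=u^e+c_{e-1}u^{e-1}+\dots+c_0\in W[u]$, $e\ge 1$, be an Eisenstein polynomial, i.e. the minimal polynomial over $K_0$ of a uniformizer $\pi_K$ of a totally ramified extension $K$ of $K_0$ of degree $e$. Let $\mathfrak S=W[[u]]\subset\mathcal A=K_0[[u]]$, with the Frobenius $\varphi$ that is the Witt vector Frobenius on $K_0$ and maps $u$ to $u^p$. For a module $M$ over a ring $A$ with endomorphism $\varphi$ put ${}^{\varphi}M=M\otimes_{A,\varphi}A$. Let $\mathcal O\subset\mathcal A$ be the ring of power series that converge on the open unit disc, $\lambda=\prod_{n\ge0}\varphi^n(E/E(0))\in\mathcal O$, and for $0<r<1$ let $|\sum x_nu^n|_r=\sup_n|x_n|r^n$ on $\mathcal O$, extended to $\mathcal O[1/\lambda]$ by $|x\lambda^{-n}|_r=|x|_r|\lambda|_r^{-n}$. Let $\widehat{\mathfrak S}_n$ be the completion of $\mathfrak S[1/p]$ for the ideal generated by $\varphi^n(E)$, and $\widehat{\mathfrak S}=\widehat{\mathfrak S}_0$;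 there are maps $\mathcal O[1/\lambda]\to\widehat{\mathfrak S}_n[1/\varphi^n(E)]$ and $\varphi^n:\widehat{\mathfrak S}[1/E]\to\widehat{\mathfrak S}_n[1/\varphi^n(E)]$. A *pseudo-iso-$\varphi/\mathfrak S$-module* is a free $\mathfrak S[1/p]$-module $\mathfrak N$ of finite rank with an isomorphism $\varphi_{\mathfrak N}:{}^{\varphi}\mathfrak N[1/E]\to\mathfrak N[1/E]$ such that for some integers $s\le t$, some free $\mathfrak S$-module $\mathfrak M$ with $\mathfrak M[1/p]=\mathfrak N$ and some constant $C$, the map $\Phi_n=\varphi_{\mathfrak N}\circ{}^{\varphi}\varphi_{\mathfrak N}\circ\dots\circ{}^{\varphi^{n-1}}\varphi_{\mathfrak N}$ satisfies, for all $n\ge1$, $$\Phi_n\in p^{-C}\big(E\cdots\varphi^{n-1}(E)\big)^{s}\operatorname{Hom}_{\mathfrak S}({}^{\varphi^n}\mathfrak M,\mathfrak M),\qquad \Phi_n^{-1}\in p^{-C}\big(E\cdots\varphi^{n-1}(E)\big)^{-t}\operatorname{Hom}_{\mathfrak S}(\mathfrak M,{}^{\varphi^n}\mathfrak M).$$ Morphisms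 are the $\mathfrak S[1/p]$-linear maps that commute with $\varphi$. A *$\varphi$-module of Hodge–Pink* is a triple $(D,\varphi_D,V_D)$ of a finite dimensional $K_0$-vector space $D$, an isomorphism $\varphi_D:{}^{\varphi}D\to D$, and a free $\widehat{\mathfrak S}$-lattice $V_D$ in ${}^{\varphi}D\otimes_{K_0}\widehat{\mathfrak S}[1/E]$. Morphisms $D'\to D$ are the $K_0$-linear maps $f$ that commute with $\varphi$ and satisfy $({}^{\varphi}f\otimes1)(V_{D'})\subset V_D$. For a pseudo-iso-$\varphi/\mathfrak S$-module $\mathfrak N$ put $D=\mathfrak N\otimes_{\mathfrak S[1/p]}K_0=\mathfrak N/u\mathfrak N$ and $\varphi_D=\varphi_{\mathfrak N}\bmod u$. There is a unique $\mathcal O[1/\lambda]$-linear map $\xi:D\otimes_{K_0}\mathcal O[1/\lambda]\to\mathfrak N\otimes_{\mathfrak S[1/p]}\mathcal O[1/\lambda]$ that is congruent to $1$ modulo $u$ and satisfies $\xi\circ(\varphi_D\otimes1)=(\varphi_{\mathfrak N}\otimes1)\circ{}^{\varphi}\xi$; it is an isomorphism and functorial in $\mathfrak N$. With $$V_D=(\varphi_D\otimes1)^{-1}\big(\xi^{-1}(\mathfrak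 N\otimes_{\mathfrak S[1/p]}\widehat{\mathfrak S})\big)$$ this defines a functor $\mathbb D_{\mathrm{iso}}:\mathfrak N\mapsto(D,\varphi_D,V_D)$ from pseudo-iso-$\varphi/\mathfrak S$-modules to $\varphi$-modules of Hodge–Pink. For a $\varphi$-module of Hodge–Pink $D$ let $\widetilde{\mathfrak N}(D)$ be the set of all $x\in D\otimes_{K_0}\mathcal O[1/\lambda]$ such that * for every $n\ge0$ the image of $x$ in $D\otimes_{K_0}\widehat{\mathfrak S}_n[1/\varphi^n(E)]$ belongs to the $\widehat{\mathfrak S}_n$-lattice $\varphi_D\circ\dots\circ{}^{\varphi^n}\varphi_D({}^{\varphi^n}V_D)$; * there is a constant $C\in\mathbb R$ such that $\big|(\varphi_D\circ\dots\circ{}^{\varphi^{n-1}}\varphi_D)^{-1}x\big|_{|\pi_K|^{p^{-n}}}\le C$ for every $n\ge0$, where the norm is the maximum of the norms of the coordinates in the basis of ${}^{\varphi^n}D$ induced by a fixed basis of $D$ (the condition does not depend on the basis). **Theorem.** (a) For every pseudo-iso-$\varphi/\mathfrak S$-module $\mathfrak N$ one has $\xi^{-1}(\mathfrak N)=\widetilde{\mathfrak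 N}(\mathbb D_{\mathrm{iso}}(\mathfrak N))$ as subsets of $D\otimes_{K_0}\mathcal O[1/\lambda]$. (b) The functor $\mathbb D_{\mathrm{iso}}$ is fully faithful. -/

import Mathlib

/-! # Pseudo-iso-`φ/𝔖`-modules and `φ`-modules of Hodge–Pink -/

open CategoryTheory
open scoped TensorProduct

universe u v w

namespace HodgePink

noncomputable section

section CoefficientField

variable (p : ℕ) [hp : Fact p.Prime] (k : Type u) [Field k] [CharP k p] [PerfectRing k p]

/-- `K₀ = Frac W(k)`. -/
def K0 : Type u := FractionRing (WittVector p k)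

instance : Field (K0 p k) := inferInstanceAs (Field (FractionRing (WittVector p k)))

instance : Algebra (WittVector p k) (K0 p k) :=
  inferInstanceAs (Algebra (WittVector p k) (FractionRing (WittVector p k)))

instance : IsFractionRing (WittVector p k) (K0 p k) :=
  inferInstanceAs (IsFractionRing (WittVector p k) (FractionRing (WittVector p k)))

/-- The Frobenius `φ` of `K₀`. -/
def phi0 : K0 p k →+* K0 p k := WittVector.FractionRing.frobeniusRingHom p k

theorem one_lt_p : (1 : NNReal) < (p : NNReal) := by exact_mod_cast hp.out.one_lt

/-- The `p`-adic absolute value on `K₀`, normalised by `|p| = 1 / p`. -/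
def absK : AbsoluteValue (K0 p k) ℝ :=
  (IsDiscreteValuationRing.maximalIdeal (WittVector p k)).adicAbv (one_lt_p p)

theorem absK_nonarch : IsNonarchimedean (absK p k) :=
  IsDedekindDomain.HeightOneSpectrum.isNonarchimedean_adicAbv _ _

variable {p k}

theorem absK_add (x y : K0 p k) : absK p k (x + y) ≤ max (absK p k x) (absK p k y) :=
  absK_nonarch p k x y

theorem absK_int (w : WittVector p k) : absK p k (algebraMap _ _ w) ≤ 1 :=
  IsDedekindDomain.HeightOneSpectrum.adicAbv_coe_le_one _ _ _

theorem mem_maximalIdeal_iff (w : WittVector p k) :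
    w ∈ (IsDiscreteValuationRing.maximalIdeal (WittVector p k)).asIdeal ↔
      (p : WittVector p k) ∣ w := by
  have h := (IsDiscreteValuationRing.irreducible_iff_uniformizer (p : WittVector p k)).1
    (WittVector.irreducible p)
  change w ∈ IsLocalRing.maximalIdeal (WittVector p k) ↔ _
  rw [h, Ideal.mem_span_singleton]

theorem absK_unit (w : (WittVector p k)ˣ) : absK p k (algebraMap _ _ (w : WittVector p k)) = 1 := by
  refine (IsDedekindDomain.HeightOneSpectrum.adicAbv_coe_eq_one_iff _ _ _).2 fun h => ?_
  rw [mem_maximalIdeal_iff] at h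
  exact (WittVector.irreducible p).not_isUnit (isUnit_of_dvd_unit h w.isUnit)

theorem absK_p : absK p k (p : K0 p k) = (p : ℝ)⁻¹ := by
  have h := (IsDiscreteValuationRing.irreducible_iff_uniformizer (p : WittVector p k)).1
    (WittVector.irreducible p)
  have h0 : (p : WittVector p k) ≠ 0 := (WittVector.irreducible p).ne_zero
  have h1 := IsDedekindDomain.HeightOneSpectrum.intValuation_singleton
    (IsDiscreteValuationRing.maximalIdeal (WittVector p k)) h0 h
  have h2 : (p : K0 p k) = algebraMap (WittVector p k) (K0 p k) p := by simp
  rw [absK, h2, IsDedekindDomain.HeightOneSpectrum.adicAbv_of_algebraMap]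
  simp [IsDedekindDomain.HeightOneSpectrum.intAdicAbv,
    IsDedekindDomain.HeightOneSpectrum.intAdicAbvDef, h1]
  rw [WithZeroMulInt.toNNReal_neg_apply _ (by simp)]
  simp only [NNReal.coe_zpow, NNReal.coe_natCast]
  exact zpow_one _

theorem p_pos : (0 : ℝ) < p := by exact_mod_cast hp.out.pos

theorem p_ne_zero : (p : K0 p k) ≠ 0 := by
  intro h
  have := absK_p (p := p) (k := k)
  rw [h, map_zero] at this
  exact (inv_pos.2 (p_pos (p := p))).ne this

theorem exists_int {x : K0 p k} (hx : absK p k x ≤ 1) :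
    ∃ w : WittVector p k, algebraMap _ _ w = x := by
  have h2 : (IsDiscreteValuationRing.maximalIdeal (WittVector p k)).valuation (K0 p k) x ≤ 1 := by
    have : WithZeroMulInt.toNNReal (ne_zero_of_lt (one_lt_p p))
        ((IsDiscreteValuationRing.maximalIdeal (WittVector p k)).valuation (K0 p k) x) ≤ 1 := hx
    have h1 := map_one (WithZeroMulInt.toNNReal (ne_zero_of_lt (one_lt_p p)))
    exact (WithZeroMulInt.toNNReal_strictMono (one_lt_p p)).le_iff_le.1 (this.trans h1.symm.le)
  exact IsDiscreteValuationRing.exists_lift_of_le_one h2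

theorem absK_phi0 (x : K0 p k) : absK p k (phi0 p k x) = absK p k x := by
  have hW : ∀ w : WittVector p k, phi0 p k (algebraMap _ _ w) =
      algebraMap _ _ (WittVector.frobenius w) := fun w => by
    change WittVector.FractionRing.frobeniusRingHom p k
      (algebraMap (WittVector p k) (FractionRing (WittVector p k)) w) =
        algebraMap (WittVector p k) (FractionRing (WittVector p k)) (WittVector.frobenius w)
    simp [WittVector.FractionRing.frobeniusRingHom, WittVector.FractionRing.frobenius]
  have key : ∀ w : WittVector p k, absK p k (phi0 p k (algebraMap _ _ w)) =
      absK p k (algebraMap _ _ w) := by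
    intro w
    by_cases h : w = 0
    · simp [h]
    obtain ⟨n, b, rfl⟩ := WittVector.exists_eq_pow_p_mul' w h
    have h1 : absK p k (phi0 p k (algebraMap _ _ (b : WittVector p k))) = 1 := by
      rw [hW]
      exact absK_unit (Units.map (WittVector.frobenius : WittVector p k →+* _).toMonoidHom b)
    simp only [map_mul, map_pow, map_natCast, h1, absK_unit]
  obtain ⟨a, b, -, rfl⟩ := IsFractionRing.div_surjective (A := WittVector p k) x
  simp only [map_div₀, key]

theorem absK_p_lt_one : absK p k (p : K0 p k) < 1 := by
  rw [absK_p]; exact inv_lt_one_of_one_lt₀ (by exact_mod_cast hp.out.one_lt)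

theorem exists_pow_mul_le (C : ℝ) : ∃ n : ℕ, C * ((p : ℝ)⁻¹) ^ n ≤ 1 := by
  have h1 : (p : ℝ)⁻¹ < 1 := inv_lt_one_of_one_lt₀ (by exact_mod_cast hp.out.one_lt)
  have h0 : (0 : ℝ) ≤ (p : ℝ)⁻¹ := inv_nonneg.2 (p_pos (p := p)).le
  have := (tendsto_pow_atTop_nhds_zero_of_lt_one h0 h1).const_mul C
  rw [mul_zero] at this
  obtain ⟨n, hn⟩ := (this.eventually (gt_mem_nhds one_pos)).exists
  exact ⟨n, hn.le⟩

theorem absK_sum_le {ι : Type*} (s : Finset ι) (f : ι → K0 p k) {C : ℝ} (hC : 0 ≤ C)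
    (h : ∀ i ∈ s, absK p k (f i) ≤ C) : absK p k (∑ i ∈ s, f i) ≤ C := by
  classical
  induction s using Finset.induction_on with
  | empty => simpa
  | insert a s ha ih =>
    rw [Finset.sum_insert ha]
    exact (absK_add _ _).trans (max_le (h _ (by simp))
      (ih fun i hi => h i (Finset.mem_insert_of_mem hi)))

theorem absK_sub_le (x y : K0 p k) : absK p k (x - y) ≤ max (absK p k x) (absK p k y) := by
  have := absK_add x (-y)
  rwa [← sub_eq_add_neg, (absK p k).map_neg] at this

theorem dvd_of_absK_le {w : WittVector p k} {n : ℕ}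
    (h : absK p k (algebraMap _ _ w) ≤ ((p : ℝ)⁻¹) ^ n) : (p : WittVector p k) ^ n ∣ w := by
  have h1 : absK p k (algebraMap _ _ w / (p : K0 p k) ^ n) ≤ 1 := by
    rw [map_div₀, map_pow, absK_p]
    exact div_le_one_of_le₀ h (by positivity)
  obtain ⟨v, hv⟩ := exists_int h1
  refine ⟨v, IsFractionRing.injective (WittVector p k) (K0 p k) ?_⟩
  have := p_ne_zero (p := p) (k := k)
  rw [map_mul, hv, map_pow, map_natCast]
  field_simp

/-- `K₀` is complete: a series whose terms tend to zero converges. -/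
theorem exists_series_sum (a : ℕ → K0 p k)
    (ha : ∀ ε > 0, ∃ N, ∀ n ≥ N, absK p k (a n) ≤ ε) :
    ∃ s : K0 p k, ∀ ε > 0, ∃ N, ∀ n ≥ N, absK p k (s - ∑ j ∈ Finset.range n, a j) ≤ ε := by
  have hq0 : (0 : ℝ) < (p : ℝ)⁻¹ := inv_pos.2 (p_pos (p := p))
  -- partial sums between two large indices are small
  have htail : ∀ ε > 0, ∃ N, ∀ m ≥ N, ∀ n ≥ m, absK p k (∑ j ∈ Finset.range n, a j -
      ∑ j ∈ Finset.range m, a j) ≤ ε := by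
    intro ε hε
    obtain ⟨N, hN⟩ := ha ε hε
    refine ⟨N, fun m hm n hn => ?_⟩
    rw [← Finset.sum_Ico_eq_sub _ hn]
    exact absK_sum_le _ _ hε.le fun i hi => hN i (hm.le.trans (Finset.mem_Ico.1 hi).1)
  choose! N hN using fun j : ℕ => htail (((p : ℝ)⁻¹) ^ j) (by positivity)
  -- monotone reindexing
  let M : ℕ → ℕ := fun j => ∑ i ∈ Finset.range (j + 1), N i
  have hNM : ∀ j, N j ≤ M j := fun j =>
    Finset.single_le_sum (f := N) (fun _ _ => Nat.zero_le _) (by simp)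
  have hMm : Monotone M := fun i j hij =>
    Finset.sum_le_sum_of_subset (Finset.range_mono (by omega))
  let S : ℕ → K0 p k := fun n => ∑ j ∈ Finset.range n, a j
  have hS : ∀ i j, i ≤ j → absK p k (S (M j) - S (M i)) ≤ ((p : ℝ)⁻¹) ^ i := fun i j hij =>
    hN i (M i) (hNM i) (M j) (hMm hij)
  have hint : ∀ j, ∃ w : WittVector p k, algebraMap _ _ w = S (M j) - S (M 0) := fun j =>
    exists_int (by simpa using hS 0 j (Nat.zero_le j))
  choose w hw using hint
  have hcong : ∀ i j, i ≤ j → (p : WittVector p k) ^ i ∣ w j - w i := fun i j hij =>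
    dvd_of_absK_le (by rw [map_sub, hw, hw]; simpa using hS i j hij)
  obtain ⟨L, hL⟩ := IsPrecomplete.prec
    (I := Ideal.span {(p : WittVector p k)}) (M := WittVector p k) inferInstance (f := w) (by
      intro i j hij
      rw [SModEq.sub_mem, smul_eq_mul, Ideal.mul_top, Ideal.span_singleton_pow,
        Ideal.mem_span_singleton, dvd_sub_comm]
      exact hcong i j hij)
  refine ⟨algebraMap _ _ L + S (M 0), fun ε hε => ?_⟩
  obtain ⟨j, hj⟩ := exists_pow_lt_of_lt_one hε (inv_lt_one_of_one_lt₀ (a := (p : ℝ))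
    (by exact_mod_cast hp.out.one_lt))
  refine ⟨M j, fun n hn => ?_⟩
  have h1 : absK p k (algebraMap _ _ (L - w j)) ≤ ((p : ℝ)⁻¹) ^ j := by
    have := hL j
    rw [SModEq.sub_mem, smul_eq_mul, Ideal.mul_top, Ideal.span_singleton_pow,
        Ideal.mem_span_singleton, dvd_sub_comm] at this
    obtain ⟨c, hc⟩ := this
    rw [hc, map_mul, map_mul, map_pow, map_pow, map_natCast, absK_p]
    exact mul_le_of_le_one_right (by positivity) (absK_int c)
  have h2 := hN j (M j) (hNM j) n hn
  have : algebraMap _ _ L + S (M 0) - ∑ j ∈ Finset.range n, a j =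
      algebraMap _ _ (L - w j) - (∑ j ∈ Finset.range n, a j - ∑ j ∈ Finset.range (M j), a j) := by
    rw [map_sub, hw]; simp only [S]; ring
  rw [this]
  exact (absK_sub_le _ _).trans ((max_le h1 h2).trans hj.le)

end CoefficientField

section Series

set_option linter.unusedSectionVars false

variable (p : ℕ) [hp : Fact p.Prime] (k : Type u) [Field k] [CharP k p] [PerfectRing k p]

/-- `𝔖 = W[[u]]`. -/
abbrev FrakS : Type u := PowerSeries (WittVector p k)

/-- `𝒜 = K₀[[u]]`; the rings `𝔖[1/p]`, `𝔖[1/p,1/E]`, `𝒪`, `𝒪[1/λ]` are all realised inside it. -/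
abbrev RingA : Type u := PowerSeries (K0 p k)

/-- The Frobenius of `𝒜`: it is `φ` on `K₀` and `u ↦ u ^ p`. -/
def phi : RingA p k →+* RingA p k :=
  (PowerSeries.expand p hp.out.ne_zero : RingA p k →ₐ[K0 p k] RingA p k).toRingHom.comp
    (PowerSeries.map (phi0 p k))

/-- The inclusion `𝔖 ⊆ 𝒜`. -/
def sToA : FrakS p k →+* RingA p k := PowerSeries.map (algebraMap (WittVector p k) (K0 p k))

/-- `𝔖[1/p]`, as a subring of `𝒜`. -/
def SP : Subalgebra (K0 p k) (RingA p k) where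
  carrier := {x | ∃ (n : ℕ) (y : FrakS p k), (p : RingA p k) ^ n * x = sToA p k y}
  mul_mem' := by
    rintro a b ⟨n, y, hy⟩ ⟨m, z, hz⟩
    exact ⟨n + m, y * z, by rw [map_mul, ← hy, ← hz]; ring⟩
  add_mem' := by
    rintro a b ⟨n, y, hy⟩ ⟨m, z, hz⟩
    refine ⟨n + m, (p : FrakS p k) ^ m * y + (p : FrakS p k) ^ n * z, ?_⟩
    rw [map_add, map_mul, map_mul, map_pow, map_pow, map_natCast, ← hy, ← hz]; ring
  algebraMap_mem' := by
    intro c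
    obtain ⟨n, hn⟩ := exists_pow_mul_le (p := p) (absK p k c)
    obtain ⟨w, hw⟩ := exists_int (p := p) (k := k) (x := c * p ^ n) (by
      rwa [map_mul, map_pow, absK_p])
    refine ⟨n, PowerSeries.C w, ?_⟩
    rw [sToA, PowerSeries.map_C, hw, map_mul, map_pow, map_natCast, mul_comm]
    rfl

/-- `𝒪`: the power series over `K₀` that converge on the open unit disc, that is,
`sup |xₙ| rⁿ < ∞` for all `0 < r < 1`. -/
def RingO : Subalgebra (K0 p k) (RingA p k) where
  carrier := {x | ∀ r : ℝ, 0 < r → r < 1 →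
    ∃ C : ℝ, ∀ n, absK p k (PowerSeries.coeff n x) * r ^ n ≤ C}
  mul_mem' := by
    intro a b ha hb r h0 h1
    obtain ⟨C, hC⟩ := ha r h0 h1
    obtain ⟨D, hD⟩ := hb r h0 h1
    have hC0 : 0 ≤ C := le_trans (by positivity) (hC 0)
    have hD0 : 0 ≤ D := le_trans (by positivity) (hD 0)
    refine ⟨C * D, fun n => ?_⟩
    rw [← le_div_iff₀ (by positivity), PowerSeries.coeff_mul]
    refine absK_sum_le _ _ (by positivity) fun i hi => ?_
    rw [le_div_iff₀ (by positivity), map_mul, ← Finset.HasAntidiagonal.mem_antidiagonal.1 hi, pow_add]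
    calc _ = (absK p k (PowerSeries.coeff i.1 a) * r ^ i.1) *
          (absK p k (PowerSeries.coeff i.2 b) * r ^ i.2) := by ring
      _ ≤ C * D := mul_le_mul (hC _) (hD _) (by positivity) hC0
  add_mem' := by
    intro a b ha hb r h0 h1
    obtain ⟨C, hC⟩ := ha r h0 h1
    obtain ⟨D, hD⟩ := hb r h0 h1
    refine ⟨max C D, fun n => ?_⟩
    rw [map_add]
    refine (mul_le_mul_of_nonneg_right (absK_add _ _) (by positivity)).trans ?_
    rw [max_mul_of_nonneg _ _ (by positivity)]
    exact max_le_max (hC n) (hD n)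
  algebraMap_mem' := by
    intro c r h0 h1
    refine ⟨absK p k c, fun n => ?_⟩
    rw [PowerSeries.algebraMap_apply, PowerSeries.coeff_C]
    split_ifs with h
    · simp [h]
    · simp

/-- The Gauss norm `|x|_r = sup |xₙ| rⁿ` (used for `x ∈ 𝒪` and `0 < r < 1`). -/
def gaussNorm (r : ℝ) (x : RingA p k) : ℝ := ⨆ n, absK p k (PowerSeries.coeff n x) * r ^ n

variable {p k}

/-- The localisation `R[1/a]` of a subring `R` of `𝒜`, as a subring of `𝒜`
(used for `a` a unit of `𝒜`). -/
def away (R : Subalgebra (K0 p k) (RingA p k)) (a : RingA p k) (ha : a ∈ R) :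
    Subalgebra (K0 p k) (RingA p k) where
  carrier := {x | ∃ n : ℕ, a ^ n * x ∈ R}
  mul_mem' := by
    rintro x y ⟨n, hx⟩ ⟨m, hy⟩
    exact ⟨n + m, by have := R.mul_mem hx hy; convert this using 1; ring⟩
  add_mem' := by
    rintro x y ⟨n, hx⟩ ⟨m, hy⟩
    refine ⟨n + m, ?_⟩
    have := R.add_mem (R.mul_mem (R.pow_mem ha m) hx) (R.mul_mem (R.pow_mem ha n) hy)
    convert this using 1; ring
  algebraMap_mem' c := ⟨0, by simpa using R.algebraMap_mem c⟩

theorem le_away (R : Subalgebra (K0 p k) (RingA p k)) (a : RingA p k) (ha : a ∈ R) :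
    R ≤ away R a ha := fun x hx => ⟨0, by simpa using hx⟩

theorem coeff_phi (n : ℕ) (x : RingA p k) : PowerSeries.coeff n (phi p k x) =
    if p ∣ n then phi0 p k (PowerSeries.coeff (n / p) x) else 0 := by
  change PowerSeries.coeff n (PowerSeries.expand p hp.out.ne_zero (PowerSeries.map _ x)) = _
  rw [PowerSeries.coeff_expand]
  simp

theorem phi_X : phi p k PowerSeries.X = PowerSeries.X ^ p := by
  simp [phi]

theorem phi_C (c : K0 p k) : phi p k (PowerSeries.C c) = PowerSeries.C (phi0 p k c) := by
  change PowerSeries.expand p hp.out.ne_zero (PowerSeries.map _ _) = _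
  rw [PowerSeries.map_C, PowerSeries.expand_C]

theorem constantCoeff_phi (x : RingA p k) : PowerSeries.constantCoeff (phi p k x) =
    phi0 p k (PowerSeries.constantCoeff x) := by
  rw [← PowerSeries.coeff_zero_eq_constantCoeff_apply, coeff_phi]
  simp

theorem X_pow_dvd_phi {n : ℕ} {x : RingA p k} (h : PowerSeries.X ^ n ∣ x) :
    PowerSeries.X ^ (p * n) ∣ phi p k x := by
  have := map_dvd (phi p k) h
  rwa [map_pow, phi_X, ← pow_mul] at this

theorem mem_SP_iff {x : RingA p k} :
    x ∈ SP p k ↔ ∃ C : ℝ, ∀ n, absK p k (PowerSeries.coeff n x) ≤ C := by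
  have hpn : ∀ n m, PowerSeries.coeff m ((p : RingA p k) ^ n * x) =
      (p : K0 p k) ^ n * PowerSeries.coeff m x := fun n m => by
    rw [← map_natCast (PowerSeries.C (R := K0 p k)) p, ← map_pow, PowerSeries.coeff_C_mul]
  constructor
  · rintro ⟨n, y, hy⟩
    refine ⟨(p : ℝ) ^ n, fun m => ?_⟩
    have h1 := hpn n m
    rw [hy, sToA, PowerSeries.coeff_map] at h1
    have h2 := absK_int (PowerSeries.coeff m y)
    rw [h1, map_mul, map_pow, absK_p, inv_pow, inv_mul_le_iff₀ (pow_pos (p_pos) n), mul_one] at h2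
    exact h2
  · rintro ⟨C, hC⟩
    obtain ⟨n, hn⟩ := exists_pow_mul_le (p := p) C
    have : ∀ m, ∃ w : WittVector p k, algebraMap _ _ w = (p : K0 p k) ^ n * PowerSeries.coeff m x :=
      fun m => exists_int (by
        rw [map_mul, map_pow, absK_p, mul_comm]
        exact (mul_le_mul_of_nonneg_right (hC m) (by positivity)).trans hn)
    choose w hw using this
    refine ⟨n, PowerSeries.mk w, ?_⟩
    ext m
    rw [hpn, sToA, PowerSeries.coeff_map, PowerSeries.coeff_mk, hw]

theorem SP_le_O : SP p k ≤ RingO p k := by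
  intro x hx r h0 h1
  obtain ⟨C, hC⟩ := mem_SP_iff.1 hx
  have hC0 : 0 ≤ C := le_trans ((absK p k).nonneg _) (hC 0)
  exact ⟨C, fun n => (mul_le_mul (hC n) (pow_le_one₀ h0.le h1.le) (by positivity) hC0).trans
    (mul_one C).le⟩

theorem phi_mem_SP {x : RingA p k} (hx : x ∈ SP p k) : phi p k x ∈ SP p k := by
  obtain ⟨C, hC⟩ := mem_SP_iff.1 hx
  refine mem_SP_iff.2 ⟨C, fun n => ?_⟩
  rw [coeff_phi]
  split_ifs
  · rw [absK_phi0]; exact hC _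
  · rw [map_zero]; exact le_trans ((absK p k).nonneg _) (hC 0)

theorem phi_mem_O {x : RingA p k} (hx : x ∈ RingO p k) : phi p k x ∈ RingO p k := by
  intro r h0 h1
  obtain ⟨C, hC⟩ := hx (r ^ p) (by positivity) (pow_lt_one₀ h0.le h1 hp.out.ne_zero)
  refine ⟨C, fun n => ?_⟩
  rw [coeff_phi]
  split_ifs with h
  · obtain ⟨m, rfl⟩ := h
    rw [absK_phi0, Nat.mul_div_cancel_left _ hp.out.pos, pow_mul]; exact hC _
  · rw [map_zero, zero_mul]; exact le_trans (by positivity) (hC 0)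

/-! ### `u`-adic contractions -/

variable {σ : Type*}

/-- A map on families of power series that improves `u`-adic congruences. -/
def IsContraction (T : (σ → RingA p k) → (σ → RingA p k)) : Prop :=
  ∀ (n : ℕ) (F G : σ → RingA p k), 1 ≤ n → (∀ s, PowerSeries.X ^ n ∣ F s - G s) →
    ∀ s, PowerSeries.X ^ (n + 1) ∣ T F s - T G s

theorem eq_zero_of_forall_dvd {x : RingA p k} (h : ∀ n : ℕ, PowerSeries.X ^ n ∣ x) : x = 0 := by
  ext m
  exact PowerSeries.X_pow_dvd_iff.1 (h (m + 1)) m (Nat.lt_succ_self m)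

theorem IsContraction.unique {T : (σ → RingA p k) → (σ → RingA p k)} (hT : IsContraction T)
    {F G : σ → RingA p k} (hF : T F = F) (hG : T G = G)
    (h : ∀ s, PowerSeries.X ∣ F s - G s) : F = G := by
  have key : ∀ n : ℕ, ∀ s, PowerSeries.X ^ (n + 1) ∣ F s - G s := by
    intro n
    induction n with
    | zero => simpa using h
    | succ n ih =>
      have := hT (n + 1) F G (by omega) ih
      rwa [hF, hG] at this
  funext s
  refine sub_eq_zero.1 (eq_zero_of_forall_dvd fun n => ?_)
  exact (pow_dvd_pow _ (Nat.le_succ n)).trans (key n s)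

/-- The coefficientwise limit of the iterates of a contraction. -/
def iterLimit (T : (σ → RingA p k) → (σ → RingA p k)) (F : σ → RingA p k) : σ → RingA p k :=
  fun s => PowerSeries.mk fun m => PowerSeries.coeff m (T^[m + 1] F s)

theorem IsContraction.iterLimit_dvd {T : (σ → RingA p k) → (σ → RingA p k)}
    (hT : IsContraction T) {F : σ → RingA p k} (hF : ∀ s, PowerSeries.X ∣ T F s - F s) (j : ℕ)
    (s : σ) : PowerSeries.X ^ (j + 1) ∣ iterLimit T F s - T^[j] F s := by
  have step : ∀ j, ∀ s, PowerSeries.X ^ (j + 1) ∣ T^[j + 1] F s - T^[j] F s := by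
    intro j
    induction j with
    | zero => simpa using hF
    | succ j ih =>
      rw [Function.iterate_succ_apply' T (j + 1), Function.iterate_succ_apply' T j]
      rw [Function.iterate_succ_apply' T j] at ih
      exact hT (j + 1) _ _ (by omega) ih
  have far : ∀ i j, ∀ s, PowerSeries.X ^ (j + 1) ∣ T^[j + i] F s - T^[j] F s := by
    intro i j s
    induction i with
    | zero => simp
    | succ i ih =>
      have h1 := (pow_dvd_pow (PowerSeries.X : RingA p k) (show j + 1 ≤ j + i + 1 by omega)).trans
        (step (j + i) s)
      have := dvd_add h1 ih
      rwa [sub_add_sub_cancel] at this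
  rw [PowerSeries.X_pow_dvd_iff]
  intro m hm
  rw [map_sub, iterLimit, PowerSeries.coeff_mk]
  obtain ⟨i, rfl⟩ := Nat.exists_eq_add_of_le (Nat.lt_succ_iff.1 hm)
  have h1 := PowerSeries.X_pow_dvd_iff.1 (far 1 m s) m (Nat.lt_succ_self m)
  have h2 := PowerSeries.X_pow_dvd_iff.1 (far i m s) m (Nat.lt_succ_self m)
  rw [map_sub, sub_eq_zero] at h1 h2
  rw [h1, h2, sub_self]

theorem IsContraction.apply_iterLimit {T : (σ → RingA p k) → (σ → RingA p k)}
    (hT : IsContraction T) {F : σ → RingA p k} (hF : ∀ s, PowerSeries.X ∣ T F s - F s) :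
    T (iterLimit T F) = iterLimit T F := by
  funext s
  refine sub_eq_zero.1 (eq_zero_of_forall_dvd fun j => ?_)
  have h1 := hT (j + 1) (iterLimit T F) (T^[j] F) (by omega) (hT.iterLimit_dvd hF j) s
  have h2 := hT.iterLimit_dvd hF (j + 1) s
  rw [← Function.iterate_succ_apply' T j] at h1
  have := dvd_sub ((pow_dvd_pow _ (show j ≤ j + 1 + 1 by omega)).trans h1)
    ((pow_dvd_pow _ (show j ≤ j + 1 + 1 by omega)).trans h2)
  rwa [sub_sub_sub_cancel_right] at this

/-- Coefficients controlled by those of half the index grow polynomially. -/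
theorem growth {σ : Type*} (Y : σ → RingA p k) {Q B : ℝ} (hB : 0 ≤ B)
    (h0 : ∀ s, absK p k (PowerSeries.coeff 0 (Y s)) ≤ B)
    (h : ∀ n, 1 ≤ n → ∀ K, 0 ≤ K →
      (∀ m, m ≤ n / 2 → ∀ s, absK p k (PowerSeries.coeff m (Y s)) ≤ K) →
      ∀ s, absK p k (PowerSeries.coeff n (Y s)) ≤ Q * K) (s : σ) : Y s ∈ RingO p k := by
  obtain ⟨a, ha⟩ := pow_unbounded_of_one_lt Q (show (1 : ℝ) < 3 / 2 by norm_num)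
  have key : ∀ n, ∀ s, absK p k (PowerSeries.coeff n (Y s)) ≤ B * ((n : ℝ) + 1) ^ a := by
    intro n
    induction n using Nat.strong_induction_on with
    | _ n ih =>
      rcases Nat.eq_zero_or_pos n with rfl | hn
      · simpa using h0
      intro s
      have h1 := h n hn (B * (((n / 2 : ℕ) : ℝ) + 1) ^ a) (by positivity) (fun m hm s =>
        (ih m (by omega) s).trans (by gcongr)) s
      refine h1.trans ?_
      have h2 : (((n / 2 : ℕ) : ℝ) + 1) * (3 / 2) ≤ (n : ℝ) + 1 := by
        have : 3 * (n / 2 + 1) ≤ 2 * (n + 1) := by omega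
        have : (3 * ((n / 2 : ℕ) + 1) : ℝ) ≤ 2 * (n + 1) := by exact_mod_cast this
        linarith
      calc Q * (B * (((n / 2 : ℕ) : ℝ) + 1) ^ a)
          ≤ (3 / 2) ^ a * (B * (((n / 2 : ℕ) : ℝ) + 1) ^ a) := by gcongr
        _ = B * ((((n / 2 : ℕ) : ℝ) + 1) * (3 / 2)) ^ a := by rw [mul_pow]; ring
        _ ≤ B * ((n : ℝ) + 1) ^ a := by gcongr
  intro r hr0 hr1
  have hlim : Filter.Tendsto (fun n : ℕ => ((n + 1 : ℕ) : ℝ) ^ a * r ^ (n + 1)) Filter.atTop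
      (nhds 0) :=
    (Filter.tendsto_add_atTop_iff_nat 1).2 (tendsto_pow_const_mul_const_pow_of_lt_one a hr0.le hr1)
  obtain ⟨C, hC⟩ := hlim.bddAbove_range
  refine ⟨B * (C / r), fun n => ?_⟩
  have h2 := hC ⟨n, rfl⟩
  simp only [Nat.cast_add, Nat.cast_one] at h2
  calc _ ≤ B * ((n : ℝ) + 1) ^ a * r ^ n := by gcongr; exact key n s
    _ = B * (((n : ℝ) + 1) ^ a * r ^ (n + 1) / r) := by rw [pow_succ]; field_simp
    _ ≤ B * (C / r) := by gcongr

theorem absK_coeff_mul_phi_le {x y : RingA p k} {B K : ℝ} {n : ℕ} (hB : 0 ≤ B) (hK : 0 ≤ K)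
    (hx : ∀ m, absK p k (PowerSeries.coeff m x) ≤ B)
    (hy : ∀ m, m ≤ n / 2 → absK p k (PowerSeries.coeff m y) ≤ K) :
    absK p k (PowerSeries.coeff n (x * phi p k y)) ≤ B * K := by
  rw [PowerSeries.coeff_mul]
  refine absK_sum_le _ _ (by positivity) fun i hi => ?_
  rw [map_mul]
  refine mul_le_mul (hx _) ?_ (by positivity) hB
  rw [coeff_phi]
  split_ifs with h
  · rw [absK_phi0]
    have h1 : i.2 ≤ n := (Nat.le_add_left _ _).trans (Finset.HasAntidiagonal.mem_antidiagonal.1 hi).le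
    exact hy _ ((Nat.div_le_div_right h1).trans (Nat.div_le_div_left hp.out.two_le two_pos))
  · simpa

end Series

section Bounds

set_option linter.unusedSectionVars false

variable {p : ℕ} [hp : Fact p.Prime] {k : Type u} [Field k] [CharP k p] [PerfectRing k p]

/-- `|xₙ| rⁿ ≤ C` for all `n`. -/
def NB (r C : ℝ) (x : RingA p k) : Prop := ∀ n, absK p k (PowerSeries.coeff n x) * r ^ n ≤ C

theorem NB.nonneg {r C : ℝ} {x : RingA p k} (h : NB r C x) : 0 ≤ C :=
  le_trans (by simp) (h 0)

theorem NB.mono {r C D : ℝ} {x : RingA p k} (h : NB r C x) (hCD : C ≤ D) : NB r D x :=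
  fun n => (h n).trans hCD

theorem NB.add {r C : ℝ} (hr : 0 ≤ r) {x y : RingA p k} (hx : NB r C x) (hy : NB r C y) :
    NB r C (x + y) := fun n => by
  rw [map_add]
  refine (mul_le_mul_of_nonneg_right (absK_add _ _) (by positivity)).trans ?_
  rw [max_mul_of_nonneg _ _ (by positivity)]
  exact max_le (hx n) (hy n)

theorem NB.neg {r C : ℝ} {x : RingA p k} (hx : NB r C x) : NB r C (-x) := fun n => by
  rw [map_neg, (absK p k).map_neg]; exact hx n

theorem NB.sub {r C : ℝ} (hr : 0 ≤ r) {x y : RingA p k} (hx : NB r C x) (hy : NB r C y) :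
    NB r C (x - y) := by
  rw [sub_eq_add_neg]; exact hx.add hr hy.neg

theorem NB.mul {r C D : ℝ} (hr : 0 < r) {x y : RingA p k} (hx : NB r C x) (hy : NB r D y) :
    NB r (C * D) (x * y) := fun n => by
  have hC := hx.nonneg
  have hD := hy.nonneg
  rw [← le_div_iff₀ (by positivity), PowerSeries.coeff_mul]
  refine absK_sum_le _ _ (by positivity) fun i hi => ?_
  rw [le_div_iff₀ (by positivity), map_mul, ← Finset.HasAntidiagonal.mem_antidiagonal.1 hi, pow_add]
  calc _ = (absK p k (PowerSeries.coeff i.1 x) * r ^ i.1) *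
        (absK p k (PowerSeries.coeff i.2 y) * r ^ i.2) := by ring
    _ ≤ C * D := mul_le_mul (hx _) (hy _) (by positivity) hC

theorem NB.one {r : ℝ} : NB r 1 (1 : RingA p k) := fun n => by
  rw [PowerSeries.coeff_one]
  split_ifs with h
  · simp [h]
  · simp

theorem NB.pow {r : ℝ} (hr : 0 < r) {x : RingA p k} (hx : NB r 1 x) (n : ℕ) : NB r 1 (x ^ n) := by
  induction n with
  | zero => simpa using NB.one
  | succ n ih => rw [pow_succ]; simpa using ih.mul hr hx

theorem eq_zero_of_NB {r C κ : ℝ} (hr : 0 < r) (h0 : 0 ≤ κ) (h1 : κ < 1) {x : RingA p k}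
    (h : ∀ N : ℕ, NB r (C * κ ^ N) x) : x = 0 := by
  ext n
  have hlim := (tendsto_pow_atTop_nhds_zero_of_lt_one h0 h1).const_mul C
  rw [mul_zero] at hlim
  have := ge_of_tendsto' hlim fun N => h N n
  have h2 : absK p k (PowerSeries.coeff n x) ≤ 0 := by
    by_contra hcon
    exact absurd this (not_le.2 (mul_pos (not_le.1 hcon) (by positivity)))
  simpa using le_antisymm h2 ((absK p k).nonneg _)

/-- Inverses of principal units of the unit ball for the radius `r`. -/
theorem NB.inv {r : ℝ} (hr : 0 < r) {x : RingA p k} (hx : NB r 1 x)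
    (h0 : absK p k (PowerSeries.constantCoeff x) = 1) : NB r 1 x⁻¹ := by
  intro n
  induction n using Nat.strong_induction_on with
  | _ n ih =>
    rw [PowerSeries.coeff_inv]
    split_ifs with hn
    · simp [hn, h0]
    · rw [map_mul, (absK p k).map_neg, map_inv₀, h0, inv_one, one_mul,
        ← le_div_iff₀ (by positivity)]
      refine absK_sum_le _ _ (by positivity) fun i hi => ?_
      split_ifs with hlt
      · rw [le_div_iff₀ (by positivity), map_mul,
          ← Finset.HasAntidiagonal.mem_antidiagonal.1 hi, pow_add]
        calc _ = (absK p k (PowerSeries.coeff i.1 x) * r ^ i.1) *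
              (absK p k (PowerSeries.coeff i.2 x⁻¹) * r ^ i.2) := by ring
          _ ≤ 1 * 1 := mul_le_mul (hx _) (ih _ hlt) (by positivity) zero_le_one
          _ = 1 := one_mul 1
      · rw [map_zero]; positivity

/-- Power series with `sup |xₙ| rⁿ < ∞`. -/
def Bd (r : ℝ) (hr : 0 < r) : Subalgebra (K0 p k) (RingA p k) where
  carrier := {x | ∃ C : ℝ, NB r C x}
  mul_mem' := by
    rintro a b ⟨C, hC⟩ ⟨D, hD⟩
    exact ⟨C * D, hC.mul hr hD⟩
  add_mem' := by
    rintro a b ⟨C, hC⟩ ⟨D, hD⟩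
    exact ⟨max C D, (hC.mono (le_max_left _ _)).add hr.le (hD.mono (le_max_right _ _))⟩
  algebraMap_mem' := by
    intro c
    refine ⟨absK p k c, fun n => ?_⟩
    rw [PowerSeries.algebraMap_apply, PowerSeries.coeff_C]
    split_ifs with h
    · simp [h]
    · simp

theorem O_le_Bd {r : ℝ} (hr : 0 < r) (h1 : r < 1) : RingO p k ≤ Bd r hr := fun _ hx => hx r hr h1

theorem SP_le_Bd {r : ℝ} (hr : 0 < r) (h1 : r < 1) : SP p k ≤ Bd r hr :=
  SP_le_O.trans (O_le_Bd hr h1)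

theorem exists_NB_series {r C κ : ℝ} (hr : 0 < r) (h0 : 0 ≤ κ) (h1 : κ < 1) (hC : 0 ≤ C)
    (t : ℕ → RingA p k) (ht : ∀ j, NB r (C * κ ^ j) (t j)) :
    ∃ q : RingA p k, ∀ N : ℕ, NB r (C * κ ^ N) (q - ∑ j ∈ Finset.range N, t j) := by
  have hlim := (tendsto_pow_atTop_nhds_zero_of_lt_one h0 h1).const_mul C
  rw [mul_zero] at hlim
  have : ∀ i, ∃ s : K0 p k, ∀ ε > 0, ∃ N, ∀ n ≥ N,
      absK p k (s - ∑ j ∈ Finset.range n, PowerSeries.coeff i (t j)) ≤ ε := by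
    intro i
    refine exists_series_sum _ fun ε hε => ?_
    obtain ⟨N, hN⟩ := Filter.eventually_atTop.1
      (hlim.eventually (gt_mem_nhds (show 0 < ε * r ^ i by positivity)))
    refine ⟨N, fun n hn => ?_⟩
    have := (ht n i).trans (hN n hn).le
    exact le_of_mul_le_mul_right this (by positivity)
  choose s hs using this
  refine ⟨PowerSeries.mk s, fun N i => ?_⟩
  rw [map_sub, map_sum, PowerSeries.coeff_mk]
  rw [← le_div_iff₀ (by positivity)]
  refine le_of_forall_pos_le_add fun ε hε => ?_
  obtain ⟨M, hM⟩ := hs i ε hε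
  have hpos : 0 ≤ C * κ ^ N / r ^ i := by positivity
  have h2 : s i - ∑ j ∈ Finset.range N, PowerSeries.coeff i (t j) =
      (s i - ∑ j ∈ Finset.range (max M N), PowerSeries.coeff i (t j)) +
        ∑ j ∈ Finset.Ico N (max M N), PowerSeries.coeff i (t j) := by
    rw [Finset.sum_Ico_eq_sub _ (le_max_right _ _)]; ring
  rw [h2]
  refine (absK_add _ _).trans (max_le ((hM _ (le_max_left _ _)).trans (by linarith)) ?_)
  refine (absK_sum_le _ _ hpos fun j hj => ?_).trans (by linarith)
  rw [le_div_iff₀ (by positivity)]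
  refine (ht j i).trans (mul_le_mul_of_nonneg_left ?_ hC)
  exact pow_le_pow_of_le_one h0 h1.le (Finset.mem_Ico.1 hj).1

/-! ### Distinguished polynomials and division -/

/-- `P` is a monic polynomial of degree `d` whose lower coefficients lie in `pW`. -/
structure IsDist (P : RingA p k) (d : ℕ) : Prop where
  top : PowerSeries.coeff d P = 1
  high : ∀ i, d < i → PowerSeries.coeff i P = 0
  low : ∀ i, i < d → absK p k (PowerSeries.coeff i P) ≤ (p : ℝ)⁻¹

theorem IsDist.phi {P : RingA p k} {d : ℕ} (h : IsDist P d) : IsDist (phi p k P) (p * d) where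
  top := by rw [coeff_phi, if_pos (dvd_mul_right _ _), Nat.mul_div_cancel_left _ hp.out.pos, h.top,
    map_one]
  high i hi := by
    rw [coeff_phi]
    split_ifs with hd
    · obtain ⟨j, rfl⟩ := hd
      rw [Nat.mul_div_cancel_left _ hp.out.pos, h.high _ (lt_of_mul_lt_mul_left hi (Nat.zero_le _)),
        map_zero]
    · rfl
  low i hi := by
    rw [coeff_phi]
    split_ifs with hd
    · obtain ⟨j, rfl⟩ := hd
      rw [Nat.mul_div_cancel_left _ hp.out.pos, absK_phi0]
      exact h.low _ (lt_of_mul_lt_mul_left hi (Nat.zero_le _))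
    · simp

variable {P : RingA p k} {d : ℕ}

/-- The lower part of a distinguished polynomial has coefficients of size at most `1/p`. -/
theorem IsDist.lower (h : IsDist P d) (i : ℕ) :
    absK p k (PowerSeries.coeff i (P - PowerSeries.X ^ d)) ≤ (p : ℝ)⁻¹ := by
  rw [map_sub, PowerSeries.coeff_X_pow]
  rcases lt_trichotomy i d with hi | rfl | hi
  · rw [if_neg hi.ne, sub_zero]; exact h.low i hi
  · simp [h.top]
  · simp [if_neg hi.ne', h.high i hi]

theorem IsDist.bounded (h : IsDist P d) (i : ℕ) : absK p k (PowerSeries.coeff i P) ≤ 1 := by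
  have hp1 : (p : ℝ)⁻¹ ≤ 1 := inv_le_one_of_one_le₀ (by exact_mod_cast hp.out.one_lt.le)
  rcases lt_trichotomy i d with hi | rfl | hi
  · exact (h.low i hi).trans hp1
  · simp [h.top]
  · simp [h.high i hi]

theorem IsDist.mem_SP (h : IsDist P d) : P ∈ SP p k := mem_SP_iff.2 ⟨1, h.bounded⟩

/-- Bound for the coefficient of index `i + d` of `(P - u ^ d) y`. -/
theorem IsDist.lower_mul (h : IsDist P d) {y : RingA p k} {K : ℝ} {n : ℕ} (hK : 0 ≤ K)
    (hy : ∀ b ≤ n, absK p k (PowerSeries.coeff b y) ≤ K) :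
    absK p k (PowerSeries.coeff n ((P - PowerSeries.X ^ d) * y)) ≤ (p : ℝ)⁻¹ * K := by
  rw [PowerSeries.coeff_mul]
  refine absK_sum_le _ _ (by positivity) fun i hi => ?_
  rw [map_mul]
  exact mul_le_mul (h.lower _) (hy _ ((Nat.le_add_left _ _).trans
    (Finset.HasAntidiagonal.mem_antidiagonal.1 hi).le)) (by positivity) (by positivity)

theorem coeff_add_split (i : ℕ) (y : RingA p k) : PowerSeries.coeff (i + d) (P * y) =
    PowerSeries.coeff i y + PowerSeries.coeff (i + d) ((P - PowerSeries.X ^ d) * y) := by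
  rw [sub_mul, map_sub, PowerSeries.coeff_X_pow_mul]; ring

/-- The contraction ratio. -/
theorem ratio_lt {r : ℝ} (hr : 0 < r) (hd : (p : ℝ)⁻¹ < r ^ d) : (p : ℝ)⁻¹ / r ^ d < 1 :=
  (div_lt_one (by positivity)).2 hd

theorem IsDist.mem_SP_of_mul (h : IsDist P d) {r : ℝ} (hr : 0 < r) (h1 : r < 1)
    (hd : (p : ℝ)⁻¹ < r ^ d) {y : RingA p k} (hy : y ∈ Bd r hr) (hs : P * y ∈ SP p k) :
    y ∈ SP p k := by
  obtain ⟨K, hK⟩ := hy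
  obtain ⟨S, hS⟩ := mem_SP_iff.1 hs
  have hS0 : 0 ≤ S := le_trans ((absK p k).nonneg _) (hS 0)
  have hK0 := hK.nonneg
  have hp0 := p_pos (p := p)
  have hp1 : (p : ℝ)⁻¹ ≤ 1 := inv_le_one_of_one_le₀ (by exact_mod_cast hp.out.one_lt.le)
  set κ := (p : ℝ)⁻¹ / r ^ d with hκ
  have hκ0 : 0 ≤ κ := by positivity
  have key : ∀ N m, absK p k (PowerSeries.coeff m y) ≤ max S (K * κ ^ N / r ^ m) := by
    intro N
    induction N with
    | zero =>
      intro m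
      refine le_max_of_le_right ?_
      rw [pow_zero, mul_one, le_div_iff₀ (by positivity)]; exact hK m
    | succ N ih =>
      intro m
      have h2 := coeff_add_split (P := P) (d := d) m y
      rw [eq_comm, ← eq_sub_iff_add_eq] at h2
      rw [h2]
      refine (absK_sub_le _ _).trans (max_le (le_max_of_le_left (hS _)) ?_)
      refine (h.lower_mul (K := max S (K * κ ^ N / r ^ (m + d))) (by positivity)
        fun b hb => (ih b).trans (max_le_max le_rfl ?_)).trans ?_
      · exact div_le_div_of_nonneg_left (by positivity) (by positivity)
          (pow_le_pow_of_le_one hr.le h1.le hb)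
      · rw [mul_max_of_nonneg _ _ (by positivity)]
        refine max_le_max (mul_le_of_le_one_left hS0 hp1) (le_of_eq ?_)
        rw [pow_succ, pow_add]
        generalize κ ^ N = z
        rw [hκ]; field_simp
  refine mem_SP_iff.2 ⟨S, fun m => ?_⟩
  by_contra hcon
  rw [not_le] at hcon
  have hlim := (tendsto_pow_atTop_nhds_zero_of_lt_one hκ0 (ratio_lt hr hd)).const_mul (K / r ^ m)
  rw [mul_zero] at hlim
  have : absK p k (PowerSeries.coeff m y) ≤ 0 := ge_of_tendsto' hlim fun N => by
    rcases le_max_iff.1 (key N m) with h3 | h3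
    · exact absurd h3 (not_le.2 hcon)
    · refine h3.trans (le_of_eq ?_); ring
  exact absurd (hS0.trans hcon.le) (by linarith [hS0])

theorem IsDist.exists_div (h : IsDist P d) {r : ℝ} (hr : 0 < r) (h1 : r < 1)
    (hd : (p : ℝ)⁻¹ < r ^ d) {x : RingA p k} (hx : x ∈ Bd r hr) :
    ∃ q ∈ Bd (p := p) (k := k) r hr, x - P * q ∈ SP p k := by
  obtain ⟨K, hK⟩ := hx
  have hK0 := hK.nonneg
  have hp0 := p_pos (p := p)
  set κ := (p : ℝ)⁻¹ / r ^ d with hκ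
  have hκ0 : 0 ≤ κ := by positivity
  have hκ1 : κ < 1 := ratio_lt hr hd
  let T : RingA p k → RingA p k := fun y =>
    PowerSeries.mk fun i => PowerSeries.coeff (i + d) ((P - PowerSeries.X ^ d) * y)
  have hT : ∀ C y, NB r C y → NB r (κ * C) (T y) := by
    intro C y hy i
    have hC := hy.nonneg
    rw [PowerSeries.coeff_mk]
    refine (mul_le_mul_of_nonneg_right (h.lower_mul (K := C / r ^ (i + d)) (by positivity)
      fun b hb => ?_) (by positivity)).trans (le_of_eq ?_)
    · rw [le_div_iff₀ (by positivity)]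
      exact (mul_le_mul_of_nonneg_left (pow_le_pow_of_le_one hr.le h1.le hb)
        (by positivity)).trans (hy b)
    · rw [hκ, pow_add]; field_simp
  have hTsub : ∀ y z, T (y - z) = T y - T z := by
    intro y z; ext i; simp [T, mul_sub]
  have hTsum : ∀ (s : Finset ℕ) (f : ℕ → RingA p k), T (∑ j ∈ s, f j) = ∑ j ∈ s, T (f j) := by
    intro s f; ext i; simp [T, Finset.mul_sum]
  let x0 : RingA p k := PowerSeries.mk fun i => PowerSeries.coeff (i + d) x
  let t : ℕ → RingA p k := fun j => (fun y => -T y)^[j] x0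
  have ht1 : ∀ j, t (j + 1) = -T (t j) := fun j => Function.iterate_succ_apply' _ _ _
  have ht : ∀ j, NB r (K / r ^ d * κ ^ j) (t j) := by
    intro j
    induction j with
    | zero =>
      intro i
      change absK p k (PowerSeries.coeff i x0) * _ ≤ _
      rw [PowerSeries.coeff_mk, pow_zero, mul_one, le_div_iff₀ (by positivity), mul_assoc,
        ← pow_add]
      exact hK _
    | succ j ih =>
      rw [ht1]
      refine ((hT _ _ ih).neg).mono (le_of_eq ?_)
      ring
  obtain ⟨q, hq⟩ := exists_NB_series hr hκ0 hκ1 (show 0 ≤ K / r ^ d by positivity) t ht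
  have hqB : NB r (K / r ^ d) q := by simpa using hq 0
  have heq : q + T q - x0 = 0 := by
    refine eq_zero_of_NB (C := K / r ^ d) hr hκ0 hκ1 fun N => ?_
    have h3 : q + T q - x0 = (q - ∑ j ∈ Finset.range N, t j) +
        T (q - ∑ j ∈ Finset.range N, t j) - t N := by
      have h4 : ∑ j ∈ Finset.range N, T (t j) = -∑ j ∈ Finset.range N, t (j + 1) := by
        rw [← Finset.sum_neg_distrib]; exact Finset.sum_congr rfl fun j _ => by rw [ht1, neg_neg]
      have h5 := Finset.sum_range_sub t N
      rw [Finset.sum_sub_distrib] at h5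
      have h6 : t 0 = x0 := rfl
      rw [hTsub, hTsum, h4, ← h6]
      linear_combination (-1 : RingA p k) * h5
    rw [h3]
    refine NB.sub hr.le ((hq N).add hr.le ((hT _ _ (hq N)).mono ?_)) (ht N)
    exact mul_le_of_le_one_left (by positivity) hκ1.le
  refine ⟨q, ⟨_, hqB⟩, ?_⟩
  have hz : ∀ i, d ≤ i → PowerSeries.coeff i (x - P * q) = 0 := by
    intro i hi
    obtain ⟨i, rfl⟩ := Nat.exists_eq_add_of_le' hi
    have := congrArg (PowerSeries.coeff i) heq
    rw [map_sub, map_add, PowerSeries.coeff_mk, PowerSeries.coeff_mk, map_zero] at this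
    rw [map_sub, coeff_add_split]
    linear_combination -this
  refine mem_SP_iff.2 ⟨∑ i ∈ Finset.range d, absK p k (PowerSeries.coeff i (x - P * q)),
    fun i => ?_⟩
  rcases lt_or_ge i d with hi | hi
  · exact Finset.single_le_sum (f := fun i => absK p k (PowerSeries.coeff i (x - P * q)))
      (fun _ _ => (absK p k).nonneg _) (Finset.mem_range.2 hi)
  · rw [hz i hi, map_zero]
    exact Finset.sum_nonneg fun _ _ => (absK p k).nonneg _

end Bounds

section Eisenstein

set_option linter.unusedSectionVars false

variable (p : ℕ) [hp : Fact p.Prime] (k : Type u) [Field k] [CharP k p] [PerfectRing k p]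

/-- An Eisenstein polynomial `E = u ^ e + c_{e-1} u ^ (e-1) + ⋯ + c₀` over `W(k)` with `e ≥ 1`.
These are exactly the minimal polynomials over `K₀` of the uniformizers `π_K` of the totally
ramified extensions `K` of `K₀` (of degree `e`). -/
structure EisensteinPoly where
  /-- the polynomial -/
  poly : Polynomial (WittVector p k)
  monic : poly.Monic
  natDegree_pos : 0 < poly.natDegree
  isEisenstein : poly.IsEisensteinAt (Ideal.span {(p : WittVector p k)})

variable {p k}

namespace EisensteinPoly

variable (E : EisensteinPoly p k)

/-- The ramification index `e = deg E`. -/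
def deg : ℕ := E.poly.natDegree

/-- `E` as an element of `𝒜`. -/
def ser : RingA p k := (E.poly.map (algebraMap (WittVector p k) (K0 p k)) : Polynomial (K0 p k))

/-- `φⁿ(E)` as an element of `𝒜`. -/
def serN (n : ℕ) : RingA p k := (phi p k)^[n] E.ser

/-- `E / E(0)`. -/
def normalized : RingA p k := PowerSeries.C (PowerSeries.constantCoeff E.ser)⁻¹ * E.ser

/-- `λ = ∏ₙ φⁿ(E / E(0))`. As `φⁿ(E / E(0)) ≡ 1` modulo `u ^ pⁿ`, the coefficient of `u ^ m` in the
infinite product is the one in the product of the factors of index `n ≤ m`. -/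
def lam : RingA p k := PowerSeries.mk fun m =>
  PowerSeries.coeff m (∏ n ∈ Finset.range (m + 1), (phi p k)^[n] E.normalized)

theorem coeff_ser (i : ℕ) : PowerSeries.coeff i E.ser =
    algebraMap (WittVector p k) (K0 p k) (E.poly.coeff i) := by
  rw [ser, Polynomial.coeff_coe, Polynomial.coeff_map]

theorem isDist_ser : IsDist E.ser E.deg where
  top := by rw [coeff_ser, deg, E.monic.coeff_natDegree, map_one]
  high i hi := by rw [coeff_ser, Polynomial.coeff_eq_zero_of_natDegree_lt hi, map_zero]
  low i hi := by
    rw [coeff_ser]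
    obtain ⟨c, hc⟩ := Ideal.mem_span_singleton.1 (E.isEisenstein.mem hi)
    rw [hc, map_mul, map_mul, map_natCast, absK_p]
    exact mul_le_of_le_one_right (inv_nonneg.2 (p_pos (p := p)).le) (absK_int c)

theorem isDist_serN (n : ℕ) : IsDist (E.serN n) (p ^ n * E.deg) := by
  induction n with
  | zero => simpa [serN] using E.isDist_ser
  | succ n ih =>
    rw [serN, Function.iterate_succ_apply', pow_succ', mul_assoc]
    exact ih.phi

theorem absK_ser_zero : absK p k (PowerSeries.constantCoeff E.ser) = (p : ℝ)⁻¹ := by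
  refine le_antisymm ?_ ?_
  · rw [← PowerSeries.coeff_zero_eq_constantCoeff_apply]
    exact E.isDist_ser.low 0 E.natDegree_pos
  · obtain ⟨c, hc⟩ := Ideal.mem_span_singleton.1 (E.isEisenstein.mem E.natDegree_pos)
    have hu : absK p k (algebraMap _ _ c) = 1 := by
      refine (IsDedekindDomain.HeightOneSpectrum.adicAbv_coe_eq_one_iff _ _ _).2 fun h => ?_
      rw [mem_maximalIdeal_iff] at h
      obtain ⟨b, rfl⟩ := h
      refine E.isEisenstein.notMem ?_
      rw [hc, Ideal.span_singleton_pow, Ideal.mem_span_singleton]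
      exact ⟨b, by ring⟩
    rw [← PowerSeries.coeff_zero_eq_constantCoeff_apply, coeff_ser, hc, map_mul, map_mul,
      map_natCast, absK_p, hu, mul_one]

theorem absK_serN_zero (n : ℕ) : absK p k (PowerSeries.constantCoeff (E.serN n)) = (p : ℝ)⁻¹ := by
  induction n with
  | zero => exact E.absK_ser_zero
  | succ n ih => rw [serN, Function.iterate_succ_apply', constantCoeff_phi, absK_phi0]; exact ih

theorem constantCoeff_serN_ne (n : ℕ) : PowerSeries.constantCoeff (E.serN n) ≠ 0 := by
  intro h
  have := E.absK_serN_zero n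
  rw [h, map_zero] at this
  exact (inv_pos.2 (p_pos (p := p))).ne this

theorem constantCoeff_ser_ne : PowerSeries.constantCoeff E.ser ≠ 0 := E.constantCoeff_serN_ne 0

theorem serN_mem (n : ℕ) : E.serN n ∈ SP p k := (E.isDist_serN n).mem_SP

theorem C_mem (R : Subalgebra (K0 p k) (RingA p k)) (c : K0 p k) : PowerSeries.C c ∈ R :=
  R.algebraMap_mem c

theorem normalized_mem : E.normalized ∈ SP p k := (SP p k).mul_mem (C_mem _ _) (E.serN_mem 0)

theorem constantCoeff_normalized : PowerSeries.constantCoeff E.normalized = 1 := by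
  rw [normalized, map_mul, PowerSeries.constantCoeff_C, inv_mul_cancel₀ E.constantCoeff_ser_ne]

theorem ser_eq : E.ser = PowerSeries.C (PowerSeries.constantCoeff E.ser) * E.normalized := by
  rw [normalized, ← mul_assoc, ← map_mul, mul_inv_cancel₀ E.constantCoeff_ser_ne, map_one, one_mul]

theorem isContraction_lam :
    IsContraction fun (F : Unit → RingA p k) s => E.normalized * phi p k (F s) := by
  intro n F G hn h s
  rw [← mul_sub, ← map_sub]
  refine Dvd.dvd.mul_left ((pow_dvd_pow _ ?_).trans (X_pow_dvd_phi (h s))) _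
  calc n + 1 ≤ n + n := by omega
    _ = 2 * n := by ring
    _ ≤ p * n := Nat.mul_le_mul_right _ hp.out.two_le

theorem iterate_lam (j : ℕ) :
    (fun (F : Unit → RingA p k) s => E.normalized * phi p k (F s))^[j] (fun _ => 1) =
      fun _ => ∏ n ∈ Finset.range j, (phi p k)^[n] E.normalized := by
  induction j with
  | zero => simp
  | succ j ih =>
    rw [Function.iterate_succ_apply', ih]
    funext s
    rw [Finset.prod_range_succ', map_prod, mul_comm]
    simp only [Function.iterate_succ_apply', Function.iterate_zero, id]

theorem lam_eq : E.lam = E.normalized * phi p k E.lam := by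
  have h1 : (fun _ : Unit => E.lam) =
      iterLimit (fun (F : Unit → RingA p k) s => E.normalized * phi p k (F s)) (fun _ => 1) := by
    funext s
    ext m
    rw [iterLimit, PowerSeries.coeff_mk, iterate_lam, lam, PowerSeries.coeff_mk]
  have h2 := E.isContraction_lam.apply_iterLimit (F := fun _ => 1) (by
    intro s
    rw [map_one, mul_one, PowerSeries.X_dvd_iff, map_sub, constantCoeff_normalized, map_one,
      sub_self])
  rw [← h1] at h2
  exact (congrFun h2 ()).symm

theorem constantCoeff_lam : PowerSeries.constantCoeff E.lam = 1 := by
  rw [← PowerSeries.coeff_zero_eq_constantCoeff_apply, lam, PowerSeries.coeff_mk]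
  simp [constantCoeff_normalized]

theorem lam_mem : E.lam ∈ RingO p k := by
  obtain ⟨B, hB⟩ := mem_SP_iff.1 E.normalized_mem
  have hB0 : 0 ≤ B := le_trans ((absK p k).nonneg _) (hB 0)
  refine growth (fun _ : Unit => E.lam) (Q := B) (B := 1) zero_le_one ?_ ?_ ()
  · simp [constantCoeff_lam]
  · intro n _ K hK h _
    rw [lam_eq]
    exact absK_coeff_mul_phi_le hB0 hK hB fun m hm => h m hm ()

/-- `𝔖[1/p, 1/E]`. -/
def SPE : Subalgebra (K0 p k) (RingA p k) := away (SP p k) E.ser (E.serN_mem 0)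

/-- `𝒪[1/λ]`. -/
def OL : Subalgebra (K0 p k) (RingA p k) := away (RingO p k) E.lam E.lam_mem

theorem SP_le_SPE : SP p k ≤ E.SPE := le_away _ _ _

theorem O_le_OL : RingO p k ≤ E.OL := le_away _ _ _

theorem SP_le_OL : SP p k ≤ E.OL := SP_le_O.trans E.O_le_OL

theorem SPE_le_OL : E.SPE ≤ E.OL := by
  rintro x ⟨n, hn⟩
  refine ⟨n, ?_⟩
  have h1 : E.lam ^ n * x = phi p k E.lam ^ n *
      (PowerSeries.C (PowerSeries.constantCoeff E.ser)⁻¹ ^ n * (E.ser ^ n * x)) := by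
    conv_lhs => rw [lam_eq, normalized]
    ring
  rw [h1]
  exact (RingO p k).mul_mem ((RingO p k).pow_mem (phi_mem_O E.lam_mem) n)
    ((RingO p k).mul_mem ((RingO p k).pow_mem (C_mem _ _) n) (SP_le_O hn))

theorem phi_mem_OL {x : RingA p k} (hx : x ∈ E.OL) : phi p k x ∈ E.OL := by
  obtain ⟨n, hn⟩ := hx
  refine ⟨n, ?_⟩
  have h1 : E.lam ^ n * phi p k x = E.normalized ^ n * phi p k (E.lam ^ n * x) := by
    conv_lhs => rw [lam_eq]
    rw [map_mul, map_pow]; ring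
  rw [h1]
  exact (RingO p k).mul_mem ((RingO p k).pow_mem (SP_le_O E.normalized_mem) n) (phi_mem_O hn)

/-- The value `|x|_r` of `x ∈ 𝒪[1/λ]`: it is `|λᴺ x|_r |λ|_r⁻ᴺ` for `λᴺ x ∈ 𝒪`. -/
def normOL (r : ℝ) (x : E.OL) : ℝ :=
  gaussNorm p k r (E.lam ^ (Classical.choose x.2) * x) / gaussNorm p k r E.lam ^ (Classical.choose x.2)

/-- `|π_K| = |p| ^ (1 / e)`. -/
def absPi : ℝ := ((p : ℝ)⁻¹) ^ ((E.deg : ℝ)⁻¹)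

theorem lam_ne : PowerSeries.constantCoeff E.lam ≠ 0 := by
  rw [constantCoeff_lam]; exact one_ne_zero

theorem inv_mem_away (R : Subalgebra (K0 p k) (RingA p k)) (a : RingA p k) (ha : a ∈ R)
    (h : PowerSeries.constantCoeff a ≠ 0) : a⁻¹ ∈ away R a ha :=
  ⟨1, by rw [pow_one, PowerSeries.mul_inv_cancel _ h]; exact R.one_mem⟩

/-- A homomorphism on `R` that inverts `a` extends to `R[1/a]`. -/
theorem exists_awayLift (R : Subalgebra (K0 p k) (RingA p k)) (a : RingA p k) (ha : a ∈ R)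
    (h : PowerSeries.constantCoeff a ≠ 0) {T : Type*} [CommRing T] (f : R →+* T)
    (hf : IsUnit (f ⟨a, ha⟩)) :
    ∃ g : away R a ha →+* T, g.comp (Subalgebra.inclusion (le_away R a ha)).toRingHom = f := by
  let : Algebra R (away R a ha) := (Subalgebra.inclusion (le_away R a ha)).toRingHom.toAlgebra
  have hmap : ∀ x : R, ((algebraMap R (away R a ha) x : away R a ha) : RingA p k) = x :=
    fun x => rfl
  have hpow : ∀ n : ℕ, a⁻¹ ^ n * a ^ n = 1 := fun n => by
    rw [← mul_pow, PowerSeries.inv_mul_cancel _ h, one_pow]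
  have : IsLocalization.Away (⟨a, ha⟩ : R) (away R a ha) := by
    refine ⟨?_, ?_, ?_⟩
    · rintro ⟨y, n, rfl⟩
      refine IsUnit.of_mul_eq_one (⟨a⁻¹, inv_mem_away R a ha h⟩ ^ n) (Subtype.ext ?_)
      rw [map_pow]
      change a ^ n * a⁻¹ ^ n = 1
      rw [mul_comm]; exact hpow n
    · rintro ⟨x, n, hn⟩
      exact ⟨(⟨a ^ n * x, hn⟩, ⟨⟨a, ha⟩ ^ n, n, rfl⟩), Subtype.ext (by
        change x * a ^ n = a ^ n * x
        ring)⟩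
    · intro x y hxy
      refine ⟨1, ?_⟩
      have : (x : RingA p k) = y := congrArg (Subtype.val : away R a ha → RingA p k) hxy
      rw [Subtype.ext this]
  exact ⟨IsLocalization.Away.lift (⟨a, ha⟩ : R) hf, IsLocalization.Away.lift_comp _ hf⟩

theorem serN_isUnit_OL (n : ℕ) : IsUnit (⟨E.serN n, E.SP_le_OL (E.serN_mem n)⟩ : E.OL) := by
  have h1 : ∀ n, (phi p k)^[n] E.lam = PowerSeries.C (PowerSeries.constantCoeff (E.serN n))⁻¹ *
      E.serN n * (phi p k)^[n + 1] E.lam := by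
    intro n
    induction n with
    | zero => exact E.lam_eq
    | succ n ih =>
      rw [Function.iterate_succ_apply', ih, map_mul, map_mul, phi_C, map_inv₀, ← constantCoeff_phi,
        ← Function.iterate_succ_apply' (phi p k) (n + 1)]
      simp only [serN, Function.iterate_succ_apply']
  have h2 : ∀ n, ∃ g ∈ E.OL, (phi p k)^[n] E.lam * g = 1 := by
    intro n
    induction n with
    | zero =>
      exact ⟨E.lam⁻¹, inv_mem_away _ _ _ E.lam_ne, PowerSeries.mul_inv_cancel _ E.lam_ne⟩
    | succ n ih =>
      obtain ⟨g, hg, h⟩ := ih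
      refine ⟨phi p k g, E.phi_mem_OL hg, ?_⟩
      rw [Function.iterate_succ_apply', ← map_mul, h, map_one]
  have h3 : ∀ n, (phi p k)^[n] E.lam ∈ E.OL := by
    intro n
    induction n with
    | zero => exact E.O_le_OL E.lam_mem
    | succ n ih => rw [Function.iterate_succ_apply']; exact E.phi_mem_OL ih
  obtain ⟨g, hg, h⟩ := h2 n
  refine IsUnit.of_mul_eq_one ⟨PowerSeries.C (PowerSeries.constantCoeff (E.serN n))⁻¹ *
    (phi p k)^[n + 1] E.lam * g, E.OL.mul_mem (E.OL.mul_mem (C_mem _ _) (h3 _)) hg⟩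
    (Subtype.ext ?_)
  change E.serN n * (PowerSeries.C (PowerSeries.constantCoeff (E.serN n))⁻¹ *
    (phi p k)^[n + 1] E.lam * g) = 1
  rw [← h, h1 n]; ring

/-- `φⁿ(E)` as a unit of `𝒪[1/λ]`. -/
def unitE (n : ℕ) : (E.OL)ˣ := (E.serN_isUnit_OL n).unit

end EisensteinPoly

end Eisenstein

section Completions

set_option linter.unusedSectionVars false

variable (p : ℕ) [hp : Fact p.Prime] (k : Type u) [Field k] [CharP k p] [PerfectRing k p]

/-- The Frobenius of `𝔖[1/p]`. -/
def phiSP : SP p k →+* SP p k where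
  toFun x := ⟨phi p k x, phi_mem_SP x.2⟩
  map_one' := Subtype.ext (map_one _)
  map_mul' _ _ := Subtype.ext (map_mul _ _ _)
  map_zero' := Subtype.ext (map_zero _)
  map_add' _ _ := Subtype.ext (map_add _ _ _)

/-- Reduction modulo `u`: `𝔖[1/p] → K₀`. -/
def redSP : SP p k →+* K0 p k := PowerSeries.constantCoeff.comp (SP p k).val.toRingHom

/-- The inclusion `K₀ ⊆ 𝔖[1/p]`. -/
def kToSP : K0 p k →+* SP p k := algebraMap _ _

variable {p k}

/-- The inclusion of `𝔖[1/p]` into the ring of series bounded for the radius `r < 1`. -/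
def spToBd {r : ℝ} (hr : 0 < r) (h1 : r < 1) : SP p k →+* Bd (p := p) (k := k) r hr :=
  (Subalgebra.inclusion (SP_le_Bd hr h1)).toRingHom

section Quotient

variable {P : SP p k} {d : ℕ} (hP : IsDist (P : RingA p k) d) {r : ℝ} (hr : 0 < r) (h1 : r < 1)
  (hd : (p : ℝ)⁻¹ < r ^ d)

theorem quotLe (m : ℕ) : Ideal.span {P} ^ m ≤
    Ideal.comap (spToBd hr h1) (Ideal.span {spToBd hr h1 P} ^ m) := by
  rw [Ideal.span_singleton_pow, Ideal.span_singleton_le_iff_mem, Ideal.mem_comap, map_pow,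
    Ideal.span_singleton_pow]
  exact Ideal.mem_span_singleton_self _

/-- `𝔖[1/p] / Pᵐ → R / Pᵐ`. -/
def quotHom (P : SP p k) (m : ℕ) : SP p k ⧸ (Ideal.span {P} ^ m) →+*
    Bd (p := p) (k := k) r hr ⧸ (Ideal.span {spToBd hr h1 P} ^ m) :=
  Ideal.quotientMap _ (spToBd hr h1) (quotLe hr h1 m)

theorem IsDist.ne_zero {P : RingA p k} (hP : IsDist P d) : P ≠ 0 := by
  rintro rfl
  have := hP.top
  rw [map_zero] at this
  exact zero_ne_one this

theorem quotHom_bijective {P : SP p k} {d : ℕ} (hP : IsDist (P : RingA p k) d) {r : ℝ} (hr : 0 < r)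
    (h1 : r < 1) (hd : (p : ℝ)⁻¹ < r ^ d) (m : ℕ) : Function.Bijective (quotHom hr h1 P m) := by
  constructor
  · have key : ∀ m (s : SP p k) (y : Bd (p := p) (k := k) r hr),
        (s : RingA p k) = (P : RingA p k) ^ m * y → ∃ t : SP p k, s = P ^ m * t := by
      intro m
      induction m with
      | zero => exact fun s y _ => ⟨s, by simp⟩
      | succ m ih =>
        intro s y hs
        have hPm : (P : RingA p k) ^ m ∈ Bd (p := p) (k := k) r hr :=
          pow_mem (SP_le_Bd hr h1 P.2) m
        have h2 : (P : RingA p k) * ((P : RingA p k) ^ m * y) ∈ SP p k := by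
          rw [← mul_assoc, ← pow_succ', ← hs]; exact s.2
        obtain ⟨t, ht⟩ := ih ⟨_, hP.mem_SP_of_mul hr h1 hd (mul_mem hPm y.2) h2⟩ y rfl
        refine ⟨t, Subtype.ext ?_⟩
        have ht' : (P : RingA p k) ^ m * y = (P : RingA p k) ^ m * t := congrArg Subtype.val ht
        change (s : RingA p k) = (P : RingA p k) ^ (m + 1) * t
        rw [hs, pow_succ', mul_assoc, ht', mul_assoc]
    intro a b hab
    obtain ⟨s, rfl⟩ := Ideal.Quotient.mk_surjective a
    obtain ⟨s', rfl⟩ := Ideal.Quotient.mk_surjective b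
    rw [quotHom, Ideal.quotientMap_mk, Ideal.quotientMap_mk, Ideal.Quotient.mk_eq_mk_iff_sub_mem,
      ← map_sub, Ideal.span_singleton_pow, Ideal.mem_span_singleton] at hab
    obtain ⟨y, hy⟩ := hab
    obtain ⟨t, ht⟩ := key m (s - s') y (congrArg Subtype.val hy)
    rw [Ideal.Quotient.mk_eq_mk_iff_sub_mem, ht, Ideal.span_singleton_pow]
    exact Ideal.mul_mem_right _ _ (Ideal.mem_span_singleton_self _)
  · have key : ∀ m (x : Bd (p := p) (k := k) r hr), ∃ (s : SP p k) (y : Bd (p := p) (k := k) r hr),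
        x - spToBd hr h1 s = spToBd hr h1 P ^ m * y := by
      intro m
      induction m with
      | zero => exact fun x => ⟨0, x, by simp⟩
      | succ m ih =>
        intro x
        obtain ⟨s, y, hs⟩ := ih x
        obtain ⟨q, hq, hq'⟩ := hP.exists_div hr h1 hd y.2
        refine ⟨s + P ^ m * ⟨_, hq'⟩, ⟨q, hq⟩, Subtype.ext ?_⟩
        have hs' : (x : RingA p k) - s = (P : RingA p k) ^ m * y := congrArg Subtype.val hs
        change (x : RingA p k) - (s + (P : RingA p k) ^ m * (y - P * q)) =
          (P : RingA p k) ^ (m + 1) * q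
        linear_combination hs'
    intro a
    obtain ⟨x, rfl⟩ := Ideal.Quotient.mk_surjective a
    obtain ⟨s, y, hs⟩ := key m x
    refine ⟨Ideal.Quotient.mk _ s, ?_⟩
    rw [quotHom, Ideal.quotientMap_mk, eq_comm, Ideal.Quotient.mk_eq_mk_iff_sub_mem, hs,
      Ideal.span_singleton_pow]
    exact Ideal.mul_mem_right _ _ (Ideal.mem_span_singleton_self _)

/-- Reduction modulo `Pᵐ` of a series that converges on a disc containing the roots of `P`. -/
def bdToQuot (m : ℕ) : Bd (p := p) (k := k) r hr →+* SP p k ⧸ (Ideal.span {P} ^ m) :=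
  (RingEquiv.ofBijective _ (quotHom_bijective hP hr h1 hd m)).symm.toRingHom.comp
    (Ideal.Quotient.mk _)

theorem quotHom_bdToQuot (m : ℕ) (x : Bd (p := p) (k := k) r hr) :
    quotHom hr h1 P m (bdToQuot hP hr h1 hd m x) = Ideal.Quotient.mk _ x :=
  (RingEquiv.ofBijective _ (quotHom_bijective hP hr h1 hd m)).apply_symm_apply _

theorem bdToQuot_spToBd (m : ℕ) (s : SP p k) :
    bdToQuot hP hr h1 hd m (spToBd hr h1 s) = Ideal.Quotient.mk _ s := by
  refine (quotHom_bijective hP hr h1 hd m).1 ?_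
  rw [quotHom_bdToQuot, quotHom, Ideal.quotientMap_mk]

theorem factorPow_bdToQuot {m n : ℕ} (hle : m ≤ n) :
    (Ideal.Quotient.factorPow (Ideal.span {P}) hle).comp (bdToQuot hP hr h1 hd n) =
      bdToQuot hP hr h1 hd m := by
  ext x
  refine (quotHom_bijective hP hr h1 hd m).1 ?_
  rw [quotHom_bdToQuot]
  have hsq : ∀ a, quotHom hr h1 P m (Ideal.Quotient.factorPow (Ideal.span {P}) hle a) =
      Ideal.Quotient.factorPow (Ideal.span {spToBd hr h1 P}) hle (quotHom hr h1 P n a) := by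
    intro a
    obtain ⟨s, rfl⟩ := Ideal.Quotient.mk_surjective a
    rfl
  rw [RingHom.comp_apply, hsq, quotHom_bdToQuot]
  rfl

/-- The extension of `𝔖[1/p] → lim 𝔖[1/p] / Pᵐ` to series that converge on a larger disc. -/
def bdToCompletion : Bd (p := p) (k := k) r hr →+* AdicCompletion (Ideal.span {P}) (SP p k) :=
  AdicCompletion.liftRingHom _ (bdToQuot hP hr h1 hd) (factorPow_bdToQuot hP hr h1 hd)

theorem bdToCompletion_spToBd (s : SP p k) : bdToCompletion hP hr h1 hd (spToBd hr h1 s) =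
    algebraMap (SP p k) (AdicCompletion (Ideal.span {P}) (SP p k)) s := by
  refine AdicCompletion.ext_evalₐ fun n => ?_
  rw [bdToCompletion, AdicCompletion.evalₐ_liftRingHom, bdToQuot_spToBd, AlgHom.commutes]
  rfl

end Quotient

namespace EisensteinPoly

variable (E : EisensteinPoly p k)

/-- `φⁿ(E)` as an element of `𝔖[1/p]`. -/
def serSP (n : ℕ) : SP p k := ⟨E.serN n, E.serN_mem n⟩

/-- `Ŝₙ`, the completion of `𝔖[1/p]` for the ideal generated by `φⁿ(E)`; in particular
`E.Shat 0` is `Ŝ`. -/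
abbrev Shat (n : ℕ) : Type u := AdicCompletion (Ideal.span {E.serSP n}) (SP p k)

/-- The canonical map `𝔖[1/p] → Ŝₙ`. -/
def spToShat (n : ℕ) : SP p k →+* E.Shat n := algebraMap _ _

/-- `Ŝₙ[1/φⁿ(E)]`. -/
def Lhat (n : ℕ) : Type u := Localization.Away (E.spToShat n (E.serSP n))

instance (n : ℕ) : CommRing (E.Lhat n) :=
  inferInstanceAs (CommRing (Localization.Away (E.spToShat n (E.serSP n))))

instance (n : ℕ) : Algebra (E.Shat n) (E.Lhat n) :=
  inferInstanceAs (Algebra (E.Shat n) (Localization.Away (E.spToShat n (E.serSP n))))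

instance (n : ℕ) : IsLocalization.Away (E.spToShat n (E.serSP n)) (E.Lhat n) :=
  inferInstanceAs (IsLocalization.Away (E.spToShat n (E.serSP n))
    (Localization.Away (E.spToShat n (E.serSP n))))

/-- The canonical map `𝔖[1/p] → Ŝₙ[1/φⁿ(E)]`. -/
def spToLhat (n : ℕ) : SP p k →+* E.Lhat n := (algebraMap (E.Shat n) (E.Lhat n)).comp (E.spToShat n)

/-- The canonical map `K₀ → Ŝₙ[1/φⁿ(E)]`. -/
def kToLhat (n : ℕ) : K0 p k →+* E.Lhat n := (E.spToLhat n).comp (kToSP p k)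

/-- A radius in `]|π_K|^(p⁻ⁿ), 1[`, namely `|π_K|^(p⁻ⁿ⁻¹)`. -/
def radius (n : ℕ) : ℝ := ((p : ℝ)⁻¹) ^ (((p ^ (n + 1) * E.deg : ℕ) : ℝ)⁻¹)

theorem radius_pos (n : ℕ) : 0 < E.radius n := Real.rpow_pos_of_pos (inv_pos.2 (p_pos (p := p))) _

theorem inv_p_lt : (p : ℝ)⁻¹ < 1 := inv_lt_one_of_one_lt₀ (by exact_mod_cast hp.out.one_lt)

theorem exponent_pos (n : ℕ) : 0 < p ^ n * E.deg :=
  Nat.mul_pos (pow_pos hp.out.pos _) E.natDegree_pos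

theorem radius_lt_one (n : ℕ) : E.radius n < 1 :=
  Real.rpow_lt_one (inv_nonneg.2 (p_pos (p := p)).le) inv_p_lt
    (inv_pos.2 (by exact_mod_cast E.exponent_pos (n + 1)))

theorem radius_pow (n : ℕ) : E.radius n ^ (p ^ (n + 1) * E.deg) = (p : ℝ)⁻¹ :=
  Real.rpow_inv_natCast_pow (inv_nonneg.2 (p_pos (p := p)).le) (E.exponent_pos (n + 1)).ne'

theorem lt_radius_pow (n : ℕ) : (p : ℝ)⁻¹ < E.radius n ^ (p ^ n * E.deg) := by
  rw [← E.radius_pow n]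
  refine pow_lt_pow_right_of_lt_one₀ (E.radius_pos n) (E.radius_lt_one n) ?_
  rw [pow_succ, mul_right_comm]
  exact lt_mul_of_one_lt_right (E.exponent_pos n) hp.out.one_lt

/-- The map to `Ŝₙ` from the ring of series that are bounded for the radius `E.radius n`. -/
def bdToShat (n : ℕ) : Bd (p := p) (k := k) (E.radius n) (E.radius_pos n) →+* E.Shat n :=
  bdToCompletion (P := E.serSP n) (E.isDist_serN n) (E.radius_pos n) (E.radius_lt_one n)
    (E.lt_radius_pow n)

/-- The map `𝒪 → Ŝₙ` extending `𝔖[1/p] → Ŝₙ`: its component `𝒪 → 𝔖[1/p] / φⁿ(E)ᵐ` sends `x` to the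
class of the `s ∈ 𝔖[1/p]` with `x - s` divisible by `φⁿ(E)ᵐ`. -/
def oToShat (n : ℕ) : RingO p k →+* E.Shat n :=
  (E.bdToShat n).comp
    (Subalgebra.inclusion (O_le_Bd (E.radius_pos n) (E.radius_lt_one n))).toRingHom

theorem oToShat_SP (n : ℕ) (s : SP p k) : E.oToShat n ⟨s, SP_le_O s.2⟩ = E.spToShat n s :=
  bdToCompletion_spToBd (P := E.serSP n) (E.isDist_serN n) (E.radius_pos n) (E.radius_lt_one n)
    (E.lt_radius_pow n) s

/-! ### `λ` is invertible in `Ŝₙ[1/φⁿ(E)]` -/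

theorem serSP_isUnit_Lhat (n : ℕ) : IsUnit (E.spToLhat n (E.serSP n)) :=
  IsLocalization.Away.algebraMap_isUnit (S := E.Lhat n) (E.spToShat n (E.serSP n))

/-- `φⁱ(E) = u ^ d + p G` with `G` a unit of `𝔖`. -/
def gPart (i : ℕ) : RingA p k :=
  PowerSeries.C (p : K0 p k)⁻¹ * (E.serN i - PowerSeries.X ^ (p ^ i * E.deg))

theorem serN_eq (i : ℕ) : E.serN i = PowerSeries.X ^ (p ^ i * E.deg) +
    PowerSeries.C (p : K0 p k) * E.gPart i := by
  rw [gPart, ← mul_assoc, ← map_mul, mul_inv_cancel₀ p_ne_zero, map_one, one_mul]; ring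

theorem NB_gPart (i : ℕ) : NB 1 1 (E.gPart i) := fun n => by
  rw [gPart, PowerSeries.coeff_C_mul, map_mul, map_inv₀, absK_p, inv_inv, one_pow, mul_one]
  have := mul_le_mul_of_nonneg_left ((E.isDist_serN i).lower n) (p_pos (p := p)).le
  rwa [mul_inv_cancel₀ (p_pos (p := p)).ne'] at this

theorem constantCoeff_gPart (i : ℕ) : absK p k (PowerSeries.constantCoeff (E.gPart i)) = 1 := by
  rw [gPart, map_mul, map_sub, map_pow, PowerSeries.constantCoeff_X,
    zero_pow (E.exponent_pos i).ne', sub_zero, map_mul, PowerSeries.constantCoeff_C,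
    absK_serN_zero, map_inv₀, absK_p, inv_inv, mul_inv_cancel₀ (p_pos (p := p)).ne']

theorem NB_one_mem_SP {x : RingA p k} (h : NB 1 1 x) : x ∈ SP p k :=
  mem_SP_iff.2 ⟨1, fun n => by simpa using h n⟩

theorem serSP_isCoprime {m n : ℕ} (hmn : m < n) : IsCoprime (E.serSP m) (E.serSP n) := by
  obtain ⟨j, rfl⟩ := Nat.exists_eq_add_of_lt hmn
  set N := p ^ (j + 1) with hN
  set X : RingA p k := PowerSeries.X ^ (p ^ m * E.deg)
  set G := E.gPart m
  set G' := E.gPart (m + j + 1)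
  set c : RingA p k := PowerSeries.C (p : K0 p k)
  have hm : E.serN m = X + c * G := E.serN_eq m
  have hXm : X ∈ SP p k := NB_one_mem_SP (fun i => by
    rw [PowerSeries.coeff_X_pow]; split_ifs <;> simp)
  have hn : E.serN (m + j + 1) = X ^ N + c * G' := by
    rw [E.serN_eq, ← pow_mul, hN]; congr 2; ring
  have hG := NB_one_mem_SP (E.NB_gPart m)
  have hN2 : 2 ≤ N := hp.out.two_le.trans (Nat.le_self_pow (by omega) p)
  -- `X ^ N = (-c G) ^ N + E_m * Q`
  obtain ⟨Q, hQ⟩ : (⟨E.serN m, E.serN_mem m⟩ : SP p k) ∣ ⟨X, hXm⟩ ^ N -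
      (⟨-(c * G), (SP p k).neg_mem ((SP p k).mul_mem (C_mem _ _) hG)⟩ : SP p k) ^ N := by
    have h := sub_dvd_pow_sub_pow (⟨X, hXm⟩ : SP p k)
      (⟨-(c * G), (SP p k).neg_mem ((SP p k).mul_mem (C_mem _ _) hG)⟩ : SP p k) N
    have he : (⟨X, hXm⟩ : SP p k) -
        (⟨-(c * G), (SP p k).neg_mem ((SP p k).mul_mem (C_mem _ _) hG)⟩ : SP p k) =
        ⟨E.serN m, E.serN_mem m⟩ := Subtype.ext (by
          change X - -(c * G) = E.serN m
          rw [hm]; ring)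
    rwa [he] at h
  have hQ' : X ^ N - (-(c * G)) ^ N = E.serN m * Q := congrArg Subtype.val hQ
  -- the unit `U`
  set U : RingA p k := G' + c ^ (N - 1) * (-G) ^ N with hU
  have hcNB : NB 1 1 (c : RingA p k) := fun i => by
    simp only [c]
    rw [PowerSeries.coeff_C]
    split_ifs
    · simp only [one_pow, mul_one]; exact absK_p_lt_one.le
    · simp
  have hGN : NB 1 1 ((-G) ^ N) := ((E.NB_gPart m).neg).pow one_pos N
  have hUNB : NB 1 1 U :=
    (E.NB_gPart _).add zero_le_one (by simpa using (hcNB.pow one_pos (N - 1)).mul one_pos hGN)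
  have hU0 : absK p k (PowerSeries.constantCoeff U) = 1 := by
    have h2 : absK p k (PowerSeries.constantCoeff (c ^ (N - 1) * (-G) ^ N)) < 1 := by
      rw [map_mul, map_mul, map_pow, map_pow, PowerSeries.constantCoeff_C]
      refine (mul_le_of_le_one_right (by positivity) (by simpa using hGN 0)).trans_lt ?_
      exact pow_lt_one₀ ((absK p k).nonneg _) absK_p_lt_one (by omega)
    refine le_antisymm (by simpa using hUNB 0) ?_
    have h3 := absK_sub_le (PowerSeries.constantCoeff U)
      (PowerSeries.constantCoeff (c ^ (N - 1) * (-G) ^ N))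
    rw [← map_sub, hU, add_sub_cancel_right, constantCoeff_gPart, ← hU] at h3
    rcases le_max_iff.1 h3 with h4 | h4
    · exact h4
    · exact absurd h4 (not_le.2 h2)
  have hUne : PowerSeries.constantCoeff U ≠ 0 := fun h => by rw [h, map_zero] at hU0; norm_num at hU0
  have hUinv := NB_one_mem_SP (hUNB.inv one_pos hU0)
  have hrel : E.serN (m + j + 1) = E.serN m * Q + c * U := by
    rw [← hQ', hn, hU, mul_add, ← mul_assoc, ← pow_succ', Nat.sub_add_cancel (by omega), neg_pow,
      mul_pow, neg_pow G]; ring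
  set c' : RingA p k := PowerSeries.C (p : K0 p k)⁻¹
  have hcc : c * c' = 1 := by rw [← map_mul, mul_inv_cancel₀ p_ne_zero, map_one]
  have hUU : U * U⁻¹ = 1 := PowerSeries.mul_inv_cancel _ hUne
  refine ⟨-(Q * ⟨c', C_mem _ _⟩ * ⟨U⁻¹, hUinv⟩), ⟨c', C_mem _ _⟩ * ⟨U⁻¹, hUinv⟩, Subtype.ext ?_⟩
  change -((Q : RingA p k) * c' * U⁻¹) * E.serN m + c' * U⁻¹ * E.serN (m + j + 1) = 1
  rw [hrel]
  linear_combination U * U⁻¹ * hcc + hUU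

theorem serSP_isUnit_Shat {m n : ℕ} (hmn : m < n) : IsUnit (E.spToShat n (E.serSP m)) := by
  obtain ⟨a, b, hab⟩ := E.serSP_isCoprime hmn
  have hc := AdicCompletion.isAdicComplete_self (I := Ideal.span {E.serSP n})
    (Submodule.fg_span_singleton _)
  have hj := IsAdicComplete.le_jacobson_bot
    ((Ideal.span {E.serSP n}).map (algebraMap (SP p k) (E.Shat n)))
  have h1 := hj (Ideal.mem_map_of_mem (algebraMap (SP p k) (E.Shat n))
    (Ideal.mem_span_singleton_self (E.serSP n)))
  rw [Ideal.mem_jacobson_bot] at h1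
  have h2 := h1 (-(E.spToShat n b))
  have h3 := congrArg (E.spToShat n) hab
  rw [map_add, map_mul, map_mul, map_one] at h3
  have h4 : algebraMap (SP p k) (E.Shat n) (E.serSP n) * -(E.spToShat n b) + 1 =
      E.spToShat n a * E.spToShat n (E.serSP m) := by
    rw [← h3]; change E.spToShat n (E.serSP n) * _ + _ = _; ring
  rw [h4] at h2
  exact isUnit_of_mul_isUnit_right h2

theorem NB_phi_iter_lam (n : ℕ) : NB (E.radius n) 1 ((phi p k)^[n + 1] E.lam) := by
  have hr := E.radius_pos n
  have hr1 := E.radius_lt_one n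
  have hp0 := p_pos (p := p)
  -- the first factor
  have hnorm : ∀ i, (phi p k)^[i] E.normalized =
      PowerSeries.C (PowerSeries.constantCoeff (E.serN i))⁻¹ * E.serN i := by
    intro i
    induction i with
    | zero => rfl
    | succ i ih =>
      rw [Function.iterate_succ_apply', ih, map_mul, phi_C, map_inv₀, ← constantCoeff_phi]
      simp only [serN, Function.iterate_succ_apply']
  have hg : NB (E.radius n) 1 ((phi p k)^[n + 1] E.normalized) := by
    intro i
    rw [hnorm, PowerSeries.coeff_C_mul, map_mul, map_inv₀, absK_serN_zero, inv_inv]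
    have hD := E.isDist_serN (n + 1)
    rcases lt_trichotomy i (p ^ (n + 1) * E.deg) with hi | rfl | hi
    · refine mul_le_one₀ ?_ (by positivity) (pow_le_one₀ hr.le hr1.le)
      have := mul_le_mul_of_nonneg_left (hD.low i hi) hp0.le
      rwa [mul_inv_cancel₀ hp0.ne'] at this
    · rw [hD.top, map_one, mul_one, radius_pow, mul_inv_cancel₀ hp0.ne']
    · rw [hD.high i hi]; simp
  have heq : ∀ i, (phi p k)^[i] E.lam = (phi p k)^[i] E.normalized *
      phi p k ((phi p k)^[i] E.lam) := by
    intro i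
    induction i with
    | zero => exact E.lam_eq
    | succ i ih =>
      simp only [Function.iterate_succ_apply']
      conv_lhs => rw [ih]
      rw [map_mul]
  have h0 : ∀ i, PowerSeries.constantCoeff ((phi p k)^[i] E.lam) = 1 := by
    intro i
    induction i with
    | zero => exact E.constantCoeff_lam
    | succ i ih => rw [Function.iterate_succ_apply', constantCoeff_phi, ih, map_one]
  intro m
  induction m using Nat.strong_induction_on with
  | _ m ih =>
    rcases Nat.eq_zero_or_pos m with rfl | hm
    · rw [PowerSeries.coeff_zero_eq_constantCoeff_apply, h0]; simp
    rw [heq, ← le_div_iff₀ (by positivity), PowerSeries.coeff_mul]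
    refine absK_sum_le _ _ (by positivity) fun i hi => ?_
    have him := Finset.HasAntidiagonal.mem_antidiagonal.1 hi
    rw [le_div_iff₀ (by positivity), map_mul, ← him, pow_add]
    have hφ : absK p k (PowerSeries.coeff i.2 (phi p k ((phi p k)^[n + 1] E.lam))) *
        E.radius n ^ i.2 ≤ 1 := by
      rw [coeff_phi]
      split_ifs with hd
      · obtain ⟨b, hb⟩ := hd
        rw [absK_phi0, hb, Nat.mul_div_cancel_left _ hp.out.pos]
        have hbb : b ≤ p * b := Nat.le_mul_of_pos_left _ hp.out.pos
        refine le_trans (mul_le_mul_of_nonneg_left (pow_le_pow_of_le_one hr.le hr1.le hbb)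
          ((absK p k).nonneg _)) (ih b ?_)
        have h2 : 2 * b ≤ p * b := Nat.mul_le_mul_right _ hp.out.two_le
        omega
      · simp
    calc _ = (absK p k (PowerSeries.coeff i.1 ((phi p k)^[n + 1] E.normalized)) *
          E.radius n ^ i.1) * (absK p k (PowerSeries.coeff i.2
            (phi p k ((phi p k)^[n + 1] E.lam))) * E.radius n ^ i.2) := by ring
      _ ≤ 1 * 1 := mul_le_mul (hg _) hφ (by positivity) zero_le_one
      _ = 1 := one_mul 1

theorem lam_isUnit_Lhat (n : ℕ) :
    IsUnit (((algebraMap (E.Shat n) (E.Lhat n)).comp (E.oToShat n)) ⟨E.lam, E.lam_mem⟩) := by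
  have hmem : ∀ i, (phi p k)^[i] E.lam ∈ RingO p k := by
    intro i
    induction i with
    | zero => exact E.lam_mem
    | succ i ih => rw [Function.iterate_succ_apply']; exact phi_mem_O ih
  have h1 : ∀ n, (phi p k)^[n] E.lam = PowerSeries.C (PowerSeries.constantCoeff (E.serN n))⁻¹ *
      E.serN n * (phi p k)^[n + 1] E.lam := by
    intro n
    induction n with
    | zero => exact E.lam_eq
    | succ n ih =>
      rw [Function.iterate_succ_apply', ih, map_mul, map_mul, phi_C, map_inv₀, ← constantCoeff_phi,
        ← Function.iterate_succ_apply' (phi p k) (n + 1)]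
      simp only [serN, Function.iterate_succ_apply']
  set f := (algebraMap (E.Shat n) (E.Lhat n)).comp (E.oToShat n)
  have hSP : ∀ s : SP p k, f ⟨s, SP_le_O s.2⟩ = E.spToLhat n s := fun s => by
    simp only [f, RingHom.comp_apply, oToShat_SP]; rfl
  have hser : ∀ i ≤ n, IsUnit (E.spToLhat n (E.serSP i)) := by
    intro i hi
    rcases hi.lt_or_eq with h | rfl
    · exact (E.serSP_isUnit_Shat h).map (algebraMap (E.Shat n) (E.Lhat n))
    · exact E.serSP_isUnit_Lhat _
  have hC : ∀ c : K0 p k, c ≠ 0 → IsUnit (E.spToLhat n (kToSP p k c)) := fun c hc =>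
    (hc.isUnit.map (kToSP p k)).map _
  have htop : IsUnit (f ⟨_, hmem (n + 1)⟩) := by
    have hcc : PowerSeries.constantCoeff ((phi p k)^[n + 1] E.lam) = 1 := by
      generalize n + 1 = i
      induction i with
      | zero => exact E.constantCoeff_lam
      | succ i ih => rw [Function.iterate_succ_apply', constantCoeff_phi, ih, map_one]
    have hne : PowerSeries.constantCoeff ((phi p k)^[n + 1] E.lam) ≠ 0 := by
      rw [hcc]; exact one_ne_zero
    refine IsUnit.map (algebraMap (E.Shat n) (E.Lhat n)) (IsUnit.map (E.bdToShat n) ?_)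
    refine IsUnit.of_mul_eq_one ⟨_, 1, (E.NB_phi_iter_lam n).inv (E.radius_pos n) (by
      rw [hcc, map_one])⟩ (Subtype.ext (PowerSeries.mul_inv_cancel _ hne))
  have hdown : ∀ j ≤ n + 1, IsUnit (f ⟨_, hmem (n + 1 - j)⟩) := by
    intro j
    induction j with
    | zero => exact fun _ => htop
    | succ j ih =>
      intro hj
      obtain ⟨i, hi⟩ : ∃ i, n + 1 - j = i + 1 := ⟨n - j, by omega⟩
      have hi' : n + 1 - (j + 1) = i := by omega
      have h2 := ih (by omega)
      simp only [hi] at h2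
      simp only [hi']
      have h3 : (⟨_, hmem i⟩ : RingO p k) = ⟨_, SP_le_O (kToSP p k
          (PowerSeries.constantCoeff (E.serN i))⁻¹).2⟩ * ⟨_, SP_le_O (E.serSP i).2⟩ *
            ⟨_, hmem (i + 1)⟩ := Subtype.ext (h1 i)
      rw [h3, map_mul, map_mul, hSP, hSP]
      exact ((hC _ (inv_ne_zero (E.constantCoeff_serN_ne i))).mul (hser i (by omega))).mul h2
  have h := hdown (n + 1) le_rfl
  simp only [Nat.sub_self] at h
  exact h

theorem exists_olToLhat (n : ℕ) : ∃ g : E.OL →+* E.Lhat n,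
    g.comp (Subalgebra.inclusion E.O_le_OL).toRingHom =
      (algebraMap (E.Shat n) (E.Lhat n)).comp (E.oToShat n) :=
  exists_awayLift _ _ _ E.lam_ne _ (E.lam_isUnit_Lhat n)

/-- The map `𝒪[1/λ] → Ŝₙ[1/φⁿ(E)]` extending `𝒪 → Ŝₙ`. -/
def olToLhat (n : ℕ) : E.OL →+* E.Lhat n := Classical.choose (E.exists_olToLhat n)

theorem olToLhat_O (n : ℕ) (x : RingO p k) :
    E.olToLhat n ⟨x, E.O_le_OL x.2⟩ = algebraMap _ _ (E.oToShat n x) :=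
  DFunLike.congr_fun (Classical.choose_spec (E.exists_olToLhat n)) x

end EisensteinPoly
end Completions

section BaseChange

set_option linter.unusedSectionVars false

/-- The base change `M ⊗_{R,σ} S` of an `R`-module along a ring homomorphism `σ : R → S`. For
`R = S` and `σ = φ` this is the module `ᵠM`. -/
def BC {R : Type u} {S : Type v} [CommRing R] [CommRing S] (σ : R →+* S) (M : Type w)
    [AddCommGroup M] [Module R M] : Type max v w :=
  @TensorProduct R _ S M _ _ (Module.compHom S σ) _

variable {R : Type*} {S : Type*} {T : Type*} [CommRing R] [CommRing S] [CommRing T]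
  (σ : R →+* S) (M : Type*) [AddCommGroup M] [Module R M]

instance BC.addCommGroup : AddCommGroup (BC σ M) :=
  @TensorProduct.addCommGroup R _ S M _ _ (Module.compHom S σ) _

theorem BC.smulCommClass : @SMulCommClass R S S (Module.compHom S σ).toSMul _ :=
  @SMulCommClass.mk R S S (Module.compHom S σ).toSMul _ fun r s x => by
    change σ r * (s * x) = s * (σ r * x)
    ring

instance BC.moduleBase : Module S (BC σ M) :=
  @TensorProduct.leftModule R S _ _ S M _ _ _ (Module.compHom S σ) _
    (BC.smulCommClass σ)

/-- The tensor `s ⊗ m`. -/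
def BC.tmul (s : S) (m : M) : BC σ M := @TensorProduct.tmul R _ S M _ _ (Module.compHom S σ) _ s m

namespace BC

variable {M}

theorem tmul_add (s : S) (m m' : M) : tmul σ M s (m + m') = tmul σ M s m + tmul σ M s m' :=
  @TensorProduct.tmul_add R _ S M _ _ (Module.compHom S σ) _ _ _ _

theorem smul_tmul (s t : S) (m : M) : s • tmul σ M t m = tmul σ M (s * t) m := rfl

theorem tmul_smul (r : R) (s : S) (m : M) : tmul σ M s (r • m) = tmul σ M (σ r * s) m := by
  let := Module.compHom S σ
  exact (TensorProduct.smul_tmul (R := R) r s m).symm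

variable (M) in
/-- The canonical map `m ↦ 1 ⊗ m`. -/
def incl : M →ₛₗ[σ] BC σ M where
  toFun m := tmul σ M 1 m
  map_add' _ _ := tmul_add _ _ _ _
  map_smul' r m := by rw [tmul_smul, smul_tmul]

theorem induction {motive : BC σ M → Prop} (zero : motive 0)
    (incl : ∀ (s : S) (m : M), motive (s • incl σ M m))
    (add : ∀ x y, motive x → motive y → motive (x + y)) (x : BC σ M) : motive x := by
  refine @TensorProduct.induction_on R _ S M _ _ (Module.compHom S σ) _ motive x zero
    (fun s m => ?_) add
  have h := incl s m
  have h2 : s • BC.incl σ M m = tmul σ M s m := by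
    change s • tmul σ M 1 m = _
    rw [smul_tmul, mul_one]
  rwa [h2] at h

variable {σ}

theorem ext {θ : S →+* T} {P : Type*} [AddCommGroup P] [Module T P] {f g : BC σ M →ₛₗ[θ] P}
    (h : ∀ m, f (incl σ M m) = g (incl σ M m)) : f = g := by
  refine LinearMap.ext fun x => ?_
  refine BC.induction σ (motive := fun x => f x = g x) ?_ ?_ ?_ x
  · rw [map_zero, map_zero]
  · intro s m; rw [LinearMap.map_smulₛₗ, LinearMap.map_smulₛₗ, h]
  · intro x y hx hy; rw [map_add, map_add, hx, hy]

/-- A `τ`-semilinear map on `M` extends uniquely to a `θ`-semilinear map on `M ⊗_{R,σ} S`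
when `θ ∘ σ = τ`; it is given by `m ⊗ s ↦ θ(s) f(m)`. -/
def slift (θ : S →+* T) {τ : R →+* T} (h : θ.comp σ = τ) {P : Type*} [AddCommGroup P] [Module T P]
    (f : M →ₛₗ[τ] P) : BC σ M →ₛₗ[θ] P :=
  let g : BC σ M →+ P := @TensorProduct.liftAddHom R _ S M P _ _ _ (Module.compHom S σ) _
    { toFun := fun s =>
        { toFun := fun m => θ s • f m
          map_zero' := by rw [map_zero, smul_zero]
          map_add' := fun x y => by rw [map_add, smul_add] }
      map_zero' := by ext m; simp
      map_add' := fun x y => by ext m; simp [add_smul] }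
    (fun r s m => by
      change θ (σ r * s) • f m = θ s • f (r • m)
      have hr : θ (σ r) = τ r := RingHom.congr_fun h r
      rw [LinearMap.map_smulₛₗ, smul_smul, map_mul, hr, mul_comm])
  { toFun := g
    map_add' := g.map_add
    map_smul' := fun s x => by
      refine BC.induction σ (motive := fun x => g (s • x) = θ s • g x) ?_ ?_ ?_ x
      · rw [smul_zero, map_zero, smul_zero]
      · intro s' m
        change g (s • s' • tmul σ M 1 m) = θ s • g (s' • tmul σ M 1 m)
        rw [smul_tmul, smul_tmul]
        change θ (s * (s' * 1)) • f m = θ s • θ (s' * 1) • f m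
        rw [map_mul, mul_smul]
      · intro x y hx hy
        rw [smul_add, map_add, map_add, hx, hy, smul_add] }

@[simp]
theorem slift_incl (θ : S →+* T) {τ : R →+* T} (h : θ.comp σ = τ) {P : Type*} [AddCommGroup P]
    [Module T P] (f : M →ₛₗ[τ] P) (m : M) : slift θ h f (incl σ M m) = f m := by
  change θ 1 • f m = f m
  rw [map_one, one_smul]

/-- The linearization `M ⊗_{R,σ} S → P` of a `σ`-semilinear map `M → P`. -/
def lift {P : Type*} [AddCommGroup P] [Module S P] (f : M →ₛₗ[σ] P) : BC σ M →ₗ[S] P :=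
  slift (RingHom.id S) (RingHom.id_comp σ) f

@[simp]
theorem lift_incl {P : Type*} [AddCommGroup P] [Module S P] (f : M →ₛₗ[σ] P) (m : M) :
    lift f (incl σ M m) = f m := slift_incl _ _ _ _

/-- The canonical map `M ⊗_{R,σ} S → M ⊗_{R,τ} T` for `θ : S → T` with `θ ∘ σ = τ`. -/
def change (θ : S →+* T) {τ : R →+* T} (h : θ.comp σ = τ) : BC σ M →ₛₗ[θ] BC τ M :=
  slift θ h (incl τ M)

@[simp]
theorem change_incl (θ : S →+* T) {τ : R →+* T} (h : θ.comp σ = τ) (m : M) :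
    change θ h (incl σ M m) = incl τ M m := slift_incl _ _ _ _

variable {M' : Type*} [AddCommGroup M'] [Module R M']

variable (σ) in
/-- Base change of a linear map. -/
def map (f : M →ₗ[R] M') : BC σ M →ₗ[S] BC σ M' :=
  lift { toFun := fun m => incl σ M' (f m)
         map_add' := fun x y => by rw [map_add, map_add]
         map_smul' := fun r m => by rw [map_smul, LinearMap.map_smulₛₗ] }

@[simp]
theorem map_incl (f : M →ₗ[R] M') (m : M) : map σ f (incl σ M m) = incl σ M' (f m) :=
  lift_incl _ _

theorem map_id : map σ (LinearMap.id : M →ₗ[R] M) = LinearMap.id :=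
  BC.ext fun m => by rw [map_incl]; rfl

theorem map_comp {M'' : Type*} [AddCommGroup M''] [Module R M''] (g : M' →ₗ[R] M'')
    (f : M →ₗ[R] M') : map σ (g ∘ₗ f) = map σ g ∘ₗ map σ f :=
  BC.ext fun m => by rw [LinearMap.comp_apply, map_incl, map_incl, map_incl]; rfl

theorem change_map (θ : S →+* T) {τ : R →+* T} (h : θ.comp σ = τ) (f : M →ₗ[R] M') (x : BC σ M) :
    change θ h (map σ f x) = map τ f (change θ h x) := by
  refine BC.induction σ (motive := fun x => change θ h (map σ f x) = map τ f (change θ h x))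
    ?_ ?_ ?_ x
  · simp only [map_zero]
  · intro s m
    simp only [map_smul, LinearMap.map_smulₛₗ, map_incl, change_incl]
  · intro x y hx hy
    simp only [map_add, hx, hy]

/-- The composite of semilinear maps. -/
def scomp {θ : S →+* T} {τ : R →+* T} (h : θ.comp σ = τ) {P Q : Type*} [AddCommGroup P]
    [Module S P] [AddCommGroup Q] [Module T Q] (g : P →ₛₗ[θ] Q) (f : M →ₛₗ[σ] P) :
    M →ₛₗ[τ] Q where
  toFun m := g (f m)
  map_add' x y := by rw [map_add, map_add]
  map_smul' r x := by
    rw [LinearMap.map_smulₛₗ, LinearMap.map_smulₛₗ, ← h]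
    rfl

theorem scomp_apply {θ : S →+* T} {τ : R →+* T} (h : θ.comp σ = τ) {P Q : Type*} [AddCommGroup P]
    [Module S P] [AddCommGroup Q] [Module T Q] (g : P →ₛₗ[θ] Q) (f : M →ₛₗ[σ] P) (m : M) :
    scomp h g f m = g (f m) := rfl

/-- The iterate `fⁿ` of a semilinear endomorphism. -/
def siter {ψ : R →+* R} (f : M →ₛₗ[ψ] M) (n : ℕ) : M →ₛₗ[(ψ ^ n : R →+* R)] M where
  toFun := f^[n]
  map_add' x y := by
    induction n with
    | zero => rfl
    | succ n ih => simp only [Function.iterate_succ_apply', ih, map_add]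
  map_smul' c x := by
    induction n with
    | zero => rfl
    | succ n ih =>
      simp only [Function.iterate_succ_apply', ih, LinearMap.map_smulₛₗ, pow_succ']
      rfl

variable (σ) in
/-- The basis `1 ⊗ bᵢ` of the base change. -/
def basis {ι : Type*} (b : Module.Basis ι R M) : Module.Basis ι S (BC σ M) :=
  Module.Basis.ofRepr
    { toFun := slift (RingHom.id S) (RingHom.id_comp σ)
        { toFun := fun m => (b.repr m).mapRange σ (map_zero σ)
          map_add' := fun x y => by ext i; simp
          map_smul' := fun r x => by ext i; simp }
      map_add' := fun x y => map_add _ _ _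
      map_smul' := fun s x => LinearMap.map_smulₛₗ _ _ _
      invFun := Finsupp.linearCombination S fun i => incl σ M (b i)
      left_inv := fun x => by
        refine BC.induction σ (motive := fun x => Finsupp.linearCombination S
          (fun i => incl σ M (b i)) (slift (RingHom.id S) (RingHom.id_comp σ) _ x) = x) ?_ ?_ ?_ x
        · rw [map_zero, map_zero]
        · intro s m
          rw [LinearMap.map_smulₛₗ, slift_incl, map_smul]
          congr 1
          change Finsupp.linearCombination S (fun i => incl σ M (b i))
            ((b.repr m).mapRange σ (map_zero σ)) = _
          conv_rhs => rw [← b.linearCombination_repr m]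
          rw [Finsupp.linearCombination_apply, Finsupp.sum_mapRange_index (fun i => zero_smul S (incl σ M (b i))),
            Finsupp.linearCombination_apply, Finsupp.sum, Finsupp.sum, map_sum]
          exact Finset.sum_congr rfl fun i _ => (LinearMap.map_smulₛₗ _ _ _).symm
        · intro x y hx hy
          rw [map_add, map_add, hx, hy]
      right_inv := fun c => by
        induction c using Finsupp.induction_linear with
        | zero => rw [map_zero, map_zero]
        | add f g hf hg => rw [map_add, map_add, hf, hg]
        | single i s =>
          rw [Finsupp.linearCombination_single, LinearMap.map_smulₛₗ, slift_incl]
          ext j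
          simp }

@[simp]
theorem basis_apply {ι : Type*} (b : Module.Basis ι R M) (i : ι) :
    basis σ b i = incl σ M (b i) := by
  change Finsupp.linearCombination S (fun i => incl σ M (b i)) (Finsupp.single i 1) = _
  rw [Finsupp.linearCombination_single, one_smul]

instance [Module.Free R M] : Module.Free S (BC σ M) :=
  Module.Free.of_basis (basis σ (Module.Free.chooseBasis R M))

instance [Module.Finite R M] [Module.Free R M] : Module.Finite S (BC σ M) :=
  Module.Finite.of_basis (basis σ (Module.Free.chooseBasis R M))

end BC

section Matrices

variable {ι : Type*} [Fintype ι] [DecidableEq ι] {V W : Type*} [AddCommGroup V] [AddCommGroup W]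
  [Module S V] [Module S W]

theorem constr_comp_constr (v : Module.Basis ι S V) (w : Module.Basis ι S W) (A B : Matrix ι ι S)
    (hBA : B * A = 1) :
    (w.constr S fun j => ∑ i, B i j • v i) ∘ₗ (v.constr S fun j => ∑ i, A i j • w i) =
      LinearMap.id := by
  refine v.ext fun j => ?_
  simp only [LinearMap.comp_apply, Module.Basis.constr_basis, map_sum, map_smul,
    LinearMap.id_apply, Finset.smul_sum, smul_smul]
  rw [Finset.sum_comm]
  have : ∀ i, ∑ x, (A x j * B i x) • v i = (B * A) i j • v i := fun i => by
    rw [← Finset.sum_smul, Matrix.mul_apply]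
    simp only [mul_comm]
  simp only [this, hBA, Matrix.one_apply, ite_smul, one_smul, zero_smul]
  simp

theorem bijective_of_matrix (v : Module.Basis ι S V) (w : Module.Basis ι S W) (g : V →ₗ[S] W)
    (A B : Matrix ι ι S) (hAB : A * B = 1) (h : ∀ j, g (v j) = ∑ i, A i j • w i) :
    Function.Bijective g := by
  have hBA : B * A = 1 := mul_eq_one_comm.1 hAB
  have hg : g = v.constr S fun j => ∑ i, A i j • w i := v.ext fun j => by
    rw [h, Module.Basis.constr_basis]
  rw [hg]
  exact Function.bijective_iff_has_inverse.2 ⟨_,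
    fun x => LinearMap.congr_fun (constr_comp_constr v w A B hBA) x,
    fun x => LinearMap.congr_fun (constr_comp_constr w v B A hAB) x⟩

theorem coeff_unique (w : Module.Basis ι S W) {c c' : ι → S}
    (h : ∑ i, c i • w i = ∑ i, c' i • w i) : c = c' := by
  have h1 := congrArg w.equivFun h
  rwa [w.equivFun_apply, w.equivFun_apply, w.repr_sum_self, w.repr_sum_self] at h1

theorem matrix_of_bijective (v : Module.Basis ι S V) (w : Module.Basis ι S W) (g : V →ₗ[S] W)
    (hg : Function.Bijective g) :
    ∃ A B : Matrix ι ι S, A * B = 1 ∧ ∀ j, g (v j) = ∑ i, A i j • w i := by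
  let e := LinearEquiv.ofBijective g hg
  refine ⟨LinearMap.toMatrix v w g, LinearMap.toMatrix w v e.symm.toLinearMap, ?_, fun j => ?_⟩
  · rw [← LinearMap.toMatrix_comp]
    have : g ∘ₗ e.symm.toLinearMap = LinearMap.id := LinearMap.ext fun x => e.apply_symm_apply x
    rw [this, LinearMap.toMatrix_id]
  · simp only [LinearMap.toMatrix_apply]
    exact (w.sum_repr _).symm

theorem frob_iff_matrix {κ : Type*} [Fintype κ] {D : Type*} [AddCommGroup D] [Module R D]
    {σ : R →+* S} {ψ₀ : R →+* R} {ψ : S →+* S} (d : Module.Basis κ R D) (w : Module.Basis ι S W)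
    (f : D →ₛₗ[ψ₀] D) (F : W →ₛₗ[ψ] W) (g : D →ₛₗ[σ] W) {A₀ : Matrix κ κ R} {A : Matrix ι ι S}
    {G : Matrix ι κ S} (hf : ∀ j, f (d j) = ∑ i, A₀ i j • d i)
    (hF : ∀ j, F (w j) = ∑ i, A i j • w i) (hg : ∀ j, g (d j) = ∑ i, G i j • w i) :
    (∀ j, g (f (d j)) = F (g (d j))) ↔ G * A₀.map σ = A * G.map ψ := by
  have h1 : ∀ j, g (f (d j)) = ∑ i, (G * A₀.map σ) i j • w i := fun j => by
    rw [hf, map_sum]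
    simp only [LinearMap.map_smulₛₗ, hg, Finset.smul_sum, smul_smul, Matrix.mul_apply,
      Finset.sum_smul, Matrix.map_apply]
    rw [Finset.sum_comm]
    simp only [mul_comm]
  have h2 : ∀ j, F (g (d j)) = ∑ i, (A * G.map ψ) i j • w i := fun j => by
    rw [hg, map_sum]
    simp only [LinearMap.map_smulₛₗ, hF, Finset.smul_sum, smul_smul, Matrix.mul_apply,
      Finset.sum_smul, Matrix.map_apply]
    rw [Finset.sum_comm]
    simp only [mul_comm]
  constructor
  · intro h
    refine Matrix.ext fun i j => ?_
    refine congrFun (coeff_unique w (c := fun i => (G * A₀.map σ) i j)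
      (c' := fun i => (A * G.map ψ) i j) ?_) i
    rw [← h1, ← h2, h]
  · intro h j
    rw [h1, h2, h]

end Matrices

end BaseChange

section Homs

set_option linter.unusedSectionVars false

section ComplMap

variable {A : Type*} [CommRing A] {a b : A} (f : A →+* A) (h : f a = b)

theorem quotPhi_le {a b : A} (f : A →+* A) (h : f a = b) (m : ℕ) : Ideal.span {a} ^ m ≤ Ideal.comap f (Ideal.span {b} ^ m) := by
  rw [Ideal.span_singleton_pow, Ideal.span_singleton_le_iff_mem, Ideal.mem_comap, map_pow,
    h, Ideal.span_singleton_pow]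
  exact Ideal.mem_span_singleton_self _

theorem factorPow_evalA (I : Ideal A) {m m' : ℕ} (hle : m ≤ m') (x : AdicCompletion I A) :
    Ideal.Quotient.factorPow I hle (AdicCompletion.evalₐ I m' x) = AdicCompletion.evalₐ I m x := by
  induction x using AdicCompletion.induction_on with
  | _ a =>
  rw [AdicCompletion.evalₐ_mk, AdicCompletion.evalₐ_mk]
  have h := a.2 hle
  rw [SModEq.sub_mem, smul_eq_mul, Ideal.mul_top] at h
  exact (Ideal.Quotient.mk_eq_mk_iff_sub_mem _ _).2 (by rw [← neg_sub]; exact neg_mem h)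

/-- The components of `complMap`. -/
def complComp (m : ℕ) : AdicCompletion (Ideal.span {a}) A →+* A ⧸ Ideal.span {b} ^ m :=
  (Ideal.quotientMap (Ideal.span {b} ^ m) f (quotPhi_le f h m)).comp
    (AdicCompletion.evalₐ (Ideal.span {a}) m).toRingHom

theorem complMap_aux {m m' : ℕ} (hle : m ≤ m') :
    (Ideal.Quotient.factorPow (Ideal.span {b}) hle).comp (complComp f h m') = complComp f h m := by
  ext x
  have h' := h
  have h := factorPow_evalA (Ideal.span {a}) hle x
  obtain ⟨s, hs⟩ := Ideal.Quotient.mk_surjective (AdicCompletion.evalₐ (Ideal.span {a}) m' x)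
  change Ideal.Quotient.factorPow (Ideal.span {b}) hle (Ideal.quotientMap _ f
    (quotPhi_le f h' m') (AdicCompletion.evalₐ (Ideal.span {a}) m' x)) = Ideal.quotientMap _ f
    (quotPhi_le f h' m) (AdicCompletion.evalₐ (Ideal.span {a}) m x)
  rw [← h, ← hs]
  rfl

/-- The map from the `a`-adic to the `b`-adic completion induced by an endomorphism that maps `a`
to `b`. -/
def complMap : AdicCompletion (Ideal.span {a}) A →+* AdicCompletion (Ideal.span {b}) A :=
  AdicCompletion.liftRingHom (Ideal.span {b}) (complComp f h) (complMap_aux f h)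

theorem complMap_algebraMap (s : A) :
    complMap f h (algebraMap A _ s) = algebraMap A (AdicCompletion (Ideal.span {b}) A) (f s) := by
  refine AdicCompletion.ext_evalₐ fun m => ?_
  exact AdicCompletion.evalₐ_liftRingHom (Ideal.span {b}) _ (complMap_aux f h) m _

/-- The map `A[1/a] → B[1/b]` induced by `f : A → B` with `f a = b`. -/
def locMap {A B : Type*} [CommRing A] [CommRing B] {a : A} {b : B} (A' B' : Type*) [CommRing A']
    [CommRing B'] [Algebra A A'] [Algebra B B'] [IsLocalization.Away a A']
    [IsLocalization.Away b B'] (f : A →+* B) (h : f a = b) : A' →+* B' :=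
  IsLocalization.Away.lift (g := (algebraMap B B').comp f) a (by
    rw [RingHom.comp_apply, h]
    exact IsLocalization.Away.algebraMap_isUnit b)

theorem locMap_algebraMap {A B : Type*} [CommRing A] [CommRing B] {a : A} {b : B} (A' B' : Type*)
    [CommRing A'] [CommRing B'] [Algebra A A'] [Algebra B B'] [IsLocalization.Away a A']
    [IsLocalization.Away b B'] (f : A →+* B) (h : f a = b) (x : A) :
    locMap A' B' f h (algebraMap A _ x) = algebraMap B _ (f x) :=
  IsLocalization.Away.lift_eq _ _ _

end ComplMap

variable {p : ℕ} [hp : Fact p.Prime] {k : Type u} [Field k] [CharP k p] [PerfectRing k p]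

namespace EisensteinPoly

variable (E : EisensteinPoly p k)

/-- The inclusion `𝔖[1/p] ⊆ 𝔖[1/p, 1/E]`. -/
def spToSPE : SP p k →+* E.SPE := (Subalgebra.inclusion E.SP_le_SPE).toRingHom

/-- The inclusion `𝔖[1/p, 1/E] ⊆ 𝒪[1/λ]`. -/
def speToOL : E.SPE →+* E.OL := (Subalgebra.inclusion E.SPE_le_OL).toRingHom

/-- The inclusion `𝔖[1/p] ⊆ 𝒪[1/λ]`. -/
def spToOL : SP p k →+* E.OL := (Subalgebra.inclusion E.SP_le_OL).toRingHom

/-- The inclusion `K₀ ⊆ 𝒪[1/λ]`. -/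
def kToOL : K0 p k →+* E.OL := algebraMap _ _

/-- The inclusion `𝔖 ⊆ 𝒪[1/λ]`. -/
def sToOL : FrakS p k →+* E.OL :=
  (sToA p k).codRestrict E.OL fun y => E.SP_le_OL ⟨0, y, by rw [pow_zero, one_mul]⟩

/-- The Frobenius of `𝒪[1/λ]`. -/
def phiOL : E.OL →+* E.OL where
  toFun x := ⟨phi p k x, E.phi_mem_OL x.2⟩
  map_one' := Subtype.ext (map_one _)
  map_mul' _ _ := Subtype.ext (map_mul _ _ _)
  map_zero' := Subtype.ext (map_zero _)
  map_add' _ _ := Subtype.ext (map_add _ _ _)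

/-- Reduction modulo `u`: `𝔖[1/p, 1/E] → K₀`. -/
def redSPE : E.SPE →+* K0 p k := PowerSeries.constantCoeff.comp E.SPE.val.toRingHom

/-- Reduction modulo `u`: `𝒪[1/λ] → K₀`. -/
def redOL : E.OL →+* K0 p k := PowerSeries.constantCoeff.comp E.OL.val.toRingHom

theorem phiOL_spToOL : E.phiOL.comp E.spToOL = E.speToOL.comp (E.spToSPE.comp (phiSP p k)) :=
  RingHom.ext fun _ => Subtype.ext rfl

theorem speToOL_spToSPE : E.speToOL.comp E.spToSPE = E.spToOL :=
  RingHom.ext fun _ => Subtype.ext rfl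

theorem redSPE_spToSPE : E.redSPE.comp E.spToSPE = redSP p k := RingHom.ext fun _ => rfl

theorem redOL_spToOL : E.redOL.comp E.spToOL = redSP p k := RingHom.ext fun _ => rfl

theorem redOL_speToOL (x : E.SPE) : E.redOL (E.speToOL x) = E.redSPE x := rfl

theorem spToLhat_eq (n : ℕ) (s : SP p k) :
    E.spToLhat n s = algebraMap (E.Shat n) (E.Lhat n) (E.spToShat n s) := rfl

theorem phiOL_kToOL : E.phiOL.comp E.kToOL = E.kToOL.comp (phi0 p k) := by
  ext c : 1
  exact Subtype.ext (phi_C c)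

theorem redOL_kToOL : E.redOL.comp E.kToOL = RingHom.id _ := by
  ext c : 1
  exact PowerSeries.constantCoeff_C c

theorem phi0_redSP : (phi0 p k).comp (redSP p k) = E.redSPE.comp (E.spToSPE.comp (phiSP p k)) := by
  ext x : 1
  exact (constantCoeff_phi (x : RingA p k)).symm

theorem olToLhat_spToOL (n : ℕ) : (E.olToLhat n).comp E.spToOL = E.spToLhat n := by
  ext s : 1
  have h := E.olToLhat_O n ⟨s, SP_le_O s.2⟩
  rw [oToShat_SP] at h
  exact h

theorem olToLhat_kToOL (n : ℕ) : (E.olToLhat n).comp E.kToOL = E.kToLhat n := by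
  rw [kToLhat, ← olToLhat_spToOL]
  rfl

theorem phiSP_iterate_coe (n : ℕ) (x : SP p k) :
    (((phiSP p k ^ n : SP p k →+* SP p k) x : SP p k) : RingA p k) = (phi p k)^[n] x := by
  induction n with
  | zero => rfl
  | succ n ih =>
    rw [pow_succ', Function.iterate_succ_apply', ← ih]
    rfl

theorem phiSP_iterate_serSP (n : ℕ) : (phiSP p k ^ n : SP p k →+* SP p k) (E.serSP 0) = E.serSP n :=
  Subtype.ext (phiSP_iterate_coe n _)

theorem phiSP_iterate_kToSP (n : ℕ) :
    (phiSP p k ^ n : SP p k →+* SP p k).comp (kToSP p k) = (kToSP p k).comp (phi0 p k ^ n) := by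
  ext c : 1
  refine Subtype.ext ?_
  induction n with
  | zero => rfl
  | succ n ih =>
    rw [pow_succ', pow_succ']
    change phi p k (((phiSP p k ^ n : SP p k →+* SP p k).comp (kToSP p k) c : SP p k) : RingA p k) = _
    rw [ih]
    exact phi_C _

/-- The map `φⁿ : Ŝ → Ŝₙ` (induced by `φⁿ` on `𝔖[1/p]`). -/
def phiShat (n : ℕ) : E.Shat 0 →+* E.Shat n := complMap (phiSP p k ^ n) (E.phiSP_iterate_serSP n)

theorem phiShat_spToShat (n : ℕ) (s : SP p k) :
    E.phiShat n (E.spToShat 0 s) = E.spToShat n ((phiSP p k ^ n : SP p k →+* SP p k) s) := by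
  exact complMap_algebraMap (phiSP p k ^ n : SP p k →+* SP p k) (E.phiSP_iterate_serSP n) s

theorem phiShat_serSP (n : ℕ) :
    E.phiShat n (E.spToShat 0 (E.serSP 0)) = E.spToShat n (E.serSP n) := by
  rw [phiShat_spToShat, phiSP_iterate_serSP]

/-- The map `φⁿ : Ŝ[1/E] → Ŝₙ[1/φⁿ(E)]`. -/
def phiLhat (n : ℕ) : E.Lhat 0 →+* E.Lhat n := locMap (E.Lhat 0) (E.Lhat n) (E.phiShat n) (E.phiShat_serSP n)

theorem phiLhat_spToLhat (n : ℕ) (s : SP p k) :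
    E.phiLhat n (E.spToLhat 0 s) = E.spToLhat n ((phiSP p k ^ n : SP p k →+* SP p k) s) := by
  have h := locMap_algebraMap (E.Lhat 0) (E.Lhat n) (E.phiShat n) (E.phiShat_serSP n) (E.spToShat 0 s)
  rw [phiShat_spToShat] at h
  exact h

theorem phiLhat_kToLhat (n : ℕ) : (E.phiLhat n).comp ((E.kToLhat 0).comp (phi0 p k)) =
    (E.kToLhat n).comp (phi0 p k ^ (n + 1)) := by
  ext c : 1
  have h3 := RingHom.congr_fun (phiSP_iterate_kToSP (p := p) (k := k) n) (phi0 p k c)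
  have h := E.phiLhat_spToLhat n (kToSP p k (phi0 p k c))
  rw [RingHom.comp_apply] at h3
  rw [h3] at h
  exact h

/-! ### Restriction of scalars on base changes -/

section Restrict

variable {R : Type*} [CommRing R] {M : Type*} [AddCommGroup M] [Module R M]

instance moduleShat (n : ℕ) (σ : R →+* E.Lhat n) : Module (E.Shat n) (BC σ M) :=
  Module.compHom _ (algebraMap (E.Shat n) (E.Lhat n))

instance (n : ℕ) (σ : R →+* E.Lhat n) : IsScalarTower (E.Shat n) (E.Lhat n) (BC σ M) where
  smul_assoc a b x := by
    change (a • b) • x = algebraMap (E.Shat n) (E.Lhat n) a • b • x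
    rw [Algebra.smul_def, mul_smul]

theorem spToLhat_smul (n : ℕ) (σ : R →+* E.Lhat n) (s : SP p k) (x : BC σ M) :
    E.spToLhat n s • x = E.spToShat n s • x := rfl

instance moduleFrakS (σ : R →+* E.OL) : Module (FrakS p k) (BC σ M) :=
  Module.compHom _ E.sToOL

end Restrict

end EisensteinPoly
end Homs

section Objects

set_option linter.unusedSectionVars false

variable {p : ℕ} [hp : Fact p.Prime] {k : Type u} [Field k] [CharP k p] [PerfectRing k p]

/-- A free `𝔖[1/p]`-module `𝔑` of finite rank with an isomorphism
`φ_𝔑 : ᵠ𝔑[1/E] → 𝔑[1/E]`, given by the `φ`-semilinear map `𝔑 → 𝔑[1/E]`, `n ↦ φ_𝔑(n ⊗ 1)`. -/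
structure PhiModSP (E : EisensteinPoly p k) where
  /-- the underlying module -/
  carrier : Type u
  [addCommGroup : AddCommGroup carrier]
  [module : Module (SP p k) carrier]
  [free : Module.Free (SP p k) carrier]
  [finite : Module.Finite (SP p k) carrier]
  /-- the semilinear map `n ↦ φ_𝔑(n ⊗ 1)` -/
  frob : carrier →ₛₗ[E.spToSPE.comp (phiSP p k)] BC E.spToSPE carrier
  /-- its linearization `φ_𝔑` is an isomorphism -/
  frob_bijective : Function.Bijective (BC.lift frob)

namespace PhiModSP

variable {E : EisensteinPoly p k}

instance : CoeSort (PhiModSP E) (Type u) := ⟨carrier⟩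

attribute [instance] addCommGroup module free finite

variable (N : PhiModSP E)

/-- The `φ`-semilinear endomorphism `φ_𝔑 ⊗ φ` of `𝔑 ⊗ 𝒪[1/λ]`. -/
def frobOL : BC E.spToOL N →ₛₗ[E.phiOL] BC E.spToOL N :=
  BC.slift E.phiOL E.phiOL_spToOL
    (BC.scomp rfl (BC.change E.speToOL E.speToOL_spToSPE) N.frob)

theorem frobOL_incl (n : N) : N.frobOL (BC.incl _ _ n) =
    BC.change E.speToOL E.speToOL_spToSPE (N.frob n) := BC.slift_incl _ _ _ _

/-- The condition that `𝔑` has amplitude contained in `[s, t]`: for the `𝔖`-lattice `𝔐` spanned by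
a basis `b` of `𝔑`, with `Φₙ = φ_𝔑 ∘ ᵠφ_𝔑 ∘ ⋯ : ᵠⁿ𝔑 → 𝔑` (over `𝒪[1/λ]`, where all `φⁱ(E)` are
invertible), `pᶜ Φₙ` maps `ᵠⁿ𝔐` into `(E ⋯ φⁿ⁻¹(E))ˢ 𝔐`, and `pᶜ Φₙ⁻¹` maps `𝔐` into
`(E ⋯ φⁿ⁻¹(E))⁻ᵗ ᵠⁿ𝔐`, for a constant `C` that does not depend on `n`. -/
def HasAmplitude (s t : ℤ) : Prop :=
  ∃ (r : ℕ) (b : Module.Basis (Fin r) (SP p k) N) (C : ℕ), ∀ n : ℕ, 1 ≤ n →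
    (∀ j, ∃ y ∈ Submodule.span (FrakS p k) (Set.range fun i => BC.incl E.spToOL N (b i)),
      (p : E.OL) ^ C • N.frobOL^[n] (BC.incl _ _ (b j)) =
        (((∏ i ∈ Finset.range n, E.unitE i) ^ s : (E.OL)ˣ) : E.OL) • y) ∧
    (∀ j, ∃ y ∈ Submodule.span (FrakS p k)
        (Set.range fun i => N.frobOL^[n] (BC.incl E.spToOL N (b i))),
      (p : E.OL) ^ C • BC.incl _ _ (b j) =
        (((∏ i ∈ Finset.range n, E.unitE i) ^ (-t) : (E.OL)ˣ) : E.OL) • y)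

end PhiModSP

/-- A pseudo-iso-`φ/𝔖`-module (of some amplitude). -/
structure PIMod (E : EisensteinPoly p k) extends PhiModSP E where
  /-- the amplitude condition -/
  pim : ∃ s t : ℤ, s ≤ t ∧ toPhiModSP.HasAmplitude s t

namespace PIMod

variable {E : EisensteinPoly p k}

instance : CoeSort (PIMod E) (Type u) := ⟨fun N => N.carrier⟩

/-- A morphism of pseudo-iso-`φ/𝔖`-modules: an `𝔖[1/p]`-linear map that commutes with `φ`. -/
@[ext]
structure Hom (N N' : PIMod E) where
  /-- the underlying linear map -/
  toLin : N →ₗ[SP p k] N'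
  comm : ∀ n, BC.map E.spToSPE toLin (N.frob n) = N'.frob (toLin n)

instance : Category (PIMod E) where
  Hom := Hom
  id N := ⟨LinearMap.id, fun n => by rw [BC.map_id]; rfl⟩
  comp f g := ⟨g.toLin ∘ₗ f.toLin, fun n => by
    rw [BC.map_comp, LinearMap.comp_apply, LinearMap.comp_apply, f.comm, g.comm]⟩

end PIMod

/-- A `φ`-module of Hodge–Pink: a finite dimensional `K₀`-vector space `D` with an isomorphism
`φ_D : ᵠD → D`, given by the `φ`-semilinear map `d ↦ φ_D(d ⊗ 1)`, and an `Ŝ`-lattice `V` in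
`ᵠD ⊗ Ŝ[1/E]`, i.e. the `Ŝ`-span of an `Ŝ[1/E]`-basis. -/
structure MHP (E : EisensteinPoly p k) where
  /-- the underlying vector space -/
  carrier : Type u
  [addCommGroup : AddCommGroup carrier]
  [module : Module (K0 p k) carrier]
  [finite : Module.Finite (K0 p k) carrier]
  /-- the semilinear map `d ↦ φ_D(d ⊗ 1)` -/
  frob : carrier →ₛₗ[phi0 p k] carrier
  /-- its linearization `φ_D` is an isomorphism -/
  frob_bijective : Function.Bijective (BC.lift frob)
  /-- the Hodge–Pink structure -/
  V : Submodule (E.Shat 0) (BC ((E.kToLhat 0).comp (phi0 p k)) carrier)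
  isLattice : ∃ (r : ℕ) (b : Module.Basis (Fin r) (E.Lhat 0)
    (BC ((E.kToLhat 0).comp (phi0 p k)) carrier)), V = Submodule.span (E.Shat 0) (Set.range b)

namespace MHP

variable {E : EisensteinPoly p k}

instance : CoeSort (MHP E) (Type u) := ⟨carrier⟩

attribute [instance] addCommGroup module finite

/-- A morphism of `φ`-modules of Hodge–Pink: a `K₀`-linear map `f` that commutes with `φ` and such
that `ᵠf ⊗ 1` maps `V` into `V`. -/
@[ext]
structure Hom (D D' : MHP E) where
  /-- the underlying linear map -/
  toLin : D →ₗ[K0 p k] D'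
  comm : ∀ d, toLin (D.frob d) = D'.frob (toLin d)
  map_V : ∀ x ∈ D.V, BC.map ((E.kToLhat 0).comp (phi0 p k)) toLin x ∈ D'.V

instance : Category (MHP E) where
  Hom := Hom
  id D := ⟨LinearMap.id, fun _ => rfl, fun x hx => by rw [BC.map_id]; exact hx⟩
  comp f g := ⟨g.toLin ∘ₗ f.toLin, fun d => by
    rw [LinearMap.comp_apply, LinearMap.comp_apply, f.comm, g.comm], fun x hx => by
    rw [BC.map_comp, LinearMap.comp_apply]
    exact g.map_V _ (f.map_V _ hx)⟩

/-! ### The subset `Ñ` of `D ⊗ 𝒪[1/λ]` -/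

variable (D : MHP E)

/-- The `φⁿ⁺¹`-semilinear map `d ↦ φ_D(ᵠφ_D(⋯(d ⊗ 1)))` from `D` to `D ⊗ Ŝₙ[1/φⁿ(E)]`. -/
def frobIter (n : ℕ) :
    D →ₛₗ[(E.kToLhat n).comp (phi0 p k ^ (n + 1))] BC (E.kToLhat n) D :=
  BC.scomp rfl (BC.incl (E.kToLhat n) D) (BC.siter D.frob (n + 1))

/-- The `φⁿ`-semilinear map `φ_D ∘ ᵠφ_D ∘ ⋯ ∘ ᵠⁿφ_D ∘ φⁿ` from `ᵠD ⊗ Ŝ[1/E]` to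
`D ⊗ Ŝₙ[1/φⁿ(E)]`. -/
def theta (n : ℕ) :
    BC ((E.kToLhat 0).comp (phi0 p k)) D →ₛₗ[E.phiLhat n] BC (E.kToLhat n) D :=
  BC.slift (E.phiLhat n) (E.phiLhat_kToLhat n) (D.frobIter n)

/-- The first condition on `x ∈ D ⊗ 𝒪[1/λ]`: for all `n`, its image in `D ⊗ Ŝₙ[1/φⁿ(E)]` belongs
to the `Ŝₙ`-lattice `φ_D ⋯ ᵠⁿφ_D(ᵠⁿV)`, where `ᵠⁿV` is the `Ŝₙ`-lattice spanned by the image of `V`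
under `φⁿ`. -/
def IsIntegralAt (x : BC E.kToOL D) : Prop :=
  ∀ n : ℕ, BC.change (E.olToLhat n) (E.olToLhat_kToOL n) x ∈
    Submodule.span (E.Shat n) (D.theta n '' (D.V : Set (BC ((E.kToLhat 0).comp (phi0 p k)) D)))

/-- The second condition on `x ∈ D ⊗ 𝒪[1/λ]`: the norms `|(φ_D ⋯ ᵠⁿ⁻¹φ_D)⁻¹ x|_r` for
`r = |π_K| ^ (p⁻ⁿ)` are bounded. The norm is the maximum of the norms of the coordinates in a basis
`ᵠⁿb` of `ᵠⁿD` induced by a basis `b` of `D` (equivalently, by a `W`-lattice of `D`). -/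
def IsBoundedGrowth (x : BC E.kToOL D) : Prop :=
  ∃ (r : ℕ) (b : Module.Basis (Fin r) (K0 p k) D) (C : ℝ), ∀ n : ℕ, ∃ y : Fin r → E.OL,
    x = ∑ i, y i • BC.incl E.kToOL D (D.frob^[n] (b i)) ∧
    ∀ i, E.normOL (E.absPi ^ (((p : ℝ) ^ n)⁻¹)) (y i) ≤ C

/-- The set `Ñ ⊆ D ⊗ 𝒪[1/λ]` attached to a `φ`-module of Hodge–Pink `D`. -/
def tilde : Set (BC E.kToOL D) := {x | D.IsIntegralAt x ∧ D.IsBoundedGrowth x}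

end MHP

end Objects

section MatrixEq

set_option linter.unusedSectionVars false

variable {p : ℕ} [hp : Fact p.Prime] {k : Type u} [Field k] [CharP k p] [PerfectRing k p]

variable {m n : Type*} [Fintype m] [Fintype n] [DecidableEq m] [DecidableEq n]

/-- The operator `F ↦ A φ(F) B` on matrices. -/
def matOp (A : Matrix m m (RingA p k)) (B : Matrix n n (RingA p k)) (F : m × n → RingA p k)
    (s : m × n) : RingA p k := ∑ a, ∑ b, A s.1 a * phi p k (F (a, b)) * B b s.2

theorem matOp_isContraction (A : Matrix m m (RingA p k)) (B : Matrix n n (RingA p k)) :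
    IsContraction (matOp A B) := by
  intro N F G hN h s
  simp only [matOp]
  rw [← Finset.sum_sub_distrib]
  refine Finset.dvd_sum fun a _ => ?_
  rw [← Finset.sum_sub_distrib]
  refine Finset.dvd_sum fun b _ => ?_
  rw [← sub_mul, ← mul_sub, ← map_sub]
  refine Dvd.dvd.mul_right (Dvd.dvd.mul_left ((pow_dvd_pow _ ?_).trans (X_pow_dvd_phi (h _))) _) _
  calc N + 1 ≤ N + N := by omega
    _ = 2 * N := by ring
    _ ≤ p * N := Nat.mul_le_mul_right _ hp.out.two_le

variable (E : EisensteinPoly p k)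

theorem matOp_eq (A : Matrix m m E.OL) (B : Matrix n n E.OL) (X : Matrix m n E.OL) (i : m) (j : n) :
    (((A * X.map E.phiOL * B) i j : E.OL) : RingA p k) =
      matOp (fun i j => (A i j : RingA p k)) (fun i j => (B i j : RingA p k))
        (fun s => (X s.1 s.2 : RingA p k)) (i, j) := by
  have h : (A * X.map E.phiOL * B) i j = ∑ a, ∑ b, A i a * E.phiOL (X a b) * B b j := by
    rw [Matrix.mul_apply, Finset.sum_comm]
    refine Finset.sum_congr rfl fun b _ => ?_
    rw [Matrix.mul_apply, Finset.sum_mul]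
    rfl
  rw [h]
  simp only [matOp, AddSubmonoidClass.coe_finsetSum]
  rfl

theorem redOL_eq (x : E.OL) : E.redOL x = PowerSeries.constantCoeff (x : RingA p k) := rfl

theorem matrix_unique {A : Matrix m m E.OL} {B : Matrix n n E.OL} {G H : Matrix m n E.OL}
    (hG : G = A * G.map E.phiOL * B) (hH : H = A * H.map E.phiOL * B)
    (h : ∀ i j, E.redOL (G i j) = E.redOL (H i j)) : G = H := by
  have key := (matOp_isContraction (fun i j => (A i j : RingA p k))
    (fun i j => (B i j : RingA p k))).unique
    (F := fun s : m × n => (G s.1 s.2 : RingA p k)) (G := fun s => (H s.1 s.2 : RingA p k))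
    (by
      funext s
      rw [← Prod.mk.eta (p := s), ← matOp_eq E A B G s.1 s.2, ← hG])
    (by
      funext s
      rw [← Prod.mk.eta (p := s), ← matOp_eq E A B H s.1 s.2, ← hH])
    (fun s => by
      rw [PowerSeries.X_dvd_iff, map_sub, sub_eq_zero]
      exact h s.1 s.2)
  ext i j
  exact congrArg _ (congrFun key (i, j))

theorem exists_bound {ι : Type*} [Finite ι] (f : ι → RingA p k) (h : ∀ i, f i ∈ SP p k) :
    ∃ Q : ℝ, 0 ≤ Q ∧ ∀ i n, absK p k (PowerSeries.coeff n (f i)) ≤ Q := by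
  cases nonempty_fintype ι
  choose C hC using fun i => mem_SP_iff.1 (h i)
  refine ⟨∑ i, |C i|, Finset.sum_nonneg fun i _ => abs_nonneg _, fun i n => ?_⟩
  exact (hC i n).trans ((le_abs_self _).trans
    (Finset.single_le_sum (f := fun i => |C i|) (fun i _ => abs_nonneg _) (Finset.mem_univ i)))

theorem exists_pow {ι : Type*} [Finite ι] (f : ι → E.SPE) :
    ∃ N : ℕ, ∀ i, E.normalized ^ N * (f i : RingA p k) ∈ SP p k := by
  cases nonempty_fintype ι
  have h : ∀ i, ∃ N : ℕ, E.ser ^ N * (f i : RingA p k) ∈ SP p k := fun i => (f i).2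
  choose N hN using h
  refine ⟨∑ i, N i, fun i => ?_⟩
  obtain ⟨d, hd⟩ := Nat.exists_eq_add_of_le
    (Finset.single_le_sum (f := N) (fun i _ => Nat.zero_le _) (Finset.mem_univ i))
  rw [hd, pow_add, EisensteinPoly.normalized]
  have h1 := (SP p k).mul_mem ((SP p k).mul_mem
    ((SP p k).pow_mem (EisensteinPoly.C_mem (SP p k)
      (PowerSeries.constantCoeff E.ser)⁻¹) (N i)) ((SP p k).pow_mem E.normalized_mem d)) (hN i)
  convert h1 using 1
  rw [mul_pow, EisensteinPoly.normalized]
  ring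

theorem exists_fixed (A B : Matrix m m (RingA p k))
    (hAB : ∀ i j, PowerSeries.constantCoeff ((A * B) i j) = if i = j then 1 else 0) :
    ∃ F : m × m → RingA p k, matOp A B F = F ∧
      ∀ s, PowerSeries.constantCoeff (F s) = if s.1 = s.2 then 1 else 0 := by
  let F₀ : m × m → RingA p k := fun s => if s.1 = s.2 then 1 else 0
  have h0 : ∀ s, PowerSeries.constantCoeff (F₀ s) = if s.1 = s.2 then 1 else 0 := by
    intro s
    simp only [F₀]
    split_ifs <;> simp
  have hc := matOp_isContraction A B
  have hF : ∀ s, PowerSeries.X ∣ matOp A B F₀ s - F₀ s := by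
    intro s
    rw [PowerSeries.X_dvd_iff, map_sub, sub_eq_zero, h0, ← hAB]
    congr 1
    rw [matOp, Matrix.mul_apply]
    refine Finset.sum_congr rfl fun a _ => ?_
    rw [Finset.sum_eq_single a]
    · simp [F₀]
    · intro b _ hb
      simp [F₀, hb.symm]
    · simp
  refine ⟨_, hc.apply_iterLimit hF, fun s => ?_⟩
  have h1 := hc.iterLimit_dvd hF 0 s
  rw [zero_add, pow_one, PowerSeries.X_dvd_iff, map_sub, sub_eq_zero] at h1
  rw [h1, Function.iterate_zero, id, h0]

theorem fixed_mem {A' : Matrix m m (RingA p k)} {B : Matrix m m (K0 p k)} {F : m × m → RingA p k}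
    (hfix : matOp A' (fun i j => PowerSeries.C (B i j)) F = F)
    (h0 : ∀ s, PowerSeries.constantCoeff (F s) = if s.1 = s.2 then 1 else 0) {N : ℕ}
    (hN : ∀ s : m × m, E.normalized ^ N * A' s.1 s.2 ∈ SP p k) (s : m × m) :
    E.lam ^ N * F s ∈ RingO p k := by
  obtain ⟨Q, hQ0, hQ⟩ := exists_bound _ hN
  obtain ⟨R, hR0, hR⟩ := exists_bound (fun s : m × m => PowerSeries.C (B s.1 s.2))
    fun s => EisensteinPoly.C_mem (SP p k) (B s.1 s.2)
  have hY : ∀ s, E.lam ^ N * F s = ∑ a, ∑ b, PowerSeries.C (B b s.2) *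
      ((E.normalized ^ N * A' s.1 a) * phi p k (E.lam ^ N * F (a, b))) := by
    intro s
    have hs : F s = ∑ a, ∑ b, A' s.1 a * phi p k (F (a, b)) * PowerSeries.C (B b s.2) :=
      (congrFun hfix s).symm
    conv_lhs => rw [hs, EisensteinPoly.lam_eq, mul_pow, Finset.mul_sum]
    refine Finset.sum_congr rfl fun a _ => ?_
    rw [Finset.mul_sum]
    refine Finset.sum_congr rfl fun b _ => ?_
    rw [map_mul, map_pow]
    ring
  refine growth (fun s => E.lam ^ N * F s) (Q := R * Q) (B := 1) zero_le_one ?_ ?_ s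
  · intro s
    rw [PowerSeries.coeff_zero_eq_constantCoeff_apply, map_mul, map_pow, E.constantCoeff_lam,
      one_pow, one_mul, h0]
    split_ifs <;> simp
  · intro n _ K hK h s
    rw [hY, map_sum]
    refine absK_sum_le _ _ (by positivity) fun a _ => ?_
    rw [map_sum]
    refine absK_sum_le _ _ (by positivity) fun b _ => ?_
    rw [PowerSeries.coeff_C_mul, map_mul, mul_assoc R]
    have h1 := hR (b, s.2) 0
    rw [PowerSeries.coeff_zero_eq_constantCoeff_apply, PowerSeries.constantCoeff_C] at h1
    exact mul_le_mul h1 (absK_coeff_mul_phi_le hQ0 hK (hQ (s.1, a)) fun i hi => h i hi (a, b))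
      ((absK p k).nonneg _) hR0

theorem matrix_exists (A : Matrix m m E.SPE) (B : Matrix m m (K0 p k))
    (hAB : A.map E.redSPE * B = 1) : ∃ X : Matrix m m E.OL,
      X = A.map E.speToOL * X.map E.phiOL * B.map E.kToOL ∧ X.map E.redOL = 1 := by
  obtain ⟨F, hfix, h0⟩ := exists_fixed (fun i j => (A i j : RingA p k))
    (fun i j => PowerSeries.C (B i j)) (fun i j => by
      rw [← Matrix.one_apply, ← hAB]
      refine (map_sum _ _ _).trans (Finset.sum_congr rfl fun a _ => ?_)
      rw [map_mul, PowerSeries.constantCoeff_C]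
      rfl)
  obtain ⟨N, hN⟩ := exists_pow E (fun s : m × m => A s.1 s.2)
  have hmem : ∀ s, F s ∈ E.OL := fun s => ⟨N, fixed_mem E hfix h0 hN s⟩
  refine ⟨Matrix.of fun i j => ⟨F (i, j), hmem (i, j)⟩, ?_, ?_⟩
  · refine Matrix.ext fun i j => Subtype.ext ?_
    rw [matOp_eq]
    exact (congrFun hfix (i, j)).symm
  · ext i j
    rw [Matrix.one_apply]
    exact h0 (i, j)

theorem matrix_exists_inv (A B : Matrix m m E.SPE) (hAB : A * B = 1) :
    ∃ X X' : Matrix m m E.OL, X * X' = 1 ∧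
      X = A.map E.speToOL * X.map E.phiOL * (B.map E.redSPE).map E.kToOL ∧
      X.map E.redOL = 1 := by
  have hBA : B * A = 1 := mul_eq_one_comm.1 hAB
  have h1 : A.map E.redSPE * B.map E.redSPE = 1 := by
    rw [← Matrix.map_mul, hAB, Matrix.map_one _ (map_zero _) (map_one _)]
  have h2 : (B.transpose).map E.redSPE * (A.transpose).map E.redSPE = 1 := by
    rw [← Matrix.map_mul, ← Matrix.transpose_mul, hAB, Matrix.transpose_one,
      Matrix.map_one _ (map_zero _) (map_one _)]
  obtain ⟨X, hX, hX0⟩ := matrix_exists E A _ h1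
  obtain ⟨Z, hZ, hZ0⟩ := matrix_exists E B.transpose _ h2
  refine ⟨X, Z.transpose, ?_, hX, hX0⟩
  have hZ' : Z.transpose = (A.map E.redSPE).map E.kToOL * Z.transpose.map E.phiOL *
      B.map E.speToOL := by
    conv_lhs => rw [hZ]
    rw [Matrix.transpose_mul, Matrix.transpose_mul, Matrix.mul_assoc]
    simp only [Matrix.transpose_map, Matrix.transpose_transpose]
  refine matrix_unique E (A := A.map E.speToOL) (B := B.map E.speToOL) ?_ ?_ ?_
  · conv_lhs => rw [hX, hZ']
    have h3 : (B.map E.redSPE).map E.kToOL * (A.map E.redSPE).map E.kToOL = 1 := by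
      rw [← Matrix.map_mul, ← Matrix.map_mul, hBA, Matrix.map_one _ (map_zero _) (map_one _),
        Matrix.map_one _ (map_zero _) (map_one _)]
    rw [Matrix.map_mul]
    calc _ = A.map E.speToOL * X.map E.phiOL * (((B.map E.redSPE).map E.kToOL *
          (A.map E.redSPE).map E.kToOL) * (Z.transpose.map E.phiOL * B.map E.speToOL)) := by
          simp only [Matrix.mul_assoc]
      _ = _ := by rw [h3, Matrix.one_mul]; simp only [Matrix.mul_assoc]
  · rw [Matrix.map_one _ (map_zero _) (map_one _), Matrix.mul_one, ← Matrix.map_mul, hAB,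
      Matrix.map_one _ (map_zero _) (map_one _)]
  · intro i j
    have h5 : (X * Z.transpose).map E.redOL = (1 : Matrix m m E.OL).map E.redOL := by
      rw [Matrix.map_mul, hX0, Matrix.transpose_map, hZ0, Matrix.transpose_one,
        Matrix.one_mul, Matrix.map_one _ (map_zero _) (map_one _)]
    exact congrFun (congrFun h5 i) j

end MatrixEq

section Functor

set_option maxHeartbeats 1000000
set_option linter.unusedSectionVars false

variable {p : ℕ} [hp : Fact p.Prime] {k : Type u} [Field k] [CharP k p] [PerfectRing k p]

namespace PhiModSP

variable {E : EisensteinPoly p k} (N : PhiModSP E)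

/-- The `K₀`-vector space `D = 𝔑 ⊗ K₀ = 𝔑 / u 𝔑`. -/
abbrev D : Type u := BC ((redSP p k)) N

/-- The Frobenius `φ_D = φ_𝔑 mod u` of `D`. -/
def frobD : N.D →ₛₗ[phi0 p k] N.D :=
  BC.slift (phi0 p k) E.phi0_redSP
    (BC.scomp rfl (BC.change E.redSPE E.redSPE_spToSPE) N.frob)

theorem frobD_incl (n : N) :
    N.frobD (BC.incl _ _ n) = BC.change E.redSPE E.redSPE_spToSPE (N.frob n) :=
  BC.slift_incl _ _ _ _

section Frame

variable {ι : Type*} [Fintype ι] [DecidableEq ι] (b : Module.Basis ι (SP p k) N)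

theorem exists_matrix : ∃ A B : Matrix ι ι E.SPE, A * B = 1 ∧
    ∀ j, N.frob (b j) = ∑ i, A i j • BC.incl E.spToSPE N (b i) := by
  obtain ⟨A, B, hAB, h⟩ := matrix_of_bijective (BC.basis (E.spToSPE.comp (phiSP p k)) b)
    (BC.basis E.spToSPE b) (BC.lift N.frob) N.frob_bijective
  refine ⟨A, B, hAB, fun j => ?_⟩
  have h1 := h j
  simp only [BC.basis_apply, BC.lift_incl] at h1
  exact h1

variable {b} {A : Matrix ι ι E.SPE}

theorem frobD_basis
    (hA : ∀ j, N.frob (b j) = ∑ i, A i j • BC.incl E.spToSPE N (b i)) (j : ι) : N.frobD (BC.basis (redSP p k) b j) =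
    ∑ i, E.redSPE (A i j) • BC.basis (redSP p k) b i := by
  simp only [BC.basis_apply]
  rw [frobD_incl, hA, map_sum]
  exact Finset.sum_congr rfl fun i _ => by rw [LinearMap.map_smulₛₗ, BC.change_incl]

theorem frobOL_basis
    (hA : ∀ j, N.frob (b j) = ∑ i, A i j • BC.incl E.spToSPE N (b i)) (j : ι) : N.frobOL (BC.basis E.spToOL b j) =
    ∑ i, E.speToOL (A i j) • BC.basis E.spToOL b i := by
  simp only [BC.basis_apply]
  rw [frobOL_incl, hA, map_sum]
  exact Finset.sum_congr rfl fun i _ => by rw [LinearMap.map_smulₛₗ, BC.change_incl]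

end Frame

theorem map_mul_map_eq_one {ι : Type*} [Fintype ι] [DecidableEq ι] {R S : Type*} [CommRing R]
    [CommRing S] (f : R →+* S) {A B : Matrix ι ι R} (h : A * B = 1) : A.map f * B.map f = 1 := by
  rw [← Matrix.map_mul, h, Matrix.map_one _ (map_zero _) (map_one _)]

theorem eq_of_mul_mul {ι κ : Type*} [Fintype ι] [DecidableEq ι] {R : Type*} [CommRing R]
    {G : Matrix κ ι R} {A B : Matrix ι ι R} (h : A * B = 1) : G * A * B = G := by
  rw [Matrix.mul_assoc, h, Matrix.mul_one]

/-- The linearization of a semilinear map over a further base change. -/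
theorem bijective_lift_incl {ι : Type*} [Fintype ι] [DecidableEq ι] {R R' S : Type*} [CommRing R]
    [CommRing R'] [CommRing S] {M M' : Type*} [AddCommGroup M] [Module R M] [AddCommGroup M']
    [Module R' M'] {ψ : R →+* R'} (σ : R' →+* S) {τ : R →+* S} (hτ : σ.comp ψ = τ)
    (v : Module.Basis ι R M) (w : Module.Basis ι R' M') (f : M →ₛₗ[ψ] M')
    {A B : Matrix ι ι R'} (hAB : A * B = 1) (hA : ∀ j, f (v j) = ∑ i, A i j • w i) :
    Function.Bijective (BC.lift (BC.scomp hτ (BC.incl σ M') f)) := by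
  refine bijective_of_matrix (BC.basis τ v) (BC.basis σ w) _ (A.map σ) (B.map σ)
    (map_mul_map_eq_one σ hAB) fun j => ?_
  simp only [BC.basis_apply]
  rw [BC.lift_incl, BC.scomp_apply, hA, map_sum]
  exact Finset.sum_congr rfl fun i _ => by rw [LinearMap.map_smulₛₗ]; rfl

theorem frobD_bijective : Function.Bijective (BC.lift N.frobD) := by
  classical
  obtain ⟨A, B, hAB, hA⟩ := N.exists_matrix (Module.Free.chooseBasis (SP p k) N)
  refine bijective_of_matrix (BC.basis (phi0 p k)
    (BC.basis (redSP p k) (Module.Free.chooseBasis (SP p k) N)))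
    (BC.basis (redSP p k) (Module.Free.chooseBasis (SP p k) N)) _ (A.map E.redSPE) (B.map E.redSPE)
    (map_mul_map_eq_one _ hAB) fun j => ?_
  rw [BC.basis_apply, BC.lift_incl]
  exact N.frobD_basis hA j

/-- The linear maps `ξ : D ⊗ 𝒪[1/λ] → 𝔑 ⊗ 𝒪[1/λ]` that are congruent to `1` modulo `u` and satisfy
`ξ ∘ (φ_D ⊗ 1) = (φ_𝔑 ⊗ 1) ∘ ᵠξ`. -/
def IsXi (ξ : BC E.kToOL N.D →ₗ[E.OL] BC E.spToOL N) : Prop :=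
  (∀ d : N.D, BC.change E.redOL E.redOL_spToOL (ξ (BC.incl _ _ d)) = d) ∧
  ∀ d : N.D, ξ (BC.incl _ _ (N.frobD d)) = N.frobOL (ξ (BC.incl _ _ d))

theorem eq_of_frob (N' : PhiModSP E) {g₁ g₂ : BC E.kToOL N.D →ₗ[E.OL] BC E.spToOL N'}
    (h₁ : ∀ d : N.D, g₁ (BC.incl _ _ (N.frobD d)) = N'.frobOL (g₁ (BC.incl _ _ d)))
    (h₂ : ∀ d : N.D, g₂ (BC.incl _ _ (N.frobD d)) = N'.frobOL (g₂ (BC.incl _ _ d)))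
    (h : ∀ d : N.D, BC.change E.redOL E.redOL_spToOL (g₁ (BC.incl _ _ d)) =
      BC.change E.redOL E.redOL_spToOL (g₂ (BC.incl _ _ d))) : g₁ = g₂ := by
  classical
  set b := Module.Free.chooseBasis (SP p k) N
  set b' := Module.Free.chooseBasis (SP p k) N'
  obtain ⟨A, B, hAB, hA⟩ := N.exists_matrix b
  obtain ⟨A', B', hAB', hA'⟩ := N'.exists_matrix b'
  set w := BC.basis E.spToOL b' with hw
  set d := BC.basis (redSP p k) b with hd
  -- the matrix of such a map satisfies a fixed point equation
  have key : ∀ g : BC E.kToOL N.D →ₗ[E.OL] BC E.spToOL N',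
      (∀ d : N.D, g (BC.incl _ _ (N.frobD d)) = N'.frobOL (g (BC.incl _ _ d))) →
      ∃ G : Matrix (Module.Free.ChooseBasisIndex (SP p k) N')
        (Module.Free.ChooseBasisIndex (SP p k) N) E.OL,
        (∀ j, g (BC.incl _ _ (d j)) = ∑ i, G i j • w i) ∧
        G = A'.map E.speToOL * G.map E.phiOL * (B.map E.redSPE).map E.kToOL := by
    intro g hg
    obtain ⟨G, hG⟩ : ∃ G : Matrix (Module.Free.ChooseBasisIndex (SP p k) N')
        (Module.Free.ChooseBasisIndex (SP p k) N) E.OL,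
        ∀ j, g (BC.incl _ _ (d j)) = ∑ i, G i j • w i :=
      ⟨fun i j => w.repr (g (BC.incl _ _ (d j))) i, fun j => (w.sum_repr _).symm⟩
    have h3 := (frob_iff_matrix d w N.frobD N'.frobOL
      (BC.scomp (RingHom.id_comp _) g (BC.incl E.kToOL N.D)) (N.frobD_basis hA)
      (N'.frobOL_basis hA') hG).1 fun j => hg (d j)
    refine ⟨G, hG, ?_⟩
    refine Eq.trans ?_ (congrArg (fun M => M * (B.map E.redSPE).map E.kToOL) h3)
    exact (eq_of_mul_mul (map_mul_map_eq_one E.kToOL (map_mul_map_eq_one E.redSPE hAB))).symm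
  obtain ⟨G₁, hG₁, hG₁'⟩ := key g₁ h₁
  obtain ⟨G₂, hG₂, hG₂'⟩ := key g₂ h₂
  have hGG : G₁ = G₂ := by
    refine matrix_unique E hG₁' hG₂' fun i j => ?_
    refine congrFun (coeff_unique (BC.basis (redSP p k) b') (c := fun i => E.redOL (G₁ i j))
      (c' := fun i => E.redOL (G₂ i j)) ?_) i
    have h5 := h (d j)
    rw [hG₁, hG₂, map_sum, map_sum] at h5
    simp only [LinearMap.map_smulₛₗ, hw, BC.basis_apply, BC.change_incl] at h5
    simpa only [BC.basis_apply] using h5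
  refine (BC.basis E.kToOL d).ext fun j => ?_
  rw [BC.basis_apply, hG₁, hG₂, hGG]

theorem exists_xi : ∃ ξ : BC E.kToOL N.D →ₗ[E.OL] BC E.spToOL N,
    N.IsXi ξ ∧ Function.Bijective ξ := by
  classical
  set b := Module.Free.chooseBasis (SP p k) N
  obtain ⟨A, B, hAB, hA⟩ := N.exists_matrix b
  obtain ⟨X, X', hXX, hX, hX0⟩ := matrix_exists_inv E A B hAB
  set w := BC.basis E.spToOL b with hw
  set d := BC.basis (redSP p k) b with hd
  set ξ : BC E.kToOL N.D →ₗ[E.OL] BC E.spToOL N :=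
    (BC.basis E.kToOL d).constr E.OL fun j => ∑ i, X i j • w i
  have hξ : ∀ j, ξ (BC.incl _ _ (d j)) = ∑ i, X i j • w i := fun j => by
    rw [← BC.basis_apply, Module.Basis.constr_basis]
  have hrel : X * (A.map E.redSPE).map E.kToOL = A.map E.speToOL * X.map E.phiOL := by
    have hBA : B * A = 1 := mul_eq_one_comm.1 hAB
    refine Eq.trans (congrArg (fun M => M * (A.map E.redSPE).map E.kToOL) hX) ?_
    exact eq_of_mul_mul (map_mul_map_eq_one E.kToOL (map_mul_map_eq_one E.redSPE hBA))
  refine ⟨ξ, ⟨?_, ?_⟩, bijective_of_matrix (BC.basis E.kToOL d) w ξ X X' hXX fun j => by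
    rw [BC.basis_apply, hξ]⟩
  · let f : N.D →ₗ[K0 p k] N.D :=
      BC.scomp E.redOL_kToOL (BC.change E.redOL E.redOL_spToOL)
        (BC.scomp (RingHom.id_comp _) ξ (BC.incl E.kToOL N.D))
    have hf : f = LinearMap.id := d.ext fun j => by
      change BC.change E.redOL E.redOL_spToOL (ξ (BC.incl _ _ (d j))) = d j
      rw [hξ, map_sum]
      simp only [LinearMap.map_smulₛₗ, hw, hd, BC.basis_apply, BC.change_incl]
      have h1 : ∀ i, E.redOL (X i j) = (1 : Matrix _ _ (K0 p k)) i j := fun i =>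
        congrFun (congrFun hX0 i) j
      simp only [h1, Matrix.one_apply, ite_smul, one_smul, zero_smul]
      simp
    exact fun x => LinearMap.congr_fun hf x
  · let f₁ : N.D →ₛₗ[E.kToOL.comp (phi0 p k)] BC E.spToOL N :=
      BC.scomp rfl (BC.scomp (RingHom.id_comp _) ξ (BC.incl E.kToOL N.D)) N.frobD
    let f₂ : N.D →ₛₗ[E.kToOL.comp (phi0 p k)] BC E.spToOL N :=
      BC.scomp E.phiOL_kToOL N.frobOL (BC.scomp (RingHom.id_comp _) ξ (BC.incl E.kToOL N.D))
    have hf : f₁ = f₂ := d.ext fun j => (frob_iff_matrix d w N.frobD N.frobOL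
      (BC.scomp (RingHom.id_comp _) ξ (BC.incl E.kToOL N.D)) (N.frobD_basis hA)
      (N.frobOL_basis hA) hξ).2 hrel j
    exact fun x => LinearMap.congr_fun hf x

theorem IsXi.unique {N : PhiModSP E} {ξ ξ' : BC E.kToOL N.D →ₗ[E.OL] BC E.spToOL N}
    (h : N.IsXi ξ) (h' : N.IsXi ξ') : ξ = ξ' :=
  eq_of_frob N N h.2 h'.2 fun d => by rw [h.1, h'.1]

/-- The isomorphism `ξ : D ⊗ 𝒪[1/λ] → 𝔑 ⊗ 𝒪[1/λ]`; by `PhiModSP.IsXi.unique` it is the only linear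
map with the property `PhiModSP.IsXi`. -/
def xi : BC E.kToOL N.D →ₗ[E.OL] BC E.spToOL N := Classical.choose N.exists_xi

theorem isXi_xi : N.IsXi N.xi := (Classical.choose_spec N.exists_xi).1

theorem xi_bijective : Function.Bijective N.xi := (Classical.choose_spec N.exists_xi).2

/-- The extension of `ξ` to `D ⊗ Ŝ[1/E] → 𝔑 ⊗ Ŝ[1/E]`. -/
def xiL : BC (E.kToLhat 0) N.D →ₗ[E.Lhat 0] BC (E.spToLhat 0) N :=
  BC.lift (BC.scomp (E.olToLhat_kToOL 0) (BC.change (E.olToLhat 0) (E.olToLhat_spToOL 0))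
    (BC.scomp (RingHom.id_comp _) N.xi (BC.incl E.kToOL N.D)))

/-- The map `φ_D ⊗ 1 : ᵠD ⊗ Ŝ[1/E] → D ⊗ Ŝ[1/E]`. -/
def phiDL : BC ((E.kToLhat 0).comp (phi0 p k)) N.D →ₗ[E.Lhat 0] BC (E.kToLhat 0) N.D :=
  BC.lift (BC.scomp rfl (BC.incl (E.kToLhat 0) N.D) N.frobD)

/-- The submodule `𝔑 ⊗ Ŝ` of `𝔑 ⊗ Ŝ[1/E]`. -/
def hatLattice : Submodule (E.Shat 0) (BC (E.spToLhat 0) N) :=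
  Submodule.span (E.Shat 0) (Set.range (BC.incl (E.spToLhat 0) N))

/-- The Hodge–Pink structure `V_D = (φ_D ⊗ 1)⁻¹(ξ⁻¹(𝔑 ⊗ Ŝ))`. -/
def V : Submodule (E.Shat 0) (BC ((E.kToLhat 0).comp (phi0 p k)) N.D) :=
  N.hatLattice.comap ((N.xiL ∘ₗ N.phiDL).restrictScalars (E.Shat 0))

theorem phiDL_bijective : Function.Bijective N.phiDL := by
  classical
  obtain ⟨A, B, hAB, hA⟩ := N.exists_matrix (Module.Free.chooseBasis (SP p k) N)
  exact bijective_lift_incl (E.kToLhat 0) rfl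
    (BC.basis (redSP p k) (Module.Free.chooseBasis (SP p k) N))
    (BC.basis (redSP p k) (Module.Free.chooseBasis (SP p k) N)) N.frobD
    (map_mul_map_eq_one E.redSPE hAB) (N.frobD_basis hA)

theorem xiL_bijective : Function.Bijective N.xiL := by
  classical
  set b := Module.Free.chooseBasis (SP p k) N
  obtain ⟨A, B, hAB, hA⟩ := matrix_of_bijective (BC.basis E.kToOL (BC.basis (redSP p k) b))
    (BC.basis E.spToOL b) N.xi N.xi_bijective
  refine bijective_of_matrix (BC.basis (E.kToLhat 0) (BC.basis (redSP p k) b))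
    (BC.basis (E.spToLhat 0) b) _ (A.map (E.olToLhat 0)) (B.map (E.olToLhat 0))
    (map_mul_map_eq_one _ hAB) fun j => ?_
  have h1 := hA j
  rw [BC.basis_apply] at h1
  rw [BC.basis_apply, xiL, BC.lift_incl, BC.scomp_apply, BC.scomp_apply, h1, map_sum]
  refine Finset.sum_congr rfl fun i _ => ?_
  rw [LinearMap.map_smulₛₗ, BC.basis_apply, BC.basis_apply, BC.change_incl]
  rfl

theorem hatLattice_eq {ι : Type*} [Fintype ι] (b : Module.Basis ι (SP p k) N) :
    N.hatLattice = Submodule.span (E.Shat 0) (Set.range (BC.basis (E.spToLhat 0) b)) := by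
  refine le_antisymm (Submodule.span_le.2 ?_) (Submodule.span_mono ?_)
  · rintro _ ⟨n, rfl⟩
    rw [← b.sum_repr n, map_sum]
    refine Submodule.sum_mem _ fun i _ => ?_
    rw [LinearMap.map_smulₛₗ, E.spToLhat_smul]
    refine Submodule.smul_mem _ _ (Submodule.subset_span ⟨i, ?_⟩)
    rw [BC.basis_apply]
  · rintro _ ⟨i, rfl⟩
    exact ⟨b i, by rw [BC.basis_apply]⟩

theorem V_isLattice : ∃ (r : ℕ) (b : Module.Basis (Fin r) (E.Lhat 0)
    (BC ((E.kToLhat 0).comp (phi0 p k)) N.D)),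
    N.V = Submodule.span (E.Shat 0) (Set.range b) := by
  let b := (Module.Free.chooseBasis (SP p k) N).reindex (Fintype.equivFin _)
  let e := LinearEquiv.ofBijective (N.xiL ∘ₗ N.phiDL) (N.xiL_bijective.comp N.phiDL_bijective)
  refine ⟨_, (BC.basis (E.spToLhat 0) b).map e.symm, ?_⟩
  rw [V, N.hatLattice_eq b]
  have h1 : (N.xiL ∘ₗ N.phiDL).restrictScalars (E.Shat 0) =
      (e.restrictScalars (E.Shat 0)).toLinearMap := rfl
  rw [h1, Submodule.comap_equiv_eq_map_symm, Submodule.map_span, ← Set.range_comp]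
  rfl

/-- The `φ`-module of Hodge–Pink attached to `𝔑`. -/
@[reducible]
def toMHP : MHP E where
  carrier := N.D
  frob := N.frobD
  frob_bijective := N.frobD_bijective
  V := N.V
  isLattice := N.V_isLattice

/-! ### Functoriality -/

variable {N} {N' : PhiModSP E} (f : N →ₗ[SP p k] N')

theorem map_frobD
    (hf : ∀ n, BC.map E.spToSPE f (N.frob n) = N'.frob (f n)) (d : N.D) : BC.map (redSP p k) f (N.frobD d) = N'.frobD (BC.map (redSP p k) f d) := by
  refine BC.induction (redSP p k)
    (motive := fun d => BC.map (redSP p k) f (N.frobD d) = N'.frobD (BC.map (redSP p k) f d)) ?_ ?_ ?_ d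
  · simp only [map_zero]
  · intro s n
    simp only [LinearMap.map_smulₛₗ, map_smul, BC.map_incl, frobD_incl, ← hf, BC.change_map]
  · intro x y hx hy
    simp only [map_add, hx, hy]

theorem map_frobOL
    (hf : ∀ n, BC.map E.spToSPE f (N.frob n) = N'.frob (f n)) (x : BC E.spToOL N) :
    BC.map E.spToOL f (N.frobOL x) = N'.frobOL (BC.map E.spToOL f x) := by
  refine BC.induction E.spToOL
    (motive := fun x => BC.map E.spToOL f (N.frobOL x) = N'.frobOL (BC.map E.spToOL f x))
    ?_ ?_ ?_ x
  · simp only [map_zero]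
  · intro s n
    simp only [LinearMap.map_smulₛₗ, map_smul, BC.map_incl, frobOL_incl, ← hf, BC.change_map]
  · intro x y hx hy
    simp only [map_add, hx, hy]

theorem xi_map
    (hf : ∀ n, BC.map E.spToSPE f (N.frob n) = N'.frob (f n)) : N'.xi ∘ₗ BC.map E.kToOL (BC.map (redSP p k) f) = BC.map E.spToOL f ∘ₗ N.xi := by
  refine eq_of_frob N N' ?_ ?_ ?_
  · intro d
    simp only [LinearMap.comp_apply, BC.map_incl, map_frobD f hf, N'.isXi_xi.2]
  · intro d
    simp only [LinearMap.comp_apply, N.isXi_xi.2, map_frobOL f hf]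
  · intro d
    simp only [LinearMap.comp_apply, BC.map_incl, N'.isXi_xi.1, BC.change_map, N.isXi_xi.1]

theorem xiL_phiDL_map
    (hf : ∀ n, BC.map E.spToSPE f (N.frob n) = N'.frob (f n)) (x : BC ((E.kToLhat 0).comp (phi0 p k)) N.D) :
    N'.xiL (N'.phiDL (BC.map ((E.kToLhat 0).comp (phi0 p k)) (BC.map (redSP p k) f) x)) =
      BC.map (E.spToLhat 0) f (N.xiL (N.phiDL x)) := by
  have h : (N'.xiL ∘ₗ N'.phiDL) ∘ₗ BC.map ((E.kToLhat 0).comp (phi0 p k)) (BC.map (redSP p k) f) =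
      BC.map (E.spToLhat 0) f ∘ₗ (N.xiL ∘ₗ N.phiDL) := by
    refine BC.ext fun d => ?_
    have h1 := LinearMap.congr_fun (xi_map f hf) (BC.incl _ _ (N.frobD d))
    simp only [LinearMap.comp_apply, BC.map_incl] at h1
    simp only [LinearMap.comp_apply, BC.map_incl, phiDL, xiL, BC.lift_incl, BC.scomp_apply,
      ← BC.change_map, ← h1, map_frobD f hf]
  exact LinearMap.congr_fun h x

theorem map_mem_V
    (hf : ∀ n, BC.map E.spToSPE f (N.frob n) = N'.frob (f n)) (x : BC ((E.kToLhat 0).comp (phi0 p k)) N.D) (hx : x ∈ N.V) :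
    BC.map ((E.kToLhat 0).comp (phi0 p k)) (BC.map (redSP p k) f) x ∈ N'.V := by
  change N'.xiL (N'.phiDL _) ∈ N'.hatLattice
  rw [xiL_phiDL_map f hf]
  change N.xiL (N.phiDL x) ∈ N.hatLattice at hx
  have h : N.hatLattice ≤ N'.hatLattice.comap
      ((BC.map (E.spToLhat 0) f).restrictScalars (E.Shat 0)) := by
    refine Submodule.span_le.2 ?_
    rintro _ ⟨n, rfl⟩
    change BC.map (E.spToLhat 0) f (BC.incl _ _ n) ∈ N'.hatLattice
    rw [BC.map_incl]
    exact Submodule.subset_span ⟨_, rfl⟩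
  exact h hx

/-- The map induced by `f` on the associated `φ`-modules of Hodge–Pink. -/
def mapMHP
    (hf : ∀ n, BC.map E.spToSPE f (N.frob n) = N'.frob (f n)) : MHP.Hom N.toMHP N'.toMHP :=
  @MHP.Hom.mk p hp k _ _ _ E N.toMHP N'.toMHP (BC.map (redSP p k) f) (map_frobD f hf)
    (map_mem_V f hf)

end PhiModSP

/-- The functor `𝔻_iso`, which maps `(𝔑, φ_𝔑)` to `(D, φ_D, V_D)`. -/
def DIso (E : EisensteinPoly p k) : PIMod E ⥤ MHP E where
  obj N := N.toMHP
  map {_ _} f := PhiModSP.mapMHP (PIMod.Hom.toLin (E := E) f) (PIMod.Hom.comm (E := E) f)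
  map_id N := MHP.Hom.ext BC.map_id
  map_comp {N N' N''} (f : PIMod.Hom N N') (g : PIMod.Hom N' N'') :=
    MHP.Hom.ext (BC.map_comp g.toLin f.toLin)

end Functor

end

end HodgePink

/-! # `𝔑` is recovered from `𝔻_iso(𝔑)`

Fix a basis of `𝔑` that spans the lattice `𝔐` of the amplitude condition, and let
`x ∈ D ⊗ 𝒪[1/λ]`. The two conditions that define `Ñ` translate into conditions on the coordinates
`mᵢ ∈ 𝒪[1/λ]` of `ξ(x)`.

*Integrality.* As `ξ` commutes with the Frobenius maps, it carries the lattice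
`φ_D ⋯ ᵠⁿφ_D(ᵠⁿV)` to the image of `ᵠⁿ𝔑 ⊗ Ŝₙ` under `Φₙ` (`PhiModSP.xiHat_theta`). The
amplitude condition writes the matrices of `Φₙ` and `Φₙ⁻¹` with denominators `E ⋯ φⁿ⁻¹(E)`, which
are units in `Ŝₙ`, so this image is `𝔑 ⊗ Ŝₙ`. Hence `x` is integral at all `n` if and only if all
`mᵢ` are integral at all zeros of `λ`, which means `mᵢ ∈ 𝒪`
(`EisensteinPoly.mem_O_of_forall_mem_range`): on a disc of radius less than one, `λ` is a unit
times a finite product of the pairwise coprime polynomials `φⁱ(E)`.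

*Growth.* Let `ρₙ = |π_K| ^ (p⁻ⁿ)`. The vector `(φ_D ⋯ ᵠⁿ⁻¹φ_D)⁻¹ x` has the coordinates
`ᵠⁿξ⁻¹ (Φₙ⁻¹ m)`. The Gauss norms satisfy `|φⁿ(z)|_{ρₙ} = |z|_{ρ₀}`, so `ᵠⁿξ` and its inverse are
bounded for `|·|_{ρₙ}` independently of `n`. So are `Φₙ` and `Φₙ⁻¹`, since
`p⁻¹ ≤ |E ⋯ φⁿ⁻¹(E)|_{ρₙ} ≤ 1` (`EisensteinPoly.le_normOL_prod_unitE`). Thus the growth condition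
says that `|mᵢ|_{ρₙ}` is bounded in `n`; for `mᵢ ∈ 𝒪` and `ρₙ → 1` this means that the
coefficients of `mᵢ` are bounded, that is, `mᵢ ∈ 𝔖[1/p]`.

The subset `Ñ` is functorial in the `φ`-module of Hodge–Pink, so a morphism `D → D'` induces a map
`𝔑 = ξ(Ñ) → ξ'(Ñ') = 𝔑'`, which gives fullness. The functor is faithful because `ξ` is a natural
isomorphism and `𝔑` embeds into `𝔑 ⊗ 𝒪[1/λ]`.
-/

namespace HodgePink

/-! ### The Gauss norms -/

section GaussNorm

variable {p : ℕ} [hp : Fact p.Prime] {k : Type u} [Field k] [CharP k p] [PerfectRing k p]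

theorem gaussNorm_le {r C : ℝ} {x : RingA p k} (h : NB r C x) : gaussNorm p k r x ≤ C :=
  ciSup_le h

theorem NB_gaussNorm {r : ℝ} (hr : 0 < r) (h1 : r < 1) {x : RingA p k} (hx : x ∈ RingO p k) :
    NB r (gaussNorm p k r x) x := fun n => by
  obtain ⟨C, hC⟩ := hx r hr h1
  exact le_ciSup (f := fun n => absK p k (PowerSeries.coeff n x) * r ^ n)
    ⟨C, by rintro _ ⟨n, rfl⟩; exact hC n⟩ n

theorem gaussNorm_nonneg {r : ℝ} (hr : 0 < r) (x : RingA p k) : 0 ≤ gaussNorm p k r x :=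
  Real.iSup_nonneg fun n => by positivity

/-- On `𝒪` the supremum in the Gauss norm is attained, as the series converges on a larger disc;
the index is chosen minimal. -/
theorem exists_gaussNorm_eq {r : ℝ} (hr : 0 < r) (h1 : r < 1) {x : RingA p k}
    (hx : x ∈ RingO p k) :
    ∃ n, absK p k (PowerSeries.coeff n x) * r ^ n = gaussNorm p k r x ∧
      ∀ m < n, absK p k (PowerSeries.coeff m x) * r ^ m < gaussNorm p k r x := by
  classical
  have hNB := NB_gaussNorm hr h1 hx
  suffices h : ∃ n, absK p k (PowerSeries.coeff n x) * r ^ n = gaussNorm p k r x from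
    ⟨Nat.find h, Nat.find_spec h, fun m hm => lt_of_le_of_ne (hNB m) (Nat.find_min h hm)⟩
  rcases (gaussNorm_nonneg hr x).eq_or_lt with h0 | h0
  · exact ⟨0, le_antisymm (hNB 0) (by rw [← h0]; positivity)⟩
  by_contra hcon
  push Not at hcon
  obtain ⟨r', hr', h1'⟩ := exists_between h1
  have hr'0 : 0 < r' := hr.trans hr'
  obtain ⟨C, hC⟩ := hx r' hr'0 h1'
  have hlim := (tendsto_pow_atTop_nhds_zero_of_lt_one (div_nonneg hr.le hr'0.le)
    ((div_lt_one hr'0).2 hr')).const_mul C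
  rw [mul_zero] at hlim
  obtain ⟨N, hN⟩ := Filter.eventually_atTop.1
    (hlim.eventually (gt_mem_nhds (half_pos h0)))
  -- the finitely many terms of index `< N` stay strictly below the supremum
  obtain ⟨D, hD, hDlt⟩ : ∃ D < gaussNorm p k r x,
      ∀ n < N, absK p k (PowerSeries.coeff n x) * r ^ n ≤ D := by
    clear hN
    induction N with
    | zero => exact ⟨gaussNorm p k r x - 1, by linarith, fun n hn => absurd hn (by omega)⟩
    | succ N ih =>
      obtain ⟨D, hD, h⟩ := ih
      refine ⟨max D (absK p k (PowerSeries.coeff N x) * r ^ N),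
        max_lt hD (lt_of_le_of_ne (hNB N) (hcon N)), fun n hn => ?_⟩
      rcases Nat.lt_succ_iff_lt_or_eq.1 hn with h2 | rfl
      · exact (h n h2).trans (le_max_left _ _)
      · exact le_max_right _ _
  refine absurd (gaussNorm_le (r := r) (x := x)
    (C := max D (gaussNorm p k r x / 2)) fun n => ?_) (not_le.2 (max_lt hD (by linarith)))
  rcases lt_or_ge n N with hn | hn
  · exact (hDlt n hn).trans (le_max_left _ _)
  · refine le_trans ?_ ((hN n hn).le.trans (le_max_right _ _))
    rw [div_pow, mul_div_assoc', le_div_iff₀ (by positivity)]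
    calc _ = absK p k (PowerSeries.coeff n x) * r' ^ n * r ^ n := by ring
      _ ≤ C * r ^ n := by gcongr; exact hC n

/-- The strict form of the ultrametric inequality. -/
theorem absK_add_eq {x y : K0 p k} (h : absK p k y < absK p k x) :
    absK p k (x + y) = absK p k x := by
  refine le_antisymm ((absK_add x y).trans (max_le le_rfl h.le)) ?_
  have := absK_sub_le (x + y) y
  rw [add_sub_cancel_right] at this
  rcases le_max_iff.1 this with h2 | h2
  · exact h2
  · exact absurd h2 (not_le.2 h)

theorem absK_sum_lt {ι : Type*} (s : Finset ι) (f : ι → K0 p k) {C : ℝ} (hC : 0 < C)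
    (h : ∀ i ∈ s, absK p k (f i) < C) : absK p k (∑ i ∈ s, f i) < C := by
  classical
  induction s using Finset.induction_on with
  | empty => simpa
  | insert a s ha ih =>
    rw [Finset.sum_insert ha]
    exact (absK_add _ _).trans_lt (max_lt (h _ (by simp))
      (ih fun i hi => h i (Finset.mem_insert_of_mem hi)))

/-- The Gauss norm is multiplicative: the product of the terms at the minimal maximising indices
strictly dominates all other contributions to its coefficient. -/
theorem gaussNorm_mul {r : ℝ} (hr : 0 < r) (h1 : r < 1) {x y : RingA p k} (hx : x ∈ RingO p k)
    (hy : y ∈ RingO p k) :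
    gaussNorm p k r (x * y) = gaussNorm p k r x * gaussNorm p k r y := by
  have hX := NB_gaussNorm hr h1 hx
  have hY := NB_gaussNorm hr h1 hy
  refine le_antisymm (gaussNorm_le (hX.mul hr hY)) ?_
  rcases (gaussNorm_nonneg hr x).eq_or_lt with hx0 | hx0
  · rw [← hx0, zero_mul]; exact gaussNorm_nonneg hr _
  rcases (gaussNorm_nonneg hr y).eq_or_lt with hy0 | hy0
  · rw [← hy0, mul_zero]; exact gaussNorm_nonneg hr _
  obtain ⟨a, ha, ha'⟩ := exists_gaussNorm_eq hr h1 hx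
  obtain ⟨b, hb, hb'⟩ := exists_gaussNorm_eq hr h1 hy
  have hmain : absK p k (PowerSeries.coeff (a + b) (x * y)) =
      absK p k (PowerSeries.coeff a x * PowerSeries.coeff b y) := by
    have hmem : (a, b) ∈ Finset.HasAntidiagonal.antidiagonal (a + b) :=
      Finset.HasAntidiagonal.mem_antidiagonal.2 rfl
    have hval : absK p k (PowerSeries.coeff a x * PowerSeries.coeff b y) * r ^ (a + b) =
        gaussNorm p k r x * gaussNorm p k r y := by
      rw [← ha, ← hb, map_mul, pow_add]; ring
    have hpos : 0 < absK p k (PowerSeries.coeff a x * PowerSeries.coeff b y) :=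
      pos_of_mul_pos_left (hval ▸ mul_pos hx0 hy0) (by positivity)
    rw [PowerSeries.coeff_mul, ← Finset.add_sum_erase _ _ hmem]
    refine absK_add_eq (absK_sum_lt _ _ hpos fun i hi => ?_)
    obtain ⟨hne, hi⟩ := Finset.mem_erase.1 hi
    have hi := Finset.HasAntidiagonal.mem_antidiagonal.1 hi
    refine lt_of_mul_lt_mul_right (a := r ^ (a + b)) ?_ (by positivity)
    rw [hval, ← hi, pow_add, map_mul]
    have hlt : i.1 < a ∨ i.2 < b := by
      by_contra hcon
      push Not at hcon
      exact hne (Prod.ext (by simp; omega) (by simp; omega))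
    calc _ = (absK p k (PowerSeries.coeff i.1 x) * r ^ i.1) *
          (absK p k (PowerSeries.coeff i.2 y) * r ^ i.2) := by ring
      _ < gaussNorm p k r x * gaussNorm p k r y := by
        rcases hlt with h | h
        · exact (mul_le_mul_of_nonneg_left (hY i.2) (by positivity)).trans_lt
            (mul_lt_mul_of_pos_right (ha' i.1 h) hy0)
        · exact (mul_le_mul_of_nonneg_right (hX i.1) (by positivity)).trans_lt
            (mul_lt_mul_of_pos_left (hb' i.2 h) hx0)
  have h2 := (NB_gaussNorm hr h1 ((RingO p k).mul_mem hx hy)) (a + b)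
  rw [hmain, map_mul, pow_add] at h2
  rw [← ha, ← hb]
  linarith

theorem gaussNorm_one {r : ℝ} : gaussNorm p k r 1 = 1 := by
  refine le_antisymm (gaussNorm_le NB.one) ?_
  refine (le_of_eq ?_).trans (le_ciSup (f := fun n => absK p k
    (PowerSeries.coeff n (1 : RingA p k)) * r ^ n) ⟨1, by rintro _ ⟨n, rfl⟩; exact NB.one n⟩ 0)
  simp

theorem gaussNorm_pow {r : ℝ} (hr : 0 < r) (h1 : r < 1) {x : RingA p k} (hx : x ∈ RingO p k)
    (n : ℕ) : gaussNorm p k r (x ^ n) = gaussNorm p k r x ^ n := by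
  induction n with
  | zero => simp [gaussNorm_one]
  | succ n ih => rw [pow_succ, pow_succ, gaussNorm_mul hr h1 ((RingO p k).pow_mem hx n) hx, ih]

theorem gaussNorm_add_le {r : ℝ} (hr : 0 < r) (h1 : r < 1) {x y : RingA p k}
    (hx : x ∈ RingO p k) (hy : y ∈ RingO p k) :
    gaussNorm p k r (x + y) ≤ max (gaussNorm p k r x) (gaussNorm p k r y) :=
  gaussNorm_le (((NB_gaussNorm hr h1 hx).mono (le_max_left _ _)).add hr.le
    ((NB_gaussNorm hr h1 hy).mono (le_max_right _ _)))

/-- The Frobenius is isometric from the radius `r ^ p` to the radius `r`. -/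
theorem gaussNorm_phi {r : ℝ} (hr : 0 < r) (h1 : r < 1) {x : RingA p k} (hx : x ∈ RingO p k) :
    gaussNorm p k r (phi p k x) = gaussNorm p k (r ^ p) x := by
  have hX := NB_gaussNorm (pow_pos hr p) (pow_lt_one₀ hr.le h1 hp.out.ne_zero) hx
  refine le_antisymm (gaussNorm_le fun n => ?_) (gaussNorm_le fun n => ?_)
  · rw [coeff_phi]
    split_ifs with h
    · obtain ⟨m, rfl⟩ := h
      rw [absK_phi0, Nat.mul_div_cancel_left _ hp.out.pos, pow_mul]; exact hX _
    · rw [map_zero, zero_mul]; exact gaussNorm_nonneg (pow_pos hr p) _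
  · have h2 := NB_gaussNorm hr h1 (phi_mem_O hx) (p * n)
    rwa [coeff_phi, if_pos (dvd_mul_right _ _), absK_phi0, Nat.mul_div_cancel_left _ hp.out.pos,
      pow_mul] at h2

theorem gaussNorm_C {r : ℝ} (c : K0 p k) : gaussNorm p k r (PowerSeries.C c) = absK p k c := by
  have h : NB r (absK p k c) (PowerSeries.C c) := fun n => by
    rw [PowerSeries.coeff_C]
    split_ifs with h
    · simp [h]
    · simp
  refine le_antisymm (gaussNorm_le h) ?_
  refine (le_of_eq ?_).trans (le_ciSup (f := fun n => absK p k
    (PowerSeries.coeff n (PowerSeries.C c : RingA p k)) * r ^ n)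
      ⟨absK p k c, by rintro _ ⟨n, rfl⟩; exact h n⟩ 0)
  simp

namespace EisensteinPoly

variable (E : EisensteinPoly p k) {r : ℝ}

theorem gaussNorm_lam_pos (hr : 0 < r) (h1 : r < 1) : 0 < gaussNorm p k r E.lam := by
  have := NB_gaussNorm hr h1 E.lam_mem 0
  rw [PowerSeries.coeff_zero_eq_constantCoeff_apply, E.constantCoeff_lam] at this
  simp only [map_one, pow_zero, mul_one] at this
  linarith

/-- The value `|x|_r` does not depend on the power of `λ` that clears the denominator. -/
theorem normOL_eq (hr : 0 < r) (h1 : r < 1) (x : E.OL) {N : ℕ}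
    (hN : E.lam ^ N * (x : RingA p k) ∈ RingO p k) :
    E.normOL r x = gaussNorm p k r (E.lam ^ N * x) / gaussNorm p k r E.lam ^ N := by
  have hpos := E.gaussNorm_lam_pos hr h1
  rw [normOL, div_eq_div_iff (by positivity) (by positivity),
    ← gaussNorm_pow hr h1 E.lam_mem, ← gaussNorm_pow hr h1 E.lam_mem,
    ← gaussNorm_mul hr h1 (Classical.choose_spec x.2) ((RingO p k).pow_mem E.lam_mem _),
    ← gaussNorm_mul hr h1 hN ((RingO p k).pow_mem E.lam_mem _)]
  congr 1
  ring

theorem normOL_of_mem (hr : 0 < r) (h1 : r < 1) (x : E.OL) (hx : (x : RingA p k) ∈ RingO p k) :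
    E.normOL r x = gaussNorm p k r x := by
  rw [E.normOL_eq hr h1 x (N := 0) (by simpa using hx)]
  simp

theorem normOL_nonneg (hr : 0 < r) (h1 : r < 1) (x : E.OL) : 0 ≤ E.normOL r x :=
  div_nonneg (gaussNorm_nonneg hr _) (pow_nonneg (E.gaussNorm_lam_pos hr h1).le _)

theorem normOL_mul (hr : 0 < r) (h1 : r < 1) (x y : E.OL) :
    E.normOL r (x * y) = E.normOL r x * E.normOL r y := by
  obtain ⟨N, hN⟩ := x.2
  obtain ⟨M, hM⟩ := y.2
  have h2 : E.lam ^ (N + M) * ((x * y : E.OL) : RingA p k) =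
      (E.lam ^ N * x) * (E.lam ^ M * y) := by
    rw [MulMemClass.coe_mul]; ring
  rw [E.normOL_eq hr h1 x hN, E.normOL_eq hr h1 y hM,
    E.normOL_eq hr h1 (x * y) (N := N + M) (h2 ▸ (RingO p k).mul_mem hN hM), h2,
    gaussNorm_mul hr h1 hN hM, pow_add, div_mul_div_comm]

theorem normOL_add_le (hr : 0 < r) (h1 : r < 1) (x y : E.OL) :
    E.normOL r (x + y) ≤ max (E.normOL r x) (E.normOL r y) := by
  obtain ⟨N, hN⟩ := x.2
  obtain ⟨M, hM⟩ := y.2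
  have hx : E.lam ^ (N + M) * (x : RingA p k) ∈ RingO p k := by
    have := (RingO p k).mul_mem ((RingO p k).pow_mem E.lam_mem M) hN
    convert this using 1; ring
  have hy : E.lam ^ (N + M) * (y : RingA p k) ∈ RingO p k := by
    have := (RingO p k).mul_mem ((RingO p k).pow_mem E.lam_mem N) hM
    convert this using 1; ring
  have h2 : E.lam ^ (N + M) * ((x + y : E.OL) : RingA p k) =
      E.lam ^ (N + M) * x + E.lam ^ (N + M) * y := by
    rw [AddMemClass.coe_add, mul_add]
  have hpos := E.gaussNorm_lam_pos hr h1
  rw [E.normOL_eq hr h1 x hx, E.normOL_eq hr h1 y hy,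
    E.normOL_eq hr h1 (x + y) (h2 ▸ (RingO p k).add_mem hx hy), h2, max_div_div_right (by positivity)]
  gcongr
  exact gaussNorm_add_le hr h1 hx hy

theorem normOL_zero (hr : 0 < r) (h1 : r < 1) : E.normOL r 0 = 0 := by
  rw [E.normOL_of_mem hr h1 0 (RingO p k).zero_mem]
  have h := gaussNorm_C (p := p) (k := k) (r := r) 0
  rw [map_zero, map_zero] at h
  exact h

theorem normOL_one (hr : 0 < r) (h1 : r < 1) : E.normOL r 1 = 1 := by
  rw [E.normOL_of_mem hr h1 1 (RingO p k).one_mem]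
  exact gaussNorm_one

theorem normOL_sum_le {ι : Type*} (hr : 0 < r) (h1 : r < 1) (s : Finset ι) (f : ι → E.OL) {C : ℝ}
    (hC : 0 ≤ C) (h : ∀ i ∈ s, E.normOL r (f i) ≤ C) : E.normOL r (∑ i ∈ s, f i) ≤ C := by
  classical
  induction s using Finset.induction_on with
  | empty => simpa [E.normOL_zero hr h1]
  | insert a s ha ih =>
    rw [Finset.sum_insert ha]
    exact (E.normOL_add_le hr h1 _ _).trans (max_le (h _ (by simp))
      (ih fun i hi => h i (Finset.mem_insert_of_mem hi)))

theorem normOL_kToOL (hr : 0 < r) (h1 : r < 1) (c : K0 p k) :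
    E.normOL r (E.kToOL c) = absK p k c := by
  rw [E.normOL_of_mem hr h1 _ (C_mem _ c)]
  exact gaussNorm_C c

theorem normOL_pow (hr : 0 < r) (h1 : r < 1) (x : E.OL) (n : ℕ) :
    E.normOL r (x ^ n) = E.normOL r x ^ n := by
  induction n with
  | zero => rw [pow_zero, pow_zero, E.normOL_one hr h1]
  | succ n ih => rw [pow_succ, pow_succ, E.normOL_mul hr h1, ih]

theorem coe_phiOL (x : E.OL) : ((E.phiOL x : E.OL) : RingA p k) = phi p k (x : RingA p k) := rfl

theorem normOL_phiOL_of_mem (hr : 0 < r) (h1 : r < 1) (x : E.OL)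
    (hx : (x : RingA p k) ∈ RingO p k) :
    E.normOL r (E.phiOL x) = gaussNorm p k (r ^ p) x := by
  have h2 : ((E.phiOL x : E.OL) : RingA p k) ∈ RingO p k := by
    rw [coe_phiOL]; exact phi_mem_O hx
  rw [E.normOL_of_mem hr h1 (E.phiOL x) h2, coe_phiOL, gaussNorm_phi hr h1 hx]

theorem normOL_phiOL (hr : 0 < r) (h1 : r < 1) (x : E.OL) :
    E.normOL r (E.phiOL x) = E.normOL (r ^ p) x := by
  obtain ⟨N, hN⟩ := x.2
  have hr' := pow_pos hr p
  have h1' := pow_lt_one₀ hr.le h1 hp.out.ne_zero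
  have hpos := E.gaussNorm_lam_pos hr' h1'
  let l : E.OL := ⟨E.lam, E.O_le_OL E.lam_mem⟩
  have hl := E.normOL_phiOL_of_mem hr h1 l E.lam_mem
  have hx := E.normOL_phiOL_of_mem hr h1 (l ^ N * x) hN
  rw [map_mul, map_pow, E.normOL_mul hr h1, E.normOL_pow hr h1, hl] at hx
  rw [E.normOL_eq hr' h1' x hN, eq_div_iff (pow_pos hpos N).ne', mul_comm]
  exact hx

end EisensteinPoly

end GaussNorm

/-! ### The radii of the zeros of `φⁿ(E)` -/

section Radii

set_option linter.unusedSectionVars false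

variable {p : ℕ} [hp : Fact p.Prime] {k : Type u} [Field k] [CharP k p] [PerfectRing k p]

namespace EisensteinPoly

variable (E : EisensteinPoly p k)

/-- The radius `|π_K| ^ (p⁻ⁿ)`, on which all zeros of `φⁿ(E)` lie. -/
noncomputable def zeroRadius (n : ℕ) : ℝ := E.absPi ^ (((p : ℝ) ^ n)⁻¹)

theorem absPi_pos : 0 < E.absPi := Real.rpow_pos_of_pos (inv_pos.2 (p_pos (p := p))) _

theorem absPi_lt_one : E.absPi < 1 :=
  Real.rpow_lt_one (inv_nonneg.2 (p_pos (p := p)).le) inv_p_lt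
    (inv_pos.2 (by exact_mod_cast E.natDegree_pos))

theorem zeroRadius_pos (n : ℕ) : 0 < E.zeroRadius n := Real.rpow_pos_of_pos E.absPi_pos _

theorem zeroRadius_lt_one (n : ℕ) : E.zeroRadius n < 1 :=
  Real.rpow_lt_one E.absPi_pos.le E.absPi_lt_one (inv_pos.2 (pow_pos p_pos n))

theorem zeroRadius_pow_p_pow (n : ℕ) : E.zeroRadius n ^ p ^ n = E.absPi := by
  have h := Real.rpow_inv_natCast_pow E.absPi_pos.le (pow_pos hp.out.pos n).ne'
  rwa [Nat.cast_pow] at h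

theorem absPi_pow_deg : E.absPi ^ E.deg = (p : ℝ)⁻¹ :=
  Real.rpow_inv_natCast_pow (inv_nonneg.2 (p_pos (p := p)).le) E.natDegree_pos.ne'

theorem zeroRadius_succ_pow (n : ℕ) : E.zeroRadius (n + 1) ^ p = E.zeroRadius n := by
  have h := E.zeroRadius_pow_p_pow (n + 1)
  rw [pow_succ', pow_mul, ← E.zeroRadius_pow_p_pow n] at h
  exact (pow_left_inj₀ (pow_nonneg (E.zeroRadius_pos _).le _) (E.zeroRadius_pos n).le
    (pow_pos hp.out.pos n).ne').1 h

theorem tendsto_zeroRadius : Filter.Tendsto E.zeroRadius Filter.atTop (nhds 1) := by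
  have h1 : Filter.Tendsto (fun n : ℕ => ((p : ℝ) ^ n)⁻¹) Filter.atTop (nhds 0) :=
    (tendsto_pow_atTop_atTop_of_one_lt
      (show (1 : ℝ) < p by exact_mod_cast hp.out.one_lt)).inv_tendsto_atTop
  have h2 := (Real.continuousAt_const_rpow (b := 0) E.absPi_pos.ne').tendsto.comp h1
  rwa [Real.rpow_zero] at h2

theorem normOL_phiOL_iterate (n : ℕ) (x : E.OL) :
    E.normOL (E.zeroRadius n) ((E.phiOL ^ n : E.OL →+* E.OL) x) = E.normOL (E.zeroRadius 0) x := by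
  induction n with
  | zero => rfl
  | succ n ih =>
    rw [pow_succ', ← ih, ← E.zeroRadius_succ_pow n]
    exact E.normOL_phiOL (E.zeroRadius_pos _) (E.zeroRadius_lt_one _) _

/-- The norm `|·|_r` as a homomorphism of monoids. -/
noncomputable def normHom {r : ℝ} (hr : 0 < r) (h1 : r < 1) : E.OL →* ℝ where
  toFun := E.normOL r
  map_one' := E.normOL_one hr h1
  map_mul' := E.normOL_mul hr h1

theorem normOL_units_zpow {r : ℝ} (hr : 0 < r) (h1 : r < 1) (x : (E.OL)ˣ) (s : ℤ) :
    E.normOL r ((x ^ s : (E.OL)ˣ) : E.OL) = E.normOL r (x : E.OL) ^ s := by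
  change ((Units.map (E.normHom hr h1) (x ^ s) : ℝˣ) : ℝ) =
    ((Units.map (E.normHom hr h1) x : ℝˣ) : ℝ) ^ s
  rw [map_zpow, Units.val_zpow_eq_zpow_val]

theorem normOL_unitE_le {r : ℝ} (hr : 0 < r) (h1 : r < 1) (n : ℕ) :
    E.normOL r (E.unitE n : E.OL) ≤ 1 := by
  rw [E.normOL_of_mem hr h1 _ (SP_le_O (E.serN_mem n))]
  exact gaussNorm_le fun m =>
    mul_le_one₀ ((E.isDist_serN n).bounded m) (by positivity) (pow_le_one₀ hr.le h1.le)

theorem le_normOL_unitE {r : ℝ} (hr : 0 < r) (h1 : r < 1) (n : ℕ) :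
    r ^ (p ^ n * E.deg) ≤ E.normOL r (E.unitE n : E.OL) := by
  rw [E.normOL_of_mem hr h1 _ (SP_le_O (E.serN_mem n))]
  have h := NB_gaussNorm hr h1 (SP_le_O (E.serN_mem n)) (p ^ n * E.deg)
  rwa [(E.isDist_serN n).top, map_one, one_mul] at h

theorem normOL_prod_unitE_le {r : ℝ} (hr : 0 < r) (h1 : r < 1) (n : ℕ) :
    E.normOL r ((∏ i ∈ Finset.range n, E.unitE i : (E.OL)ˣ) : E.OL) ≤ 1 := by
  rw [Units.coe_prod]
  change E.normHom hr h1 _ ≤ 1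
  rw [map_prod]
  exact Finset.prod_le_one (fun i _ => E.normOL_nonneg hr h1 _)
    fun i _ => E.normOL_unitE_le hr h1 i

/-- The norm of `E ⋯ φⁿ⁻¹(E)` at the radius of the zeros of `φⁿ(E)` is bounded below independently
of `n`: the sum of the degrees is at most `pⁿ e`. -/
theorem le_normOL_prod_unitE (n : ℕ) : (p : ℝ)⁻¹ ≤
    E.normOL (E.zeroRadius n) ((∏ i ∈ Finset.range n, E.unitE i : (E.OL)ˣ) : E.OL) := by
  have hr := E.zeroRadius_pos n
  have h1 := E.zeroRadius_lt_one n
  have h2 : (p : ℝ)⁻¹ ≤ ∏ i ∈ Finset.range n, E.zeroRadius n ^ (p ^ i * E.deg) := by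
    rw [Finset.prod_pow_eq_pow_sum, ← Finset.sum_mul, ← E.absPi_pow_deg,
      ← E.zeroRadius_pow_p_pow n, ← pow_mul]
    refine pow_le_pow_of_le_one hr.le h1.le (Nat.mul_le_mul_right _ ?_)
    exact (Nat.geomSum_lt hp.out.two_le fun i hi => Finset.mem_range.1 hi).le
  refine h2.trans ?_
  rw [Units.coe_prod]
  change _ ≤ E.normHom hr h1 _
  rw [map_prod]
  exact Finset.prod_le_prod (fun i _ => by positivity) fun i _ => E.le_normOL_unitE hr h1 i

theorem normOL_prod_unitE_zpow_le (n : ℕ) (s : ℤ) : E.normOL (E.zeroRadius n)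
    (((∏ i ∈ Finset.range n, E.unitE i) ^ s : (E.OL)ˣ) : E.OL) ≤ (p : ℝ) ^ s.natAbs := by
  have hr := E.zeroRadius_pos n
  have h1 := E.zeroRadius_lt_one n
  have hp1 : (1 : ℝ) ≤ p := by exact_mod_cast hp.out.one_lt.le
  have h2 := E.le_normOL_prod_unitE n
  have h3 := E.normOL_prod_unitE_le hr h1 n
  rw [E.normOL_units_zpow hr h1]
  have h0 := (inv_pos.2 (p_pos (p := p))).trans_le h2
  rcases Int.natAbs_eq s with hs | hs
  · rw [hs, Int.natAbs_natCast, zpow_natCast]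
    exact (pow_le_one₀ h0.le h3).trans (one_le_pow₀ hp1)
  · rw [hs, Int.natAbs_neg, Int.natAbs_natCast, zpow_neg, zpow_natCast, ← inv_pow]
    exact pow_le_pow_left₀ (inv_nonneg.2 h0.le) (inv_le_of_inv_le₀ p_pos h2) _

theorem normOL_sToOL_le {r : ℝ} (hr : 0 < r) (h1 : r < 1) (y : FrakS p k) :
    E.normOL r (E.sToOL y) ≤ 1 := by
  have hmem : sToA p k y ∈ SP p k := ⟨0, y, by rw [pow_zero, one_mul]⟩
  rw [E.normOL_of_mem hr h1 _ (SP_le_O hmem)]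
  refine gaussNorm_le fun m => mul_le_one₀ ?_ (by positivity) (pow_le_one₀ hr.le h1.le)
  change absK p k (PowerSeries.coeff m (PowerSeries.map _ y)) ≤ 1
  rw [PowerSeries.coeff_map]
  exact absK_int _

/-- An element of `𝒪` whose norms at the radii `|π_K| ^ (p⁻ⁿ)` are bounded has bounded
coefficients. -/
theorem mem_SP_of_normOL_le {x : E.OL} (hx : (x : RingA p k) ∈ RingO p k) {C : ℝ}
    (h : ∀ n, E.normOL (E.zeroRadius n) x ≤ C) : (x : RingA p k) ∈ SP p k := by
  refine mem_SP_iff.2 ⟨C, fun m => ?_⟩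
  have h2 := (E.tendsto_zeroRadius.pow m).const_mul (absK p k (PowerSeries.coeff m (x : RingA p k)))
  rw [one_pow, mul_one] at h2
  refine le_of_tendsto' h2 fun n => ?_
  have h3 := h n
  rw [E.normOL_of_mem (E.zeroRadius_pos n) (E.zeroRadius_lt_one n) x hx] at h3
  exact (NB_gaussNorm (E.zeroRadius_pos n) (E.zeroRadius_lt_one n) hx m).trans h3

/-- Elements of `𝔖[1/p]` have bounded norms for all radii. -/
theorem exists_normOL_spToOL_le (x : SP p k) :
    ∃ C : ℝ, 0 ≤ C ∧ ∀ r, 0 < r → r < 1 → E.normOL r (E.spToOL x) ≤ C := by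
  obtain ⟨C, hC⟩ := mem_SP_iff.1 x.2
  have hC0 : 0 ≤ C := le_trans ((absK p k).nonneg _) (hC 0)
  refine ⟨C, hC0, fun r hr h1 => ?_⟩
  have hx : ((E.spToOL x : E.OL) : RingA p k) ∈ RingO p k := SP_le_O x.2
  rw [E.normOL_of_mem hr h1 _ hx]
  exact gaussNorm_le fun m => (mul_le_mul_of_nonneg_right (hC m) (by positivity)).trans
    (mul_le_of_le_one_right hC0 (pow_le_one₀ hr.le h1.le))

end EisensteinPoly

end Radii

/-! ### Integrality at the zeros of `λ` -/

section Integrality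

set_option linter.unusedSectionVars false

variable {p : ℕ} [hp : Fact p.Prime] {k : Type u} [Field k] [CharP k p] [PerfectRing k p]

theorem Bd_mono {r s : ℝ} (hr : 0 < r) (hs : 0 < s) (h : r ≤ s) {x : RingA p k}
    (hx : x ∈ Bd s hs) : x ∈ Bd r hr := by
  obtain ⟨C, hC⟩ := hx
  exact ⟨C, fun n => (mul_le_mul_of_nonneg_left (pow_le_pow_left₀ hr.le h n)
    ((absK p k).nonneg _)).trans (hC n)⟩

theorem phi_mem_Bd {r s : ℝ} (hr : 0 < r) (hs : 0 < s) (h : s ^ p = r) {x : RingA p k}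
    (hx : x ∈ Bd r hr) : phi p k x ∈ Bd s hs := by
  obtain ⟨C, hC⟩ := hx
  refine ⟨C, fun n => ?_⟩
  rw [coeff_phi]
  split_ifs with hd
  · obtain ⟨m, rfl⟩ := hd
    rw [absK_phi0, Nat.mul_div_cancel_left _ hp.out.pos, pow_mul, h]; exact hC _
  · rw [map_zero, zero_mul]; exact hC.nonneg

namespace EisensteinPoly

variable (E : EisensteinPoly p k)

theorem radius_eq (n : ℕ) : E.radius n = E.zeroRadius (n + 1) := by
  refine (pow_left_inj₀ (E.radius_pos n).le (E.zeroRadius_pos _).le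
    (E.exponent_pos (n + 1)).ne').1 ?_
  rw [E.radius_pow, pow_mul, E.zeroRadius_pow_p_pow, E.absPi_pow_deg]

theorem isDist_serSP (n : ℕ) : IsDist (E.serSP n : RingA p k) (p ^ n * E.deg) := E.isDist_serN n

theorem evalA_oToShat (n m : ℕ) (x : RingO p k)
    (hx : (x : RingA p k) ∈ Bd (E.radius n) (E.radius_pos n)) :
    AdicCompletion.evalₐ (Ideal.span {E.serSP n}) m (E.oToShat n x) =
      bdToQuot (E.isDist_serSP n) (E.radius_pos n) (E.radius_lt_one n) (E.lt_radius_pow n) m ⟨x, hx⟩ :=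
  AdicCompletion.evalₐ_liftRingHom _ _ (factorPow_bdToQuot (E.isDist_serSP n) (E.radius_pos n)
    (E.radius_lt_one n) (E.lt_radius_pow n)) _ _

/-- The components of `𝒪 → Ŝₙ`. -/
theorem evalA_oToShat_eq (n m : ℕ) (x : RingO p k) (s : SP p k) (q : RingA p k)
    (hq : q ∈ Bd (E.radius n) (E.radius_pos n))
    (h : (x : RingA p k) = s + E.serN n ^ m * q) :
    AdicCompletion.evalₐ (Ideal.span {E.serSP n}) m (E.oToShat n x) =
      Ideal.Quotient.mk _ s := by
  rw [E.evalA_oToShat n m x (O_le_Bd (E.radius_pos n) (E.radius_lt_one n) x.2)]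
  refine (quotHom_bijective (E.isDist_serSP n) (E.radius_pos n) (E.radius_lt_one n)
    (E.lt_radius_pow n) m).1 ?_
  rw [quotHom_bdToQuot, quotHom, Ideal.quotientMap_mk, Ideal.Quotient.mk_eq_mk_iff_sub_mem,
    Ideal.span_singleton_pow, Ideal.mem_span_singleton]
  refine ⟨⟨q, hq⟩, Subtype.ext ?_⟩
  change (x : RingA p k) - s = E.serN n ^ m * q
  rw [h]; ring

/-- Division with remainder by a power of a distinguished polynomial. -/
theorem exists_div_pow (n m : ℕ) {r : ℝ} (hr : 0 < r) (h1 : r < 1)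
    (hd : (p : ℝ)⁻¹ < r ^ (p ^ n * E.deg)) {x : RingA p k} (hx : x ∈ Bd r hr) :
    ∃ (s : SP p k), ∃ q ∈ Bd (p := p) (k := k) r hr, x = s + E.serN n ^ m * q := by
  obtain ⟨a, ha⟩ := (quotHom_bijective (E.isDist_serSP n) hr h1 hd m).2
    (Ideal.Quotient.mk _ ⟨x, hx⟩)
  obtain ⟨s, rfl⟩ := Ideal.Quotient.mk_surjective a
  rw [quotHom, Ideal.quotientMap_mk, eq_comm, Ideal.Quotient.mk_eq_mk_iff_sub_mem,
    Ideal.span_singleton_pow, Ideal.mem_span_singleton] at ha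
  obtain ⟨q, hq⟩ := ha
  refine ⟨s, q, q.2, ?_⟩
  have hq' : x - s = E.serN n ^ m * q := congrArg Subtype.val hq
  rw [← hq']; ring

theorem dvd_of_quot_eq (n m : ℕ) {r : ℝ} (hr : 0 < r) (h1 : r < 1)
    (hd : (p : ℝ)⁻¹ < r ^ (p ^ n * E.deg)) {s : SP p k} {q : RingA p k} (hq : q ∈ Bd r hr)
    (h : (s : RingA p k) = E.serN n ^ m * q) :
    ∃ t : SP p k, (s : RingA p k) = E.serN n ^ m * t := by
  have h2 := (quotHom_bijective (E.isDist_serSP n) hr h1 hd m).1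
    (a₁ := Ideal.Quotient.mk _ s) (a₂ := 0) (by
      rw [map_zero, quotHom, Ideal.quotientMap_mk, Ideal.Quotient.eq_zero_iff_mem,
        Ideal.span_singleton_pow, Ideal.mem_span_singleton]
      exact ⟨⟨q, hq⟩, Subtype.ext h⟩)
  rw [Ideal.Quotient.eq_zero_iff_mem, Ideal.span_singleton_pow, Ideal.mem_span_singleton] at h2
  obtain ⟨t, ht⟩ := h2
  exact ⟨t, congrArg Subtype.val ht⟩

/-- The kernel of `𝒪 → 𝔖[1/p] / φⁿ(E)ᵐ` consists of the multiples of `φⁿ(E)ᵐ`. -/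
theorem exists_of_evalA_eq_zero (n m : ℕ) (x : RingO p k)
    (h : AdicCompletion.evalₐ (Ideal.span {E.serSP n}) m (E.oToShat n x) = 0) :
    ∃ q ∈ Bd (p := p) (k := k) (E.radius n) (E.radius_pos n),
      (x : RingA p k) = E.serN n ^ m * q := by
  have hx := O_le_Bd (E.radius_pos n) (E.radius_lt_one n) x.2
  obtain ⟨s, q, hq, hs⟩ := E.exists_div_pow n m (E.radius_pos n) (E.radius_lt_one n)
    (E.lt_radius_pow n) hx
  rw [E.evalA_oToShat_eq n m x s q hq hs, Ideal.Quotient.eq_zero_iff_mem,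
    Ideal.span_singleton_pow, Ideal.mem_span_singleton] at h
  obtain ⟨t, rfl⟩ := h
  refine ⟨t + q, add_mem (SP_le_Bd (E.radius_pos n) (E.radius_lt_one n) t.2) hq, ?_⟩
  rw [hs, mul_add]
  rfl

theorem serN_pow_ne_zero (n m : ℕ) : E.serN n ^ m ≠ 0 :=
  pow_ne_zero _ (IsDist.ne_zero (E.isDist_serN n))

theorem phi_iterate_lam_eq (n : ℕ) : (phi p k)^[n] E.lam =
    PowerSeries.C (PowerSeries.constantCoeff (E.serN n))⁻¹ * E.serN n *
      (phi p k)^[n + 1] E.lam := by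
  induction n with
  | zero => exact E.lam_eq
  | succ n ih =>
    rw [Function.iterate_succ_apply', ih, map_mul, map_mul, phi_C, map_inv₀, ← constantCoeff_phi,
      ← Function.iterate_succ_apply' (phi p k) (n + 1)]
    simp only [serN, Function.iterate_succ_apply']

/-- `λ` is a constant times `E ⋯ φⁿ(E)` times `φⁿ⁺¹(λ)`. -/
theorem exists_lam_eq (n : ℕ) : ∃ c : K0 p k, c ≠ 0 ∧ E.lam = PowerSeries.C c *
    (∏ i ∈ Finset.range n, E.serN i) * (phi p k)^[n] E.lam := by
  induction n with
  | zero => exact ⟨1, one_ne_zero, by simp⟩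
  | succ n ih =>
    obtain ⟨c, hc, h⟩ := ih
    refine ⟨c * (PowerSeries.constantCoeff (E.serN n))⁻¹,
      mul_ne_zero hc (inv_ne_zero (E.constantCoeff_serN_ne n)), ?_⟩
    rw [Finset.prod_range_succ, map_mul]
    conv_lhs => rw [h, E.phi_iterate_lam_eq n]
    ring

theorem phi_iterate_lam_mem (n : ℕ) : (phi p k)^[n] E.lam ∈ RingO p k := by
  induction n with
  | zero => exact E.lam_mem
  | succ n ih => rw [Function.iterate_succ_apply']; exact phi_mem_O ih

theorem constantCoeff_phi_iterate_lam (n : ℕ) :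
    PowerSeries.constantCoeff ((phi p k)^[n] E.lam) = 1 := by
  induction n with
  | zero => exact E.constantCoeff_lam
  | succ n ih => rw [Function.iterate_succ_apply', constantCoeff_phi, ih, map_one]

theorem radius_mono : Monotone E.radius := by
  refine monotone_nat_of_le_succ fun n => ?_
  rw [radius_eq, radius_eq, ← E.zeroRadius_succ_pow (n + 1)]
  exact pow_le_of_le_one (E.zeroRadius_pos _).le (E.zeroRadius_lt_one _).le hp.out.ne_zero

theorem lt_radius_pow_of_le {i n : ℕ} (hin : i ≤ n) :
    (p : ℝ)⁻¹ < E.radius n ^ (p ^ i * E.deg) :=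
  (E.lt_radius_pow i).trans_le (pow_le_pow_left₀ (E.radius_pos i).le (E.radius_mono hin) _)

theorem mem_O_of_forall_mem_Bd {x : RingA p k}
    (h : ∀ n, x ∈ Bd (p := p) (k := k) (E.radius n) (E.radius_pos n)) : x ∈ RingO p k := by
  intro r hr h1
  have h2 : Filter.Tendsto E.radius Filter.atTop (nhds 1) := by
    have := E.tendsto_zeroRadius.comp (Filter.tendsto_add_atTop_nat 1)
    refine this.congr fun n => (E.radius_eq n).symm
  obtain ⟨n, hn⟩ := (h2.eventually (lt_mem_nhds h1)).exists
  exact Bd_mono hr (E.radius_pos n) hn.le (h n)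

/-- A series in `𝒪` that is divisible by `φⁱ(E)ᴺ` in `Ŝᵢ` is so on the larger discs. -/
theorem exists_of_evalA_eq_zero_of_le {i n : ℕ} (hin : i ≤ n) (m : ℕ) (x : RingO p k)
    (h : AdicCompletion.evalₐ (Ideal.span {E.serSP i}) m (E.oToShat i x) = 0) :
    ∃ q ∈ Bd (p := p) (k := k) (E.radius n) (E.radius_pos n),
      (x : RingA p k) = E.serN i ^ m * q := by
  obtain ⟨q, hq, hxq⟩ := E.exists_of_evalA_eq_zero i m x h
  obtain ⟨s, q', hq', hs⟩ := E.exists_div_pow i m (E.radius_pos n) (E.radius_lt_one n)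
    (E.lt_radius_pow_of_le hin) (O_le_Bd (E.radius_pos n) (E.radius_lt_one n) x.2)
  obtain ⟨t, ht⟩ := E.dvd_of_quot_eq i m (E.radius_pos i) (E.radius_lt_one i) (E.lt_radius_pow i)
    (sub_mem hq (Bd_mono (E.radius_pos i) (E.radius_pos n) (E.radius_mono hin) hq'))
    (s := s) (by rw [mul_sub, ← hxq, hs]; ring)
  refine ⟨t + q', add_mem (SP_le_Bd (E.radius_pos n) (E.radius_lt_one n) t.2) hq', ?_⟩
  rw [hs, ht]; ring

/-- A series in `𝒪` that is divisible by `φⁱ(E)ᴺ` in `Ŝᵢ` for all `i` is divisible by `λᴺ`: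
on each disc of radius less than one, `λ` is a unit times a product of finitely many of the
pairwise coprime `φⁱ(E)`. -/
theorem mem_O_of_evalA_eq_zero (x : RingA p k) (N : ℕ) (hx : E.lam ^ N * x ∈ RingO p k)
    (h : ∀ n, AdicCompletion.evalₐ (Ideal.span {E.serSP n}) N (E.oToShat n ⟨_, hx⟩) = 0) :
    x ∈ RingO p k := by
  refine E.mem_O_of_forall_mem_Bd fun n => ?_
  let f := spToBd (p := p) (k := k) (E.radius_pos n) (E.radius_lt_one n)
  have hdvd : ∏ i ∈ Finset.range (n + 1), f (E.serSP i) ^ N ∣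
      (⟨_, O_le_Bd (E.radius_pos n) (E.radius_lt_one n) hx⟩ :
        Bd (p := p) (k := k) (E.radius n) (E.radius_pos n)) := by
    refine Finset.prod_dvd_of_coprime (fun i _ j _ hij => ?_) fun i hi => ?_
    · refine IsCoprime.pow ?_
      rcases lt_or_gt_of_ne hij with h2 | h2
      · exact (E.serSP_isCoprime h2).map f
      · exact ((E.serSP_isCoprime h2).map f).symm
    · obtain ⟨q, hq, hxq⟩ := E.exists_of_evalA_eq_zero_of_le
        (Nat.lt_succ_iff.1 (Finset.mem_range.1 hi)) N ⟨_, hx⟩ (h i)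
      exact ⟨⟨q, hq⟩, Subtype.ext hxq⟩
  obtain ⟨q, hq⟩ := hdvd
  have hq' : E.lam ^ N * x = (∏ i ∈ Finset.range (n + 1), E.serN i) ^ N * q := by
    have h2 : E.lam ^ N * x = ((∏ i ∈ Finset.range (n + 1), f (E.serSP i) ^ N :
        Bd (p := p) (k := k) (E.radius n) (E.radius_pos n)) : RingA p k) * q :=
      congrArg Subtype.val hq
    rw [h2, Finset.prod_pow, SubmonoidClass.coe_pow, SubmonoidClass.coe_finsetProd]
    rfl
  obtain ⟨c, hc, hlam⟩ := E.exists_lam_eq (n + 1)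
  have hprod : (∏ i ∈ Finset.range (n + 1), E.serN i) ^ N ≠ 0 :=
    pow_ne_zero _ (Finset.prod_ne_zero_iff.2 fun i _ => IsDist.ne_zero (E.isDist_serN i))
  set μ := (phi p k)^[n + 1] E.lam with hμ
  have hμ0 : PowerSeries.constantCoeff μ ≠ 0 := by
    rw [hμ, E.constantCoeff_phi_iterate_lam]; exact one_ne_zero
  have hinv : μ⁻¹ ∈ Bd (p := p) (k := k) (E.radius n) (E.radius_pos n) :=
    ⟨1, (E.NB_phi_iter_lam n).inv (E.radius_pos n) (by
      rw [← hμ, hμ, E.constantCoeff_phi_iterate_lam, map_one])⟩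
  have hcc : PowerSeries.C c⁻¹ * PowerSeries.C c = (1 : RingA p k) := by
    rw [← map_mul, inv_mul_cancel₀ hc, map_one]
  have hμμ : μ⁻¹ * μ = 1 := PowerSeries.inv_mul_cancel _ hμ0
  have hxq : x = PowerSeries.C c⁻¹ ^ N * μ⁻¹ ^ N * q := by
    have h3 : (PowerSeries.C c * μ) ^ N * x = q := by
      refine mul_left_cancel₀ hprod ?_
      rw [← hq', hlam]; ring
    rw [← h3, ← mul_assoc, ← mul_pow, ← mul_pow]
    have h4 : PowerSeries.C c⁻¹ * μ⁻¹ * (PowerSeries.C c * μ) = 1 := by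
      linear_combination (μ⁻¹ * μ) * hcc + hμμ
    rw [h4, one_pow, one_mul]
  rw [hxq]
  exact mul_mem (mul_mem (pow_mem (C_mem _ _) _) (pow_mem hinv _)) q.2

/-- An element of `𝒪[1/λ]` that is integral at the zeros of all `φⁿ(E)` lies in `𝒪`. -/
theorem mem_O_of_forall_mem_range (x : E.OL)
    (h : ∀ n, E.olToLhat n x ∈ (algebraMap (E.Shat n) (E.Lhat n)).range) :
    (x : RingA p k) ∈ RingO p k := by
  obtain ⟨N, hN⟩ := x.2
  refine E.mem_O_of_evalA_eq_zero x N hN fun n => ?_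
  obtain ⟨z, hz⟩ := h n
  set e := E.spToShat n (E.serSP n)
  -- the image of `λ` in `Ŝₙ` is divisible by `φⁿ(E)`
  obtain ⟨w, hw⟩ : ∃ w, E.oToShat n ⟨_, E.lam_mem⟩ = e * w := by
    obtain ⟨c, -, hlam⟩ := E.exists_lam_eq (n + 1)
    have hmem : PowerSeries.C c * (∏ i ∈ Finset.range n, E.serN i) *
        (phi p k)^[n + 1] E.lam ∈ RingO p k :=
      mul_mem (mul_mem (C_mem _ _) (prod_mem fun i _ => SP_le_O (E.serN_mem i)))
        (E.phi_iterate_lam_mem _)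
    refine ⟨E.oToShat n ⟨_, hmem⟩, ?_⟩
    have he : e = E.oToShat n ⟨_, SP_le_O (E.serSP n).2⟩ := (E.oToShat_SP n _).symm
    rw [he, ← map_mul]
    refine congrArg (E.oToShat n) (Subtype.ext ?_)
    change E.lam = E.serN n * _
    conv_lhs => rw [hlam, Finset.prod_range_succ]
    ring
  have h1 : algebraMap (E.Shat n) (E.Lhat n) (E.oToShat n ⟨_, hN⟩) =
      algebraMap (E.Shat n) (E.Lhat n) (e ^ N * (w ^ N * z)) := by
    rw [← E.olToLhat_O]
    have h2 : (⟨_, E.O_le_OL hN⟩ : E.OL) = ⟨_, E.O_le_OL E.lam_mem⟩ ^ N * x := Subtype.ext rfl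
    have h3 := E.olToLhat_O n ⟨_, E.lam_mem⟩
    rw [h2, map_mul, map_pow, h3, hw, ← hz, ← map_pow, ← map_mul]
    ring_nf
  obtain ⟨⟨_, j, rfl⟩, hj⟩ := (IsLocalization.eq_iff_exists (Submonoid.powers e) (E.Lhat n)).1 h1
  -- so `φⁿ(E)ʲ λᴺ x` is divisible by `φⁿ(E)ʲ⁺ᴺ`
  have hmem : E.serN n ^ j * (E.lam ^ N * (x : RingA p k)) ∈ RingO p k :=
    mul_mem (pow_mem (SP_le_O (E.serN_mem n)) j) hN
  have h4 : E.oToShat n ⟨_, hmem⟩ = e ^ (j + N) * (w ^ N * z) := by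
    have h5 : (⟨_, hmem⟩ : RingO p k) = ⟨_, SP_le_O (E.serN_mem n)⟩ ^ j * ⟨_, hN⟩ :=
      Subtype.ext rfl
    have h6 := E.oToShat_SP n (E.serSP n)
    rw [h5, map_mul, map_pow, pow_add, mul_assoc, ← hj]
    exact congrArg (fun y => y ^ j * E.oToShat n ⟨_, hN⟩) h6
  obtain ⟨q, hq, hxq⟩ := E.exists_of_evalA_eq_zero n (j + N) ⟨_, hmem⟩ (by
    rw [h4, map_mul, map_pow]
    have h7 : AdicCompletion.evalₐ (Ideal.span {E.serSP n}) (j + N) e =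
        Ideal.Quotient.mk _ (E.serSP n) := (AdicCompletion.evalₐ _ _).commutes _
    rw [h7, ← map_pow, Ideal.Quotient.eq_zero_iff_mem.2, zero_mul]
    exact Ideal.pow_mem_pow (Ideal.mem_span_singleton_self _) _)
  have h8 : E.lam ^ N * (x : RingA p k) = ((0 : SP p k) : RingA p k) + E.serN n ^ N * q := by
    refine mul_left_cancel₀ (E.serN_pow_ne_zero n j) ?_
    refine hxq.trans ?_
    rw [pow_add, ZeroMemClass.coe_zero]; ring
  rw [E.evalA_oToShat_eq n N ⟨_, hN⟩ 0 q hq h8, map_zero]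

/-- The maps `𝒪 → Ŝ` and `𝒪 → Ŝₙ` are compatible with `φⁿ`: if `x - s` is divisible by `Eᵐ` for the radius `|π_K| ^ (1/p)`, then `φⁿ(x) - φⁿ(s)` is
divisible by `φⁿ(E)ᵐ` for the radius `|π_K| ^ (p⁻ⁿ⁻¹)`. -/
theorem phiShat_oToShat (n : ℕ) (x : RingO p k) (hx : (phi p k)^[n] (x : RingA p k) ∈ RingO p k) :
    E.phiShat n (E.oToShat 0 x) = E.oToShat n ⟨_, hx⟩ := by
  refine AdicCompletion.ext_evalₐ fun m => ?_
  obtain ⟨s, q, hq, hs⟩ := E.exists_div_pow 0 m (E.radius_pos 0) (E.radius_lt_one 0)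
    (E.lt_radius_pow 0) (O_le_Bd (E.radius_pos 0) (E.radius_lt_one 0) x.2)
  have hqn : ∀ n, (phi p k)^[n] q ∈ Bd (p := p) (k := k) (E.radius n) (E.radius_pos n) := by
    intro n
    induction n with
    | zero => exact hq
    | succ n ih =>
      rw [Function.iterate_succ_apply']
      exact phi_mem_Bd (E.radius_pos n) _ (by rw [radius_eq, radius_eq, zeroRadius_succ_pow]) ih
  have hxn : (phi p k)^[n] (x : RingA p k) =
      ((phiSP p k ^ n : SP p k →+* SP p k) s : SP p k) + E.serN n ^ m * (phi p k)^[n] q := by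
    rw [hs, iterate_map_add, iterate_map_mul, iterate_map_pow, phiSP_iterate_coe]
    rfl
  rw [E.evalA_oToShat_eq n m ⟨_, hx⟩ _ _ (hqn n) hxn]
  have h1 : AdicCompletion.evalₐ (Ideal.span {E.serSP n}) m (E.phiShat n (E.oToShat 0 x)) =
      complComp (phiSP p k ^ n : SP p k →+* SP p k) (E.phiSP_iterate_serSP n) m
        (E.oToShat 0 x) :=
    AdicCompletion.evalₐ_liftRingHom (Ideal.span {E.serSP n}) _ (complMap_aux _ _) m _
  have h2 : complComp (phiSP p k ^ n : SP p k →+* SP p k) (E.phiSP_iterate_serSP n) m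
      (E.oToShat 0 x) = Ideal.quotientMap _ _ (quotPhi_le _ (E.phiSP_iterate_serSP n) m)
        (AdicCompletion.evalₐ (Ideal.span {E.serSP 0}) m (E.oToShat 0 x)) := rfl
  rw [h1, h2, E.evalA_oToShat_eq 0 m x s q hq hs, Ideal.quotientMap_mk]

theorem coe_phiOL_pow (n : ℕ) (x : E.OL) :
    (((E.phiOL ^ n : E.OL →+* E.OL) x : E.OL) : RingA p k) = (phi p k)^[n] (x : RingA p k) := by
  induction n with
  | zero => rfl
  | succ n ih =>
    rw [pow_succ', Function.iterate_succ_apply', ← ih]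
    rfl

theorem phi_iterate_mem_O (n : ℕ) {x : RingA p k} (hx : x ∈ RingO p k) :
    (phi p k)^[n] x ∈ RingO p k := by
  induction n with
  | zero => exact hx
  | succ n ih => rw [Function.iterate_succ_apply']; exact phi_mem_O ih

theorem phiLhat_olToLhat (n : ℕ) :
    (E.phiLhat n).comp (E.olToLhat 0) = (E.olToLhat n).comp (E.phiOL ^ n) := by
  have hO : ∀ x : RingO p k, E.phiLhat n (E.olToLhat 0 ⟨x, E.O_le_OL x.2⟩) =
      E.olToLhat n ((E.phiOL ^ n : E.OL →+* E.OL) ⟨x, E.O_le_OL x.2⟩) := by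
    intro x
    have hx := phi_iterate_mem_O n x.2
    have h1 : (E.phiOL ^ n : E.OL →+* E.OL) ⟨x, E.O_le_OL x.2⟩ = ⟨_, E.O_le_OL hx⟩ :=
      Subtype.ext (E.coe_phiOL_pow n _)
    rw [h1]
    refine Eq.trans ?_ (E.olToLhat_O n ⟨_, hx⟩).symm
    rw [← E.phiShat_oToShat n x hx, E.olToLhat_O]
    exact locMap_algebraMap (E.Lhat 0) (E.Lhat n) (E.phiShat n) (E.phiShat_serSP n) _
  refine RingHom.ext fun x => ?_
  obtain ⟨N, hN⟩ := x.2
  have hl := hO ⟨_, E.lam_mem⟩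
  have hx := hO ⟨_, hN⟩
  have h2 : (⟨_, E.O_le_OL hN⟩ : E.OL) = ⟨_, E.O_le_OL E.lam_mem⟩ ^ N * x := Subtype.ext rfl
  rw [h2] at hx
  simp only [map_mul, map_pow] at hx
  rw [← hl] at hx
  refine ((IsUnit.map (E.phiLhat n) ?_).pow N).mul_left_cancel hx
  rw [E.olToLhat_O 0 ⟨_, E.lam_mem⟩]
  exact E.lam_isUnit_Lhat 0

end EisensteinPoly

end Integrality

/-! ### Consequences of the amplitude condition -/

section Amplitude

set_option linter.unusedSectionVars false

variable {p : ℕ} [hp : Fact p.Prime] {k : Type u} [Field k] [CharP k p] [PerfectRing k p]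

namespace EisensteinPoly

variable (E : EisensteinPoly p k)

/-- The image of `E ⋯ φⁿ⁻¹(E)` in `Ŝₙ[1/φⁿ(E)]` is a unit of `Ŝₙ`. -/
theorem exists_units_map_eq (n : ℕ) : ∃ v : (E.Shat n)ˣ,
    Units.map (algebraMap (E.Shat n) (E.Lhat n)).toMonoidHom v =
      Units.map (E.olToLhat n).toMonoidHom (∏ i ∈ Finset.range n, E.unitE i) := by
  suffices h : ∀ m ≤ n, ∃ v : (E.Shat n)ˣ,
      Units.map (algebraMap (E.Shat n) (E.Lhat n)).toMonoidHom v =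
        Units.map (E.olToLhat n).toMonoidHom (∏ i ∈ Finset.range m, E.unitE i) from h n le_rfl
  intro m
  induction m with
  | zero => exact fun _ => ⟨1, by simp⟩
  | succ m ih =>
    intro hm
    obtain ⟨v, hv⟩ := ih (by omega)
    obtain ⟨w, hw⟩ := E.serSP_isUnit_Shat (Nat.lt_of_succ_le hm)
    refine ⟨v * w, ?_⟩
    rw [Finset.prod_range_succ, map_mul, map_mul, hv]
    congr 1
    refine Units.ext ?_
    change algebraMap (E.Shat n) (E.Lhat n) w = E.olToLhat n (E.spToOL (E.serSP m))
    rw [hw]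
    exact (RingHom.congr_fun (E.olToLhat_spToOL n) _).symm

theorem olToLhat_prod_unitE_zpow_mem (n : ℕ) (s : ℤ) :
    E.olToLhat n (((∏ i ∈ Finset.range n, E.unitE i) ^ s : (E.OL)ˣ) : E.OL) ∈
      (algebraMap (E.Shat n) (E.Lhat n)).range := by
  obtain ⟨v, hv⟩ := E.exists_units_map_eq n
  refine ⟨((v ^ s : (E.Shat n)ˣ) : E.Shat n), ?_⟩
  have h := congrArg (· ^ s) hv
  simp only [← map_zpow] at h
  exact congrArg Units.val h

theorem olToLhat_spToOL_mem (n : ℕ) (x : SP p k) :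
    E.olToLhat n (E.spToOL x) ∈ (algebraMap (E.Shat n) (E.Lhat n)).range :=
  ⟨E.spToShat n x, (RingHom.congr_fun (E.olToLhat_spToOL n) x).symm⟩

variable {R : Type*} [CommRing R] {M : Type*} [AddCommGroup M] [Module R M]

/-- A vector `z` such that `pᶜ z` lies in `(E ⋯ φⁿ⁻¹(E))ˢ` times an `𝔖`-lattice has coordinates
that are integral in `Ŝₙ` and bounded, uniformly in `n`, at the radius of the zeros of `φⁿ(E)`. -/
theorem exists_coeff_of_smul_eq {σ : R →+* E.OL} {ι : Type*} [Fintype ι] (v : ι → BC σ M)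
    (n C : ℕ) (s : ℤ) (z : BC σ M)
    (h : ∃ y ∈ Submodule.span (FrakS p k) (Set.range v), (p : E.OL) ^ C • z =
      (((∏ i ∈ Finset.range n, E.unitE i) ^ s : (E.OL)ˣ) : E.OL) • y) :
    ∃ G : ι → E.OL, z = ∑ i, G i • v i ∧ ∀ i,
      E.normOL (E.zeroRadius n) (G i) ≤ (p : ℝ) ^ C * (p : ℝ) ^ s.natAbs ∧
      E.olToLhat n (G i) ∈ (algebraMap (E.Shat n) (E.Lhat n)).range := by
  obtain ⟨y, hy, hz⟩ := h
  obtain ⟨c, rfl⟩ := (Submodule.mem_span_range_iff_exists_fun _).1 hy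
  set e : E.OL := (((∏ i ∈ Finset.range n, E.unitE i) ^ s : (E.OL)ˣ) : E.OL)
  set a : E.OL := E.kToOL (((p : K0 p k)⁻¹) ^ C) with ha
  have hap : a * (p : E.OL) ^ C = 1 := by
    have : (p : E.OL) ^ C = E.kToOL ((p : K0 p k) ^ C) := by rw [map_pow, map_natCast]
    rw [ha, this, ← map_mul, ← mul_pow, inv_mul_cancel₀ p_ne_zero, one_pow, map_one]
  refine ⟨fun i => a * e * E.sToOL (c i), ?_, fun i => ⟨?_, ?_⟩⟩
  · have h2 := congrArg (a • ·) hz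
    simp only [smul_smul, hap, one_smul] at h2
    rw [h2, Finset.smul_sum]
    exact Finset.sum_congr rfl fun i _ => (mul_smul (a * e) (E.sToOL (c i)) (v i)).symm
  · have hr := E.zeroRadius_pos n
    have h1 := E.zeroRadius_lt_one n
    rw [E.normOL_mul hr h1, E.normOL_mul hr h1, E.normOL_kToOL hr h1, map_pow, map_inv₀, absK_p,
      inv_inv]
    have h2 : (p : ℝ) ^ C * E.normOL (E.zeroRadius n) e ≤ (p : ℝ) ^ C * (p : ℝ) ^ s.natAbs :=
      mul_le_mul_of_nonneg_left (E.normOL_prod_unitE_zpow_le n s) (pow_nonneg p_pos.le C)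
    have h3 : 0 ≤ (p : ℝ) ^ C * E.normOL (E.zeroRadius n) e :=
      mul_nonneg (pow_nonneg p_pos.le C) (E.normOL_nonneg hr h1 e)
    exact (mul_le_of_le_one_right h3 (E.normOL_sToOL_le hr h1 _)).trans h2
  · rw [map_mul, map_mul]
    exact mul_mem (mul_mem (E.olToLhat_spToOL_mem n (kToSP p k _))
      (E.olToLhat_prod_unitE_zpow_mem n s))
      (E.olToLhat_spToOL_mem n ⟨sToA p k (c i), 0, c i, by rw [pow_zero, one_mul]⟩)

end EisensteinPoly

namespace PhiModSP

variable {E : EisensteinPoly p k} {N : PhiModSP E}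

/-- The matrices of the maps `Φₙ` and of their inverses in a suitable basis are integral in `Ŝₙ`,
and their norms at the radius of the zeros of `φⁿ(E)` are bounded independently of `n`. -/
theorem HasAmplitude.exists_matrices {s t : ℤ} (h : N.HasAmplitude s t) :
    ∃ (r : ℕ) (b : Module.Basis (Fin r) (SP p k) N) (M : ℝ), 0 ≤ M ∧ ∀ n : ℕ,
      (∃ G : Fin r → Fin r → E.OL,
        (∀ j, N.frobOL^[n] (BC.incl E.spToOL N (b j)) =
          ∑ i, G j i • BC.incl E.spToOL N (b i)) ∧
        ∀ j i, E.normOL (E.zeroRadius n) (G j i) ≤ M ∧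
          E.olToLhat n (G j i) ∈ (algebraMap (E.Shat n) (E.Lhat n)).range) ∧
      (∃ H : Fin r → Fin r → E.OL,
        (∀ j, BC.incl E.spToOL N (b j) =
          ∑ i, H j i • N.frobOL^[n] (BC.incl E.spToOL N (b i))) ∧
        ∀ j i, E.normOL (E.zeroRadius n) (H j i) ≤ M ∧
          E.olToLhat n (H j i) ∈ (algebraMap (E.Shat n) (E.Lhat n)).range) := by
  obtain ⟨r, b, C, hb⟩ := h
  -- the conditions hold for `n = 0` as well, as `Φ₀ = 1`
  have hb' : ∀ n : ℕ,
      (∀ j, ∃ y ∈ Submodule.span (FrakS p k) (Set.range fun i => BC.incl E.spToOL N (b i)),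
        (p : E.OL) ^ C • N.frobOL^[n] (BC.incl _ _ (b j)) =
          (((∏ i ∈ Finset.range n, E.unitE i) ^ s : (E.OL)ˣ) : E.OL) • y) ∧
      (∀ j, ∃ y ∈ Submodule.span (FrakS p k)
          (Set.range fun i => N.frobOL^[n] (BC.incl E.spToOL N (b i))),
        (p : E.OL) ^ C • BC.incl _ _ (b j) =
          (((∏ i ∈ Finset.range n, E.unitE i) ^ (-t) : (E.OL)ˣ) : E.OL) • y) := by
    intro n
    rcases Nat.eq_zero_or_pos n with rfl | hn
    · have h0 : ∀ j, ∃ y ∈ Submodule.span (FrakS p k)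
          (Set.range fun i => BC.incl E.spToOL N (b i)),
          (p : E.OL) ^ C • BC.incl E.spToOL N (b j) = y := fun j => by
        refine ⟨_, Submodule.smul_mem _ ((p : FrakS p k) ^ C) (Submodule.subset_span ⟨j, rfl⟩), ?_⟩
        change _ = E.sToOL ((p : FrakS p k) ^ C) • BC.incl E.spToOL N (b j)
        rw [map_pow, map_natCast]
      simp only [Finset.range_zero, Finset.prod_empty, one_zpow, Units.val_one, one_smul,
        Function.iterate_zero, id]
      exact ⟨h0, h0⟩
    · exact hb n hn
  have hp1 : (1 : ℝ) ≤ p := by exact_mod_cast hp.out.one_lt.le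
  have hp0 := p_pos (p := p)
  refine ⟨r, b, max ((p : ℝ) ^ C * (p : ℝ) ^ s.natAbs) ((p : ℝ) ^ C * (p : ℝ) ^ (-t).natAbs),
    by positivity, fun n => ⟨?_, ?_⟩⟩
  · choose G hG hG' using fun j => E.exists_coeff_of_smul_eq _ n C s _ ((hb' n).1 j)
    exact ⟨G, hG, fun j i => ⟨(hG' j i).1.trans (le_max_left _ _), (hG' j i).2⟩⟩
  · choose G hG hG' using fun j => E.exists_coeff_of_smul_eq _ n C (-t) _ ((hb' n).2 j)
    exact ⟨G, hG, fun j i => ⟨(hG' j i).1.trans (le_max_right _ _), (hG' j i).2⟩⟩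

theorem siter_frobOL_apply (n : ℕ) (x : BC E.spToOL N) :
    BC.siter N.frobOL n x = N.frobOL^[n] x := rfl

theorem xi_frobD_iterate (n : ℕ) (d : N.D) :
    N.xi (BC.incl E.kToOL N.D (N.frobD^[n] d)) = N.frobOL^[n] (N.xi (BC.incl E.kToOL N.D d)) := by
  induction n with
  | zero => rfl
  | succ n ih => rw [Function.iterate_succ_apply', Function.iterate_succ_apply', N.isXi_xi.2, ih]

end PhiModSP

end Amplitude

/-! ### The lattices at the zeros of `φⁿ(E)` -/

section Lattices

set_option linter.unusedSectionVars false

variable {p : ℕ} [hp : Fact p.Prime] {k : Type u} [Field k] [CharP k p] [PerfectRing k p]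

namespace PhiModSP

variable {E : EisensteinPoly p k} (N : PhiModSP E)

/-- The extension of `ξ` to `D ⊗ Ŝₙ[1/φⁿ(E)] → 𝔑 ⊗ Ŝₙ[1/φⁿ(E)]`. -/
noncomputable def xiHat (n : ℕ) : BC (E.kToLhat n) N.D →ₗ[E.Lhat n] BC (E.spToLhat n) N :=
  BC.lift (BC.scomp (E.olToLhat_kToOL n) (BC.change (E.olToLhat n) (E.olToLhat_spToOL n))
    (BC.scomp (RingHom.id_comp _) N.xi (BC.incl E.kToOL N.D)))

theorem xiHat_incl (n : ℕ) (d : N.D) : N.xiHat n (BC.incl (E.kToLhat n) N.D d) =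
    BC.change (E.olToLhat n) (E.olToLhat_spToOL n) (N.xi (BC.incl E.kToOL N.D d)) :=
  BC.lift_incl _ _

theorem xiHat_change (n : ℕ) (x : BC E.kToOL N.D) :
    N.xiHat n (BC.change (E.olToLhat n) (E.olToLhat_kToOL n) x) =
      BC.change (E.olToLhat n) (E.olToLhat_spToOL n) (N.xi x) := by
  refine BC.induction E.kToOL (motive := fun x =>
    N.xiHat n (BC.change (E.olToLhat n) (E.olToLhat_kToOL n) x) =
      BC.change (E.olToLhat n) (E.olToLhat_spToOL n) (N.xi x)) ?_ ?_ ?_ x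
  · simp only [map_zero]
  · intro s d
    simp only [LinearMap.map_smulₛₗ, map_smul, BC.change_incl, xiHat_incl]
  · intro x y hx hy
    simp only [map_add, hx, hy]

theorem xiHat_injective (n : ℕ) : Function.Injective (N.xiHat n) := by
  classical
  set b := Module.Free.chooseBasis (SP p k) N
  obtain ⟨A, B, hAB, hA⟩ := matrix_of_bijective (BC.basis E.kToOL (BC.basis (redSP p k) b))
    (BC.basis E.spToOL b) N.xi N.xi_bijective
  refine (bijective_of_matrix (BC.basis (E.kToLhat n) (BC.basis (redSP p k) b))
    (BC.basis (E.spToLhat n) b) _ (A.map (E.olToLhat n)) (B.map (E.olToLhat n))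
    (map_mul_map_eq_one _ hAB) fun j => ?_).1
  have h1 := hA j
  rw [BC.basis_apply] at h1
  rw [BC.basis_apply, xiHat_incl, h1, map_sum]
  refine Finset.sum_congr rfl fun i _ => ?_
  rw [LinearMap.map_smulₛₗ, BC.basis_apply, BC.basis_apply, BC.change_incl]
  rfl

theorem phiLhat_comp_spToLhat (n : ℕ) : (E.phiLhat n).comp (E.spToLhat 0) =
    (E.olToLhat n).comp ((E.phiOL ^ n).comp E.spToOL) := by
  rw [← E.olToLhat_spToOL 0, ← RingHom.comp_assoc, E.phiLhat_olToLhat, RingHom.comp_assoc]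

/-- The `φⁿ`-semilinear map `Φₙ ∘ φⁿ : 𝔑 ⊗ Ŝ[1/E] → 𝔑 ⊗ Ŝₙ[1/φⁿ(E)]`. -/
noncomputable def frobHat (n : ℕ) : BC (E.spToLhat 0) N →ₛₗ[E.phiLhat n] BC (E.spToLhat n) N :=
  BC.slift (E.phiLhat n) (phiLhat_comp_spToLhat n)
    (BC.scomp rfl (BC.change (E.olToLhat n) (E.olToLhat_spToOL n))
      (BC.scomp rfl (BC.siter N.frobOL n) (BC.incl E.spToOL N)))

theorem frobHat_incl (n : ℕ) (m : N) : N.frobHat n (BC.incl (E.spToLhat 0) N m) =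
    BC.change (E.olToLhat n) (E.olToLhat_spToOL n) (N.frobOL^[n] (BC.incl E.spToOL N m)) :=
  BC.slift_incl _ _ _ _

theorem frobHat_change (n : ℕ) (z : BC E.spToOL N) :
    N.frobHat n (BC.change (E.olToLhat 0) (E.olToLhat_spToOL 0) z) =
      BC.change (E.olToLhat n) (E.olToLhat_spToOL n) (N.frobOL^[n] z) := by
  simp only [← siter_frobOL_apply]
  refine BC.induction E.spToOL (motive := fun z =>
    N.frobHat n (BC.change (E.olToLhat 0) (E.olToLhat_spToOL 0) z) =
      BC.change (E.olToLhat n) (E.olToLhat_spToOL n) (BC.siter N.frobOL n z)) ?_ ?_ ?_ z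
  · simp only [map_zero]
  · intro s m
    simp only [LinearMap.map_smulₛₗ, BC.change_incl, frobHat_incl, siter_frobOL_apply]
    congr 1
    exact RingHom.congr_fun (E.phiLhat_olToLhat n) s
  · intro x y hx hy
    simp only [map_add, hx, hy]

/-- The map `ξ` identifies `φ_D ∘ ⋯ ∘ ᵠⁿφ_D` with `Φₙ ∘ ᵠⁿ(ξ ∘ φ_D)`. -/
theorem xiHat_theta (n : ℕ) (v : BC ((E.kToLhat 0).comp (phi0 p k)) N.D) :
    N.xiHat n (N.toMHP.theta n v) = N.frobHat n (N.xiL (N.phiDL v)) := by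
  refine BC.induction ((E.kToLhat 0).comp (phi0 p k)) (motive := fun v =>
    N.xiHat n (N.toMHP.theta n v) = N.frobHat n (N.xiL (N.phiDL v))) ?_ ?_ ?_ v
  · simp only [map_zero]
  · intro s d
    have h1 : N.toMHP.theta n (BC.incl ((E.kToLhat 0).comp (phi0 p k)) N.D d) =
        BC.incl (E.kToLhat n) N.D (N.frobD^[n + 1] d) := BC.slift_incl _ _ _ _
    have h2 : N.xiL (N.phiDL (BC.incl ((E.kToLhat 0).comp (phi0 p k)) N.D d)) =
        BC.change (E.olToLhat 0) (E.olToLhat_spToOL 0)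
          (N.xi (BC.incl E.kToOL N.D (N.frobD d))) := by
      rw [phiDL, BC.lift_incl]
      exact N.xiHat_incl 0 _
    simp only [LinearMap.map_smulₛₗ, map_smul]
    rw [h1, h2, frobHat_change, xiHat_incl, Function.iterate_succ_apply, xi_frobD_iterate]
  · intro x y hx hy
    simp only [map_add, hx, hy]

theorem exists_mem_V (m : N) : ∃ v ∈ N.V, N.xiL (N.phiDL v) = BC.incl (E.spToLhat 0) N m := by
  obtain ⟨v, hv⟩ := (N.xiL_bijective.comp N.phiDL_bijective).2 (BC.incl (E.spToLhat 0) N m)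
  refine ⟨v, ?_, hv⟩
  change N.xiL (N.phiDL v) ∈ N.hatLattice
  rw [show N.xiL (N.phiDL v) = _ from hv]
  exact Submodule.subset_span ⟨m, rfl⟩

theorem phiLhat_algebraMap (n : ℕ) (a : E.Shat 0) :
    E.phiLhat n (algebraMap (E.Shat 0) (E.Lhat 0) a) =
      algebraMap (E.Shat n) (E.Lhat n) (E.phiShat n a) :=
  locMap_algebraMap (E.Lhat 0) (E.Lhat n) (E.phiShat n) (E.phiShat_serSP n) a

variable {N}

theorem smul_mem_of_mem_range {R : Type*} [CommRing R] {M : Type*} [AddCommGroup M] [Module R M]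
    {n : ℕ} {σ : R →+* E.Lhat n} {L : Submodule (E.Shat n) (BC σ M)} {a : E.Lhat n}
    (ha : a ∈ (algebraMap (E.Shat n) (E.Lhat n)).range) {x : BC σ M} (hx : x ∈ L) : a • x ∈ L := by
  obtain ⟨a, rfl⟩ := ha
  rw [algebraMap_smul]
  exact L.smul_mem a hx

/-- Elements `ξ⁻¹(m)` with `m ∈ 𝔑` are integral at the zeros of `λ`. -/
theorem isIntegralAt_of_xi_mem {s t : ℤ} (h : N.HasAmplitude s t) {x : BC E.kToOL N.D} {m : N}
    (hx : N.xi x = BC.incl E.spToOL N m) : N.toMHP.IsIntegralAt x := by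
  intro n
  obtain ⟨r, b, M, -, hM⟩ := h.exists_matrices
  obtain ⟨H, hH, hH'⟩ := (hM n).2
  choose v hv hv' using fun i => N.exists_mem_V (b i)
  set L := Submodule.span (E.Shat n) (N.toMHP.theta n ''
    (N.toMHP.V : Set (BC ((E.kToLhat 0).comp (phi0 p k)) N.toMHP)))
  -- a preimage of `m` in the lattice
  have hb : ∀ j, ∃ w ∈ L, N.xiHat n w = BC.incl (E.spToLhat n) N (b j) := fun j => by
    refine ⟨∑ i, E.olToLhat n (H j i) • N.toMHP.theta n (v i), Submodule.sum_mem _ fun i _ =>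
      smul_mem_of_mem_range (hH' j i).2 (Submodule.subset_span ⟨v i, hv i, rfl⟩), ?_⟩
    have h2 := congrArg (BC.change (E.olToLhat n) (E.olToLhat_spToOL n)) (hH j)
    rw [BC.change_incl, map_sum] at h2
    rw [h2, map_sum]
    refine Finset.sum_congr rfl fun i _ => ?_
    rw [map_smul, xiHat_theta, hv', frobHat_incl, LinearMap.map_smulₛₗ]
  choose w hw hw' using hb
  have hxw : BC.change (E.olToLhat n) (E.olToLhat_kToOL n) x =
      ∑ j, E.spToLhat n (b.repr m j) • w j := by
    refine N.xiHat_injective n ?_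
    rw [xiHat_change, hx, BC.change_incl, map_sum]
    conv_lhs => rw [← b.sum_repr m]
    rw [map_sum]
    refine Finset.sum_congr rfl fun j _ => ?_
    rw [LinearMap.map_smulₛₗ, LinearMap.map_smul, hw']
  rw [hxw]
  exact Submodule.sum_mem _ fun j _ => smul_mem_of_mem_range ⟨_, rfl⟩ (hw j)

/-- The map `Φₙ ∘ φⁿ` maps `𝔑 ⊗ Ŝ` into `𝔑 ⊗ Ŝₙ`. -/
theorem frobHat_mem_span {r : ℕ} {b : Module.Basis (Fin r) (SP p k) N} {n : ℕ}
    {G : Fin r → Fin r → E.OL} (hG : ∀ j, N.frobOL^[n] (BC.incl E.spToOL N (b j)) =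
      ∑ i, G j i • BC.incl E.spToOL N (b i))
    (hG' : ∀ j i, E.olToLhat n (G j i) ∈ (algebraMap (E.Shat n) (E.Lhat n)).range)
    {y : BC (E.spToLhat 0) N} (hy : y ∈ N.hatLattice) : N.frobHat n y ∈
      Submodule.span (E.Shat n) (Set.range fun i => BC.incl (E.spToLhat n) N (b i)) := by
  have hbL : ∀ j, N.frobHat n (BC.incl (E.spToLhat 0) N (b j)) ∈
      Submodule.span (E.Shat n) (Set.range fun i => BC.incl (E.spToLhat n) N (b i)) := fun j => by
    rw [frobHat_incl, hG, map_sum]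
    refine Submodule.sum_mem _ fun i _ => ?_
    rw [LinearMap.map_smulₛₗ, BC.change_incl]
    exact smul_mem_of_mem_range (hG' j i) (Submodule.subset_span ⟨i, rfl⟩)
  rw [N.hatLattice_eq b] at hy
  obtain ⟨c, rfl⟩ := (Submodule.mem_span_range_iff_exists_fun _).1 hy
  rw [map_sum]
  refine Submodule.sum_mem _ fun j _ => ?_
  rw [← algebraMap_smul (E.Lhat 0) (c j), LinearMap.map_smulₛₗ, phiLhat_algebraMap,
    BC.basis_apply]
  exact smul_mem_of_mem_range ⟨_, rfl⟩ (hbL j)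

theorem olToLhat_repr_mem {r : ℕ} (b : Module.Basis (Fin r) (SP p k) N) (n : ℕ)
    (z : BC E.spToOL N) (hz : BC.change (E.olToLhat n) (E.olToLhat_spToOL n) z ∈
      Submodule.span (E.Shat n) (Set.range fun i => BC.incl (E.spToLhat n) N (b i))) (i : Fin r) :
    E.olToLhat n ((BC.basis E.spToOL b).repr z i) ∈
      (algebraMap (E.Shat n) (E.Lhat n)).range := by
  obtain ⟨c, hc⟩ := (Submodule.mem_span_range_iff_exists_fun _).1 hz
  have h1 : BC.change (E.olToLhat n) (E.olToLhat_spToOL n) z =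
      ∑ i, E.olToLhat n ((BC.basis E.spToOL b).repr z i) • BC.basis (E.spToLhat n) b i := by
    conv_lhs => rw [← (BC.basis E.spToOL b).sum_repr z, map_sum]
    refine Finset.sum_congr rfl fun i _ => ?_
    rw [LinearMap.map_smulₛₗ, BC.basis_apply, BC.basis_apply, BC.change_incl]
  have h2 : BC.change (E.olToLhat n) (E.olToLhat_spToOL n) z =
      ∑ i, algebraMap (E.Shat n) (E.Lhat n) (c i) • BC.basis (E.spToLhat n) b i := by
    rw [← hc]
    refine Finset.sum_congr rfl fun i _ => ?_
    rw [algebraMap_smul, BC.basis_apply]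
  exact ⟨c i, congrFun (coeff_unique (BC.basis (E.spToLhat n) b) (h2.symm.trans h1)) i⟩

theorem mem_of_mem_span {R R' : Type*} [CommRing R] [CommRing R'] {M M' : Type*}
    [AddCommGroup M] [Module R M] [AddCommGroup M'] [Module R' M'] {n : ℕ} {σ : R →+* E.Lhat n}
    {σ' : R' →+* E.Lhat n} (f : BC σ M →ₗ[E.Lhat n] BC σ' M') {S : Set (BC σ M)}
    {L : Submodule (E.Shat n) (BC σ' M')} (h : ∀ x ∈ S, f x ∈ L) {x : BC σ M}
    (hx : x ∈ Submodule.span (E.Shat n) S) : f x ∈ L := by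
  induction hx using Submodule.span_induction with
  | mem x hx => exact h x hx
  | zero => rw [map_zero]; exact L.zero_mem
  | add x y _ _ hx hy => rw [map_add]; exact L.add_mem hx hy
  | smul a x _ hx =>
    rw [← algebraMap_smul (E.Lhat n) a x, map_smul]
    exact smul_mem_of_mem_range ⟨a, rfl⟩ hx

theorem xiHat_mem_of_mem_span {n : ℕ} {L : Submodule (E.Shat n) (BC (E.spToLhat n) N)}
    (hL : ∀ y ∈ N.hatLattice, N.frobHat n y ∈ L) {x : BC (E.kToLhat n) N.D}
    (hx : x ∈ Submodule.span (E.Shat n) (N.toMHP.theta n ''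
      (N.toMHP.V : Set (BC ((E.kToLhat 0).comp (phi0 p k)) N.toMHP)))) : N.xiHat n x ∈ L := by
  refine mem_of_mem_span (N.xiHat n) (fun y hy => ?_) hx
  obtain ⟨v, hv, rfl⟩ := hy
  rw [xiHat_theta]
  exact hL _ hv

/-- The coordinates of `ξ(x)`, for `x` integral at the zeros of `λ`, lie in `𝒪`. -/
theorem repr_xi_mem_O {r : ℕ} {b : Module.Basis (Fin r) (SP p k) N}
    (hb : ∀ n, ∃ G : Fin r → Fin r → E.OL,
        (∀ j, N.frobOL^[n] (BC.incl E.spToOL N (b j)) =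
          ∑ i, G j i • BC.incl E.spToOL N (b i)) ∧
        ∀ j i, E.olToLhat n (G j i) ∈ (algebraMap (E.Shat n) (E.Lhat n)).range)
    {x : BC E.kToOL N.D} (hx : N.toMHP.IsIntegralAt x) (i : Fin r) :
    (((BC.basis E.spToOL b).repr (N.xi x) i : E.OL) : RingA p k) ∈ RingO p k := by
  refine E.mem_O_of_forall_mem_range _ fun n => olToLhat_repr_mem b n _ ?_ i
  obtain ⟨G, hG, hG'⟩ := hb n
  rw [← xiHat_change]
  exact xiHat_mem_of_mem_span (fun y hy => frobHat_mem_span hG hG' hy) (hx n)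

end PhiModSP

end Lattices

/-! ### Coordinates in base changes -/

section Coordinates

namespace BC

variable {R S T : Type*} [CommRing R] [CommRing S] [CommRing T] {M : Type*} [AddCommGroup M]
  [Module R M] {ι : Type*} [Fintype ι]

theorem repr_change {σ : R →+* S} (θ : S →+* T) {τ : R →+* T} (h : θ.comp σ = τ)
    (b : Module.Basis ι R M) (z : BC σ M) (i : ι) :
    (basis τ b).repr (change θ h z) i = θ ((basis σ b).repr z i) := by
  have h1 : change θ h z = ∑ i, θ ((basis σ b).repr z i) • basis τ b i := by
    conv_lhs => rw [← (basis σ b).sum_repr z, map_sum]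
    refine Finset.sum_congr rfl fun i _ => ?_
    rw [LinearMap.map_smulₛₗ, basis_apply, basis_apply, change_incl]
  rw [h1, (basis τ b).repr_sum_self]

theorem repr_incl (σ : R →+* S) (b : Module.Basis ι R M) (m : M) (i : ι) :
    (basis σ b).repr (incl σ M m) i = σ (b.repr m i) := by
  have h1 : incl σ M m = ∑ i, σ (b.repr m i) • basis σ b i := by
    conv_lhs => rw [← b.sum_repr m, map_sum]
    refine Finset.sum_congr rfl fun i _ => ?_
    rw [LinearMap.map_smulₛₗ, basis_apply]
  rw [h1, (basis σ b).repr_sum_self]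

variable [Module.Free R M] [Module.Finite R M]

theorem change_injective {σ : R →+* S} {θ : S →+* T} (hθ : Function.Injective θ) {τ : R →+* T}
    (h : θ.comp σ = τ) : Function.Injective (change (M := M) θ h) := by
  intro x y hxy
  let b := Module.Free.chooseBasis R M
  refine (basis σ b).ext_elem fun i => hθ ?_
  rw [← repr_change θ h, ← repr_change θ h, hxy]

theorem incl_injective {σ : R →+* S} (hσ : Function.Injective σ) :
    Function.Injective (incl σ M) := by
  intro x y hxy
  let b := Module.Free.chooseBasis R M
  refine b.ext_elem fun i => hσ ?_
  rw [← repr_incl, ← repr_incl, hxy]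

end BC

theorem exists_nonneg_upper_bound {ι : Type*} [Finite ι] (f : ι → ℝ) :
    ∃ K : ℝ, 0 ≤ K ∧ ∀ i, f i ≤ K := by
  obtain ⟨K, hK⟩ := (Set.finite_range f).bddAbove
  exact ⟨max K 0, le_max_right _ _, fun i => (hK ⟨i, rfl⟩).trans (le_max_left _ _)⟩

end Coordinates

/-! ### Growth -/

section Growth

set_option linter.unusedSectionVars false

variable {p : ℕ} [hp : Fact p.Prime] {k : Type u} [Field k] [CharP k p] [PerfectRing k p]

namespace PhiModSP

variable {E : EisensteinPoly p k} {N : PhiModSP E}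

/-- Elements `ξ⁻¹(m)` with `m ∈ 𝔑` have bounded growth: the coordinates of
`(φ_D ⋯ ᵠⁿ⁻¹φ_D)⁻¹ x = ᵠⁿξ⁻¹ (Φₙ⁻¹ m)` are controlled by `Φₙ⁻¹` and by the norms of `ξ⁻¹` for the
fixed radius `|π_K|`. -/
theorem isBoundedGrowth_of_xi_mem {s t : ℤ} (h : N.HasAmplitude s t) {x : BC E.kToOL N.D} {m : N}
    (hx : N.xi x = BC.incl E.spToOL N m) : N.toMHP.IsBoundedGrowth x := by
  obtain ⟨r, b, M, hM0, hM⟩ := h.exists_matrices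
  set d : Module.Basis (Fin r) (K0 p k) N.D := BC.basis (redSP p k) b
  choose w hw using fun i => N.xi_bijective.2 (BC.incl E.spToOL N (b i))
  let Z : Fin r → Fin r → E.OL := fun i l => (BC.basis E.kToOL d).repr (w i) l
  have hZ : ∀ i, w i = ∑ l, Z i l • BC.incl E.kToOL N.D (d l) := fun i => by
    conv_lhs => rw [← (BC.basis E.kToOL d).sum_repr (w i)]
    exact Finset.sum_congr rfl fun l _ => by rw [BC.basis_apply]
  obtain ⟨K, hK0, hK⟩ := exists_nonneg_upper_bound
    fun q : Fin r × Fin r => E.normOL (E.zeroRadius 0) (Z q.1 q.2)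
  choose B hB0 hB using fun j => E.exists_normOL_spToOL_le (b.repr m j)
  obtain ⟨B', hB'0, hB'⟩ := exists_nonneg_upper_bound B
  refine ⟨r, d, B' * M * K, fun n => ?_⟩
  obtain ⟨H, hH, hH'⟩ := (hM n).2
  have hr := E.zeroRadius_pos n
  have h1 := E.zeroRadius_lt_one n
  have hexp : x = ∑ l, (∑ j, ∑ i, E.spToOL (b.repr m j) * H j i *
      (E.phiOL ^ n : E.OL →+* E.OL) (Z i l)) • BC.incl E.kToOL N.D (N.frobD^[n] (d l)) := by
    refine N.xi_bijective.1 ?_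
    have h2 : ∀ i, N.frobOL^[n] (BC.incl E.spToOL N (b i)) =
        ∑ l, (E.phiOL ^ n : E.OL →+* E.OL) (Z i l) •
          N.xi (BC.incl E.kToOL N.D (N.frobD^[n] (d l))) := fun i => by
      rw [← hw, hZ, map_sum, ← siter_frobOL_apply, map_sum]
      refine Finset.sum_congr rfl fun l _ => ?_
      rw [LinearMap.map_smul, LinearMap.map_smulₛₗ, siter_frobOL_apply, xi_frobD_iterate]
    have h3 : N.xi x = ∑ j, ∑ i, ∑ l, (E.spToOL (b.repr m j) * H j i *
        (E.phiOL ^ n : E.OL →+* E.OL) (Z i l)) •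
          N.xi (BC.incl E.kToOL N.D (N.frobD^[n] (d l))) := by
      rw [hx]
      conv_lhs => rw [← b.sum_repr m, map_sum]
      refine Finset.sum_congr rfl fun j _ => ?_
      rw [LinearMap.map_smulₛₗ, hH, Finset.smul_sum]
      refine Finset.sum_congr rfl fun i _ => ?_
      rw [h2, Finset.smul_sum, Finset.smul_sum]
      refine Finset.sum_congr rfl fun l _ => ?_
      rw [smul_smul, smul_smul, mul_assoc]
    rw [h3, map_sum]
    simp only [LinearMap.map_smul]
    simp only [Finset.sum_smul]
    conv_rhs => rw [Finset.sum_comm]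
    refine Finset.sum_congr rfl fun j _ => ?_
    exact Finset.sum_comm
  refine ⟨fun l => ∑ j, ∑ i, E.spToOL (b.repr m j) * H j i * (E.phiOL ^ n : E.OL →+* E.OL) (Z i l),
    hexp, fun l => ?_⟩
  refine E.normOL_sum_le hr h1 _ _ (by positivity) fun j _ =>
    E.normOL_sum_le hr h1 _ _ (by positivity) fun i _ => ?_
  rw [E.normOL_mul hr h1, E.normOL_mul hr h1, E.normOL_phiOL_iterate]
  exact mul_le_mul (mul_le_mul ((hB j _ hr h1).trans (hB' j)) (hH' j i).1
    (E.normOL_nonneg hr h1 _) hB'0) (hK (i, l))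
    (E.normOL_nonneg (E.zeroRadius_pos 0) (E.zeroRadius_lt_one 0) _) (by positivity)

/-- The norms of the coordinates of `ξ(x)`, for `x` of bounded growth, are bounded at the radii of
the zeros of `λ`. -/
theorem exists_normOL_repr_xi_le {r : ℕ} {b : Module.Basis (Fin r) (SP p k) N} {M : ℝ} (hM0 : 0 ≤ M)
    (hb : ∀ n, ∃ G : Fin r → Fin r → E.OL,
        (∀ j, N.frobOL^[n] (BC.incl E.spToOL N (b j)) =
          ∑ i, G j i • BC.incl E.spToOL N (b i)) ∧
        ∀ j i, E.normOL (E.zeroRadius n) (G j i) ≤ M)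
    {x : BC E.kToOL N.D} (hx : N.toMHP.IsBoundedGrowth x) (l : Fin r) :
    ∃ C : ℝ, ∀ n, E.normOL (E.zeroRadius n) ((BC.basis E.spToOL b).repr (N.xi x) l) ≤ C := by
  obtain ⟨r', d, C, hC⟩ := hx
  let Z : Fin r' → Fin r → E.OL := fun i j =>
    (BC.basis E.spToOL b).repr (N.xi (BC.incl E.kToOL N.D (d i))) j
  have hZ : ∀ i, N.xi (BC.incl E.kToOL N.D (d i)) = ∑ j, Z i j • BC.incl E.spToOL N (b j) :=
    fun i => by
      conv_lhs => rw [← (BC.basis E.spToOL b).sum_repr (N.xi (BC.incl E.kToOL N.D (d i)))]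
      exact Finset.sum_congr rfl fun l _ => by rw [BC.basis_apply]
  obtain ⟨K, hK0, hK⟩ := exists_nonneg_upper_bound
    fun q : Fin r' × Fin r => E.normOL (E.zeroRadius 0) (Z q.1 q.2)
  refine ⟨max C 0 * K * M, fun n => ?_⟩
  obtain ⟨y, hy, hyC⟩ := hC n
  obtain ⟨G, hG, hG'⟩ := hb n
  have hr := E.zeroRadius_pos n
  have h1 := E.zeroRadius_lt_one n
  have h2 : N.xi x = ∑ l, (∑ i, ∑ j, y i * (E.phiOL ^ n : E.OL →+* E.OL) (Z i j) * G j l) •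
      BC.basis E.spToOL b l := by
    have h3 : N.xi x = ∑ i, ∑ j, ∑ l, (y i * (E.phiOL ^ n : E.OL →+* E.OL) (Z i j) * G j l) •
        BC.basis E.spToOL b l := by
      rw [hy, map_sum]
      refine Finset.sum_congr rfl fun i _ => ?_
      have h4 : N.xi (BC.incl E.kToOL N.D (N.frobD^[n] (d i))) =
          ∑ j, (E.phiOL ^ n : E.OL →+* E.OL) (Z i j) •
            N.frobOL^[n] (BC.incl E.spToOL N (b j)) := by
        rw [xi_frobD_iterate, hZ, ← siter_frobOL_apply, map_sum]
        exact Finset.sum_congr rfl fun j _ => LinearMap.map_smulₛₗ _ _ _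
      rw [LinearMap.map_smul]
      refine (congrArg (y i • ·) h4).trans ?_
      rw [Finset.smul_sum]
      refine Finset.sum_congr rfl fun j _ => ?_
      rw [hG, Finset.smul_sum, Finset.smul_sum]
      refine Finset.sum_congr rfl fun l _ => ?_
      rw [smul_smul, smul_smul, mul_assoc, BC.basis_apply]
    rw [h3]
    simp only [Finset.sum_smul]
    conv_rhs => rw [Finset.sum_comm]
    refine Finset.sum_congr rfl fun i _ => ?_
    exact Finset.sum_comm
  rw [h2, (BC.basis E.spToOL b).repr_sum_self]
  refine E.normOL_sum_le hr h1 _ _ (by positivity) fun i _ =>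
    E.normOL_sum_le hr h1 _ _ (by positivity) fun j _ => ?_
  rw [E.normOL_mul hr h1, E.normOL_mul hr h1, E.normOL_phiOL_iterate]
  exact mul_le_mul (mul_le_mul ((hyC i).trans (le_max_left _ _)) (hK (i, j))
    (E.normOL_nonneg (E.zeroRadius_pos 0) (E.zeroRadius_lt_one 0) _) (le_max_right _ _))
    (hG' j l) (E.normOL_nonneg hr h1 _) (by positivity)

theorem xi_mem_of_mem_tilde {s t : ℤ} (h : N.HasAmplitude s t) {x : BC E.kToOL N.D}
    (hx : x ∈ N.toMHP.tilde) : ∃ m : N, BC.incl E.spToOL N m = N.xi x := by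
  obtain ⟨r, b, M, hM0, hM⟩ := h.exists_matrices
  have hmem : ∀ i, (((BC.basis E.spToOL b).repr (N.xi x) i : E.OL) : RingA p k) ∈ SP p k := by
    intro i
    obtain ⟨C, hC⟩ := exists_normOL_repr_xi_le (b := b) hM0 (fun n => by
      obtain ⟨G, hG, hG'⟩ := (hM n).1
      exact ⟨G, hG, fun j i => (hG' j i).1⟩) hx.2 i
    refine E.mem_SP_of_normOL_le (repr_xi_mem_O (b := b) (fun n => ?_) hx.1 i) hC
    obtain ⟨G, hG, hG'⟩ := (hM n).1
    exact ⟨G, hG, fun j i => (hG' j i).2⟩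
  refine ⟨∑ i, (⟨_, hmem i⟩ : SP p k) • b i, ?_⟩
  conv_rhs => rw [← (BC.basis E.spToOL b).sum_repr (N.xi x)]
  rw [map_sum]
  refine Finset.sum_congr rfl fun i _ => ?_
  rw [LinearMap.map_smulₛₗ, BC.basis_apply]
  rfl

theorem xi_preimage_range {s t : ℤ} (h : N.HasAmplitude s t) :
    N.xi ⁻¹' Set.range (BC.incl E.spToOL N) = N.toMHP.tilde := by
  ext x
  constructor
  · rintro ⟨m, hm⟩
    exact ⟨isIntegralAt_of_xi_mem h hm.symm, isBoundedGrowth_of_xi_mem h hm.symm⟩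
  · exact fun hx => xi_mem_of_mem_tilde h hx

end PhiModSP

end Growth

/-! ### Full faithfulness -/

section FullyFaithful

set_option linter.unusedSectionVars false

variable {p : ℕ} [hp : Fact p.Prime] {k : Type u} [Field k] [CharP k p] [PerfectRing k p]

namespace MHP.Hom

variable {E : EisensteinPoly p k} {D D' : MHP E} (h : MHP.Hom D D')

theorem comm_iterate (n : ℕ) (d : D) : h.toLin (D.frob^[n] d) = D'.frob^[n] (h.toLin d) := by
  induction n with
  | zero => rfl
  | succ n ih => rw [Function.iterate_succ_apply', Function.iterate_succ_apply', h.comm, ih]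

theorem map_theta (n : ℕ) (v : BC ((E.kToLhat 0).comp (phi0 p k)) D) :
    BC.map (E.kToLhat n) h.toLin (D.theta n v) =
      D'.theta n (BC.map ((E.kToLhat 0).comp (phi0 p k)) h.toLin v) := by
  refine BC.induction ((E.kToLhat 0).comp (phi0 p k)) (motive := fun v =>
    BC.map (E.kToLhat n) h.toLin (D.theta n v) =
      D'.theta n (BC.map ((E.kToLhat 0).comp (phi0 p k)) h.toLin v)) ?_ ?_ ?_ v
  · simp only [map_zero]
  · intro s d
    have h1 : ∀ (D : MHP E) (d : D), D.theta n (BC.incl ((E.kToLhat 0).comp (phi0 p k)) D d) =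
        BC.incl (E.kToLhat n) D (D.frob^[n + 1] d) := fun D d => BC.slift_incl _ _ _ _
    rw [LinearMap.map_smulₛₗ, LinearMap.map_smul, LinearMap.map_smul, LinearMap.map_smulₛₗ,
      BC.map_incl, h1, h1, BC.map_incl, h.comm_iterate]
  · intro x y hx hy
    simp only [map_add, hx, hy]

theorem isIntegralAt_map {x : BC E.kToOL D} (hx : D.IsIntegralAt x) :
    D'.IsIntegralAt (BC.map E.kToOL h.toLin x) := by
  intro n
  rw [BC.change_map]
  refine PhiModSP.mem_of_mem_span (BC.map (E.kToLhat n) h.toLin) ?_ (hx n)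
  rintro _ ⟨v, hv, rfl⟩
  rw [map_theta]
  exact Submodule.subset_span ⟨_, h.map_V v hv, rfl⟩

theorem isBoundedGrowth_map {x : BC E.kToOL D} (hx : D.IsBoundedGrowth x) :
    D'.IsBoundedGrowth (BC.map E.kToOL h.toLin x) := by
  obtain ⟨r, b, C, hC⟩ := hx
  let b' := Module.finBasis (K0 p k) D'
  obtain ⟨K, hK0, hK⟩ := exists_nonneg_upper_bound
    fun q : Fin r × Fin (Module.finrank (K0 p k) D') =>
      absK p k (b'.repr (h.toLin (b q.1)) q.2)
  have hphi : ∀ (n : ℕ) (c : K0 p k),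
      absK p k ((phi0 p k ^ n : K0 p k →+* K0 p k) c) = absK p k c := by
    intro n c
    induction n with
    | zero => rfl
    | succ n ih =>
      rw [pow_succ']
      exact (absK_phi0 _).trans ih
  refine ⟨_, b', max C 0 * K, fun n => ?_⟩
  obtain ⟨y, hy, hyC⟩ := hC n
  have hr : 0 < E.absPi ^ (((p : ℝ) ^ n)⁻¹) := E.zeroRadius_pos n
  have h1 : E.absPi ^ (((p : ℝ) ^ n)⁻¹) < 1 := E.zeroRadius_lt_one n
  refine ⟨fun j => ∑ i, y i * E.kToOL ((phi0 p k ^ n : K0 p k →+* K0 p k)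
    (b'.repr (h.toLin (b i)) j)), ?_, fun j => ?_⟩
  · have h2 : ∀ i, BC.map E.kToOL h.toLin (BC.incl E.kToOL D (D.frob^[n] (b i))) =
        ∑ j, E.kToOL ((phi0 p k ^ n : K0 p k →+* K0 p k) (b'.repr (h.toLin (b i)) j)) •
          BC.incl E.kToOL D' (D'.frob^[n] (b' j)) := fun i => by
      have h3 : BC.siter D'.frob n (h.toLin (b i)) =
          ∑ j, (phi0 p k ^ n : K0 p k →+* K0 p k) (b'.repr (h.toLin (b i)) j) •
            BC.siter D'.frob n (b' j) := by
        conv_lhs => rw [← b'.sum_repr (h.toLin (b i)), map_sum]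
        exact Finset.sum_congr rfl fun j _ => LinearMap.map_smulₛₗ _ _ _
      rw [BC.map_incl, h.comm_iterate]
      refine (congrArg (BC.incl E.kToOL D') h3).trans ?_
      rw [map_sum]
      exact Finset.sum_congr rfl fun j _ => LinearMap.map_smulₛₗ _ _ _
    rw [hy, map_sum]
    simp only [LinearMap.map_smul, h2, Finset.smul_sum, Finset.sum_smul, smul_smul]
    exact Finset.sum_comm
  · refine E.normOL_sum_le hr h1 _ _ (by positivity) fun i _ => ?_
    rw [E.normOL_mul hr h1, E.normOL_kToOL hr h1, hphi]
    exact mul_le_mul ((hyC i).trans (le_max_left _ _)) (hK (i, j)) ((absK p k).nonneg _)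
      (le_max_right _ _)

/-- The subset `Ñ` is functorial. -/
theorem map_mem_tilde {x : BC E.kToOL D} (hx : x ∈ D.tilde) :
    BC.map E.kToOL h.toLin x ∈ D'.tilde :=
  ⟨h.isIntegralAt_map hx.1, h.isBoundedGrowth_map hx.2⟩

end MHP.Hom

namespace PhiModSP

variable {E : EisensteinPoly p k}

theorem spToOL_injective : Function.Injective E.spToOL := fun _ _ h =>
  Subtype.ext (congrArg (Subtype.val : E.OL → RingA p k) h)

theorem speToOL_injective : Function.Injective E.speToOL := fun _ _ h =>
  Subtype.ext (congrArg (Subtype.val : E.OL → RingA p k) h)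

variable {N N' : PhiModSP E}

/-- A linear map `𝔑 → 𝔑'` that commutes with `φ` is determined by its reduction modulo `u`. -/
theorem eq_of_map_redSP_eq {f g : N →ₗ[SP p k] N'}
    (hf : ∀ n, BC.map E.spToSPE f (N.frob n) = N'.frob (f n))
    (hg : ∀ n, BC.map E.spToSPE g (N.frob n) = N'.frob (g n))
    (h : BC.map (redSP p k) f = BC.map (redSP p k) g) : f = g := by
  have hinj := BC.incl_injective (M := N') (spToOL_injective (E := E))
  refine LinearMap.ext fun n => hinj ?_
  obtain ⟨x, hx⟩ := N.xi_bijective.2 (BC.incl E.spToOL N n)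
  rw [← BC.map_incl, ← BC.map_incl, ← hx]
  have h1 := LinearMap.congr_fun (xi_map f hf) x
  have h2 := LinearMap.congr_fun (xi_map g hg) x
  rw [h] at h1
  exact h1.symm.trans h2

/-- The transport of `h ⊗ 1` along the maps `ξ` of `𝔑` and `𝔑'`. -/
noncomputable def conjXi (h : MHP.Hom N.toMHP N'.toMHP) :
    BC E.spToOL N →ₗ[E.OL] BC E.spToOL N' :=
  N'.xi ∘ₗ BC.map E.kToOL (M := N.D) (M' := N'.D) h.toLin ∘ₗ
    (LinearEquiv.ofBijective N.xi N.xi_bijective).symm.toLinearMap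

theorem conjXi_xi (h : MHP.Hom N.toMHP N'.toMHP) (x : BC E.kToOL N.D) :
    conjXi h (N.xi x) = N'.xi (BC.map E.kToOL (M := N.D) (M' := N'.D) h.toLin x) := by
  have h1 : (LinearEquiv.ofBijective N.xi N.xi_bijective).symm (N.xi x) = x :=
    (LinearEquiv.ofBijective N.xi N.xi_bijective).symm_apply_apply x
  change N'.xi (BC.map E.kToOL (M := N.D) (M' := N'.D) h.toLin
    ((LinearEquiv.ofBijective N.xi N.xi_bijective).symm (N.xi x))) = _
  rw [h1]

theorem conjXi_frobOL (h : MHP.Hom N.toMHP N'.toMHP) (z : BC E.spToOL N) :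
    conjXi h (N.frobOL z) = N'.frobOL (conjXi h z) := by
  obtain ⟨x, rfl⟩ := N.xi_bijective.2 z
  refine BC.induction E.kToOL (motive := fun x =>
    conjXi h (N.frobOL (N.xi x)) = N'.frobOL (conjXi h (N.xi x))) ?_ ?_ ?_ x
  · simp only [map_zero]
  · intro s d
    have h1 : BC.map E.kToOL (M := N.D) (M' := N'.D) h.toLin
        (BC.incl E.kToOL N.D (N.frobD d)) = BC.incl E.kToOL N'.D (N'.frobD (h.toLin d)) :=
      (BC.map_incl _ _).trans (congrArg _ (h.comm d))
    have h2 : BC.map E.kToOL (M := N.D) (M' := N'.D) h.toLin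
        (BC.incl E.kToOL N.D d) = BC.incl E.kToOL N'.D (h.toLin d) := BC.map_incl _ _
    simp only [LinearMap.map_smulₛₗ, RingHom.id_apply]
    rw [← N.isXi_xi.2, conjXi_xi, conjXi_xi, h1, h2, N'.isXi_xi.2]
  · intro x y hx hy
    simp only [map_add, hx, hy]

/-- A morphism of the associated `φ`-modules of Hodge–Pink is the reduction of a morphism `𝔑 → 𝔑'`,
because `𝔑` is recovered as `ξ(Ñ)`. -/
theorem exists_map_redSP_eq {s t s' t' : ℤ} (hN : N.HasAmplitude s t) (hN' : N'.HasAmplitude s' t')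
    (h : MHP.Hom N.toMHP N'.toMHP) : ∃ f : N →ₗ[SP p k] N',
      (∀ n, BC.map E.spToSPE f (N.frob n) = N'.frob (f n)) ∧
        BC.map (redSP p k) f = h.toLin := by
  have hex : ∀ n : N, ∃ n' : N', BC.incl E.spToOL N' n' = conjXi h (BC.incl E.spToOL N n) := by
    intro n
    obtain ⟨x, hx⟩ := N.xi_bijective.2 (BC.incl E.spToOL N n)
    have h1 : x ∈ N.toMHP.tilde := by
      rw [← xi_preimage_range hN]
      exact ⟨n, hx.symm⟩
    obtain ⟨n', hn'⟩ := xi_mem_of_mem_tilde hN' (h.map_mem_tilde h1)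
    refine ⟨n', ?_⟩
    rw [hn', ← hx, conjXi_xi]
  choose f hf using hex
  have hinj := BC.incl_injective (M := N') (spToOL_injective (E := E))
  let F : N →ₗ[SP p k] N' :=
    { toFun := f
      map_add' := fun x y => hinj (by rw [map_add, hf, hf, hf, map_add, map_add])
      map_smul' := fun c x => hinj (by
        rw [LinearMap.map_smulₛₗ, hf, hf, LinearMap.map_smulₛₗ, LinearMap.map_smul]; rfl) }
  have hF : BC.map E.spToOL F = conjXi h := BC.ext fun n => (BC.map_incl _ _).trans (hf n)
  have hinj' := BC.change_injective (M := N') (speToOL_injective (E := E)) E.speToOL_spToSPE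
  refine ⟨F, fun n => hinj' ?_, LinearMap.ext fun d => ?_⟩
  · rw [BC.change_map, ← frobOL_incl, ← frobOL_incl, hF, conjXi_frobOL]
    exact congrArg _ (hf n).symm
  · have h1 := N.isXi_xi.1 d
    have h2 := N'.isXi_xi.1 (h.toLin d)
    have h3 : BC.map E.kToOL (M := N.D) (M' := N'.D) h.toLin
        (BC.incl E.kToOL N.D d) = BC.incl E.kToOL N'.D (h.toLin d) := BC.map_incl _ _
    rw [← h3, ← conjXi_xi, ← hF, BC.change_map, h1] at h2
    exact h2

end PhiModSP

end FullyFaithful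

end HodgePink

theorem proposition3p10 (p : ℕ) [Fact p.Prime] (k : Type*) [Field k] [CharP k p] [PerfectRing k p]
    (E : HodgePink.EisensteinPoly p k) :
    (∀ N : HodgePink.PIMod E,
      N.xi ⁻¹' Set.range (HodgePink.BC.incl E.spToOL N) =
        ((HodgePink.DIso E).obj N).tilde) ∧
    (HodgePink.DIso E).Full ∧ (HodgePink.DIso E).Faithful := by
  refine ⟨fun N => ?_, ⟨fun {N N'} h => ?_⟩, ⟨fun {N N'} f g hfg => ?_⟩⟩
  · obtain ⟨s, t, -, h⟩ := N.pim
    exact HodgePink.PhiModSP.xi_preimage_range h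
  · obtain ⟨s, t, -, hN⟩ := N.pim
    obtain ⟨s', t', -, hN'⟩ := N'.pim
    obtain ⟨f, hf, hfh⟩ := HodgePink.PhiModSP.exists_map_redSP_eq hN hN' h
    exact ⟨HodgePink.PIMod.Hom.mk f hf, HodgePink.MHP.Hom.ext hfh⟩
  · exact HodgePink.PIMod.Hom.ext (HodgePink.PhiModSP.eq_of_map_redSP_eq
      (HodgePink.PIMod.Hom.comm f) (HodgePink.PIMod.Hom.comm g)
      (congrArg HodgePink.MHP.Hom.toLin hfg))
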